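/- Let $m>0$. For $s,\sigma\in\mathbb R$ let $H^s_\sigma$ be the space of complex tempered distributions $\psi$ on $\mathbb R^3$ with finite norm $\|\psi\|_{H^s_\sigma}=\|\langle x\rangle^{\sigma}\langle\nabla\rangle^{s}\psi\|_{L^2(\mathbb R^3)}$, where $\langle x\rangle=(1+|x|^2)^{1/2}$ and $\langle\nabla\rangle^s=(1-\Delta)^{s/2}$. Let $\mathcal F_\sigma=H^1_\sigma\oplus H^0_\sigma$, with the norm $\|\Psi\|_{\mathcal F_\sigma}=\|\psi\|_{H^1_\sigma}+\|\pi\|_{H^0_\sigma}$ for $\Psi=(\psi,\pi)$. For every $\Psi_0\in\mathcal F_0$ the free Klein–Gordon equation $$ i\dot\Psi(t)=\mathcal H_0\Psi(t),\qquad \mathcal H_0=\begin{pmatrix}0&i\\ i(\Delta-m^2)&0\end{pmatrix},\qquad t\in\mathbb R, $$ understood in the sense of tempered distributions on $\mathbb R^3$ for each $t$, has a unique solution $\Psi\in C(\mathbb R;\mathcal F_0)$ with $\Psi(0)=\Psi_0$. Let $\mathcal U_0(t)\Psi_0=\Psi(t)$ denote the corresponding dynamical group on $\mathcal F_0$. Let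 $\sigma>3/2$. Then $\mathcal F_\sigma\subset\mathcal F_0$, and there is a constant $C>0$, depending only on $m$ and $\sigma$, such that for all $\Psi_0\in\mathcal F_\sigma$ and all $t\in\mathbb R$ $$ \|\mathcal U_0(t)\Psi_0\|_{\mathcal F_{-\sigma}}\le \frac{C}{(1+|t|)^{3/2}}\,\|\Psi_0\|_{\mathcal F_\sigma}. $$ -/

import Mathlib

open scoped ENNReal

noncomputable section

namespace KleinGordon

open MeasureTheory TemperedDistribution Filter
open scoped SchwartzMap Laplacian Topology

/-- Three-dimensional Euclidean space. -/
abbrev R3 : Type := EuclideanSpace ℝ (Fin 3)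

/-- Complex tempered distributions on `ℝ³`. -/
abbrev Dist : Type := 𝓢'(R3, ℂ)

/-- The weight `⟨x⟩ ^ σ`, where `⟨x⟩ = (1 + |x|²) ^ (1/2)`. -/
def weight (σ : ℝ) (x : R3) : ℂ := (((1 + ‖x‖ ^ 2) ^ (σ / 2) : ℝ) : ℂ)

/-- The symbol of `⟨∇⟩ ^ s = (1 - Δ) ^ (s / 2)`. With the normalization `e ^ (-2πi x·ξ)` of the
Fourier transform used in Mathlib, `-Δ` has the symbol `|2πξ|²`. -/
def besselSymbol (s : ℝ) (ξ : R3) : ℂ :=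
  (((1 + ‖(2 * Real.pi) • ξ‖ ^ 2) ^ (s / 2) : ℝ) : ℂ)

theorem hasTemperateGrowth_weight (σ : ℝ) : (weight σ).HasTemperateGrowth := by
  unfold weight
  fun_prop

theorem hasTemperateGrowth_besselSymbol (s : ℝ) : (besselSymbol s).HasTemperateGrowth :=
  (hasTemperateGrowth_weight s).comp
    (((2 * Real.pi) • ContinuousLinearMap.id ℝ R3).hasTemperateGrowth)

/-- The operator `⟨x⟩ ^ σ ⟨∇⟩ ^ s` on tempered distributions. -/
def weightedBessel (s σ : ℝ) : Dist →L[ℂ] Dist :=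
  smulLeftCLM ℂ (weight σ) ∘L fourierMultiplierCLM ℂ (besselSymbol s)

/-- The norm `‖ψ‖_{H^s_σ} = ‖⟨x⟩ ^ σ ⟨∇⟩ ^ s ψ‖_{L²}` of a tempered distribution, with the value
`∞` if `⟨x⟩ ^ σ ⟨∇⟩ ^ s ψ` is not in `L²`. The infimum runs over the `L²` functions that represent
`⟨x⟩ ^ σ ⟨∇⟩ ^ s ψ`; there is at most one. -/
def sobolevNorm (s σ : ℝ) (ψ : Dist) : ℝ≥0∞ :=
  ⨅ (g : Lp ℂ 2 (volume : Measure R3)) (_ : weightedBessel s σ ψ = (g : Dist)), ‖g‖ₑ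

theorem sobolevNorm_eq {s σ : ℝ} {ψ : Dist} {g : Lp ℂ 2 (volume : Measure R3)}
    (h : weightedBessel s σ ψ = (g : Dist)) : sobolevNorm s σ ψ = ‖g‖ₑ := by
  refine le_antisymm (iInf₂_le g h) (le_iInf₂ fun g' h' => ?_)
  have hinj : Function.Injective (Lp.toTemperedDistributionCLM ℂ (volume : Measure R3) 2) :=
    LinearMap.ker_eq_bot.mp Lp.ker_toTemperedDistributionCLM_eq_bot
  have : g = g' := hinj (by simpa using h.symm.trans h')
  rw [this]

/-- Pairs `Ψ = (ψ, π)` of tempered distributions. -/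
abbrev Phase : Type := Dist × Dist

/-- The norm `‖Ψ‖_{𝓕_σ} = ‖ψ‖_{H^1_σ} + ‖π‖_{H^0_σ}`, with values in `[0, ∞]`. -/
def energyNorm (σ : ℝ) (Ψ : Phase) : ℝ≥0∞ :=
  sobolevNorm 1 σ Ψ.1 + sobolevNorm 0 σ Ψ.2

/-- The weighted energy space `𝓕_σ = H^1_σ ⊕ H^0_σ`: the pairs of finite norm. -/
def energySpace (σ : ℝ) : Set Phase := {Ψ | energyNorm σ Ψ < ∞}

/-- The operator `𝓗₀ = ((0, i), (i(Δ - m²), 0))`. -/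
def freeHamiltonian (m : ℝ) (Ψ : Phase) : Phase :=
  (Complex.I • Ψ.2, Complex.I • (Δ Ψ.1 - ((m : ℂ) ^ 2) • Ψ.1))

/-- `Ψ ∈ C(ℝ, 𝓕_0)` is a solution of the free Klein-Gordon equation `i Ψ' = 𝓗₀ Ψ`, the equation
being understood in the sense of tempered distributions on `ℝ³` for every time `t`. -/
structure IsFreeSolution (m : ℝ) (Ψ : ℝ → Phase) : Prop where
  mem : ∀ t, Ψ t ∈ energySpace 0
  continuous : ∀ t, Tendsto (fun s => energyNorm 0 (Ψ s - Ψ t)) (𝓝 t) (𝓝 0)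
  equation_fst : ∀ (t : ℝ) (φ : 𝓢(R3, ℂ)),
    HasDerivAt (fun s => (Ψ s).1 φ) (-Complex.I * (freeHamiltonian m (Ψ t)).1 φ) t
  equation_snd : ∀ (t : ℝ) (φ : 𝓢(R3, ℂ)),
    HasDerivAt (fun s => (Ψ s).2 φ) (-Complex.I * (freeHamiltonian m (Ψ t)).2 φ) t

end KleinGordon

end

/-!
The solution operator is the Fourier multiplier with the entries `cos (t ω)`, `ω⁻¹ sin (t ω)` and
`-ω sin (t ω)`, where `ω = (m² + |k|²) ^ (1/2)`. It preserves `𝓕_0`, and it gives the only solution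
because the pairing of a solution with a test function that evolves backwards in time is constant.

For the decay, duality and conjugation with the Bessel potential reduce the estimate to the bound
`C |t| ^ (-3/2) ‖⟨x⟩ ^ σ f‖ ‖⟨x⟩ ^ σ g‖` of `∫ e ^ (i t ω) a(1/ω) 𝓕⁻ f 𝓕 g` for smooth `a`. With
the group velocity `v = k / ω`, the amplitude `a(1/ω)` is a sum of two parts.

* The part with the factor `ω⁻⁴` has a kernel bounded by `C |t| ^ (-3/2)`: on the planes orthogonal
  to `x` the integral is `e ^ (i t ω)` up to a factor `1 / t` and a remainder, and what is left on
  the axis through `x` decays like `|t| ^ (-1/2)` by van der Corput's estimate. This acts from `L¹`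
  to `L^∞`, and `‖f‖_{L¹} ≤ C ‖⟨x⟩ ^ σ f‖` because `σ > 3/2`.
* The part with the factor `|v|⁴` admits two integrations by parts along `v`, without a singularity
  at the stationary point `v = 0`. Each of them trades a factor `1 / t` for a factor `|x|` on the
  data. Truncating the data at `|x| ~ |t|` turns this into the decay `|t| ^ (-3/2)`.
-/

noncomputable section

namespace KleinGordon

open MeasureTheory TemperedDistribution Filter Set
open scoped SchwartzMap Laplacian Topology FourierTransform Interval

section L2Duality

theorem enorm_integral_mul_le {α : Type*} [MeasurableSpace α] {μ : Measure α} {f g : α → ℂ}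
    (hf : AEStronglyMeasurable f μ) (hg : AEStronglyMeasurable g μ) :
    ‖∫ x, f x * g x ∂μ‖ₑ ≤ eLpNorm f 2 μ * eLpNorm g 2 μ :=
  calc ‖∫ x, f x * g x ∂μ‖ₑ ≤ ∫⁻ x, ‖(f • g) x‖ₑ ∂μ := enorm_integral_le_lintegral_enorm _
    _ = eLpNorm (f • g) 1 μ := eLpNorm_one_eq_lintegral_enorm.symm
    _ ≤ eLpNorm f 2 μ * eLpNorm g 2 μ := eLpNorm_smul_le_mul_eLpNorm hg hf

theorem norm_star_Lp {α : Type*} [MeasurableSpace α] {μ : Measure α} (k : Lp ℂ 2 μ) :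
    ‖star k‖ = ‖k‖ := by
  refine congrArg ENNReal.toReal (eLpNorm_congr_norm_ae ?_)
  filter_upwards [Lp.coeFn_star k] with x hx
  rw [hx, Pi.star_apply, norm_star]

variable {E : Type*} [NormedAddCommGroup E] [InnerProductSpace ℝ E] [FiniteDimensional ℝ E]
  [MeasurableSpace E] [BorelSpace E]

/-- The `L²` norm of a Schwartz function. -/
def l2norm (φ : 𝓢(E, ℂ)) : ℝ := ‖φ.toLp 2‖

theorem l2norm_nonneg (φ : 𝓢(E, ℂ)) : 0 ≤ l2norm φ := norm_nonneg _

theorem ofReal_l2norm (φ : 𝓢(E, ℂ)) : ENNReal.ofReal (l2norm φ) = eLpNorm φ 2 volume := by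
  rw [l2norm, SchwartzMap.norm_toLp, ENNReal.ofReal_toReal (φ.memLp 2 volume).eLpNorm_ne_top]

theorem l2norm_le_mul {f g : 𝓢(E, ℂ)} {K : ℝ} (h : ∀ x, ‖f x‖ ≤ K * ‖g x‖) :
    l2norm f ≤ K * l2norm g := by
  refine Lp.norm_le_mul_norm_of_ae_le_mul ?_
  filter_upwards [f.coeFn_toLp 2, g.coeFn_toLp 2] with x hf hg
  rw [hf, hg]
  exact h x

theorem l2norm_fourier (f : 𝓢(E, ℂ)) : l2norm (𝓕 f) = l2norm f :=
  SchwartzMap.norm_fourier_toL2_eq f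

theorem l2norm_fourierInv (f : 𝓢(E, ℂ)) : l2norm (𝓕⁻ f) = l2norm f := by
  rw [← l2norm_fourier, FourierTransform.fourier_fourierInv_eq]

theorem norm_toTemperedDistribution_apply_le (g : Lp ℂ 2 (volume : Measure E)) (φ : 𝓢(E, ℂ)) :
    ‖(g : 𝓢'(E, ℂ)) φ‖ ≤ ‖g‖ * l2norm φ := by
  have h := enorm_integral_mul_le (φ.continuous.aestronglyMeasurable (μ := volume))
    (Lp.aestronglyMeasurable g)
  rw [← ofReal_l2norm, ← Lp.enorm_def, ← ofReal_norm, ← ofReal_norm,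
    ← ENNReal.ofReal_mul (l2norm_nonneg _),
    ENNReal.ofReal_le_ofReal_iff (mul_nonneg (l2norm_nonneg _) (norm_nonneg _)), mul_comm] at h
  simpa only [Lp.toTemperedDistribution_apply, smul_eq_mul] using h

theorem exists_eq_toTemperedDistribution {u : 𝓢'(E, ℂ)} {C : ℝ} (hC : 0 ≤ C)
    (h : ∀ φ, ‖u φ‖ ≤ C * l2norm φ) :
    ∃ g : Lp ℂ 2 (volume : Measure E), u = (g : 𝓢'(E, ℂ)) ∧ ‖g‖ ≤ C := by
  let e : 𝓢(E, ℂ) →ₗ[ℂ] Lp ℂ 2 (volume : Measure E) :=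
    (SchwartzMap.toLpCLM ℂ ℂ 2 volume).toLinearMap
  let f : 𝓢(E, ℂ) →ₗ[ℂ] ℂ :=
    { toFun := u, map_add' := map_add u, map_smul' := map_smul u }
  have hd : DenseRange e := SchwartzMap.denseRange_toLpCLM ENNReal.ofNat_ne_top
  let L := f.extendOfNorm e
  have hL (φ) : L (e φ) = u φ := LinearMap.extendOfNorm_eq hd ⟨C, h⟩ φ
  have hLC : ‖L‖ ≤ C :=
    L.opNorm_le_bound hC (LinearMap.norm_extendOfNorm_apply_le hd C h)
  let k := (InnerProductSpace.toDual ℂ (Lp ℂ 2 (volume : Measure E))).symm L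
  refine ⟨star k, ?_, (norm_star_Lp k).trans_le ((LinearIsometryEquiv.norm_map _ L).trans_le hLC)⟩
  ext φ
  rw [← hL, ← InnerProductSpace.toDual_symm_apply, Lp.toTemperedDistribution_apply, L2.inner_def]
  apply integral_congr_ae
  filter_upwards [φ.coeFn_toLp 2, Lp.coeFn_star k] with x hφ hk
  rw [hk]
  exact congrArg (· * _) hφ

theorem toTemperedDistribution_injective :
    Function.Injective (Lp.toTemperedDistributionCLM ℂ (volume : Measure E) 2) :=
  LinearMap.ker_eq_bot.mp Lp.ker_toTemperedDistributionCLM_eq_bot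

theorem l2norm_le_of_forall {ψ : 𝓢(E, ℂ)} {C : ℝ} (hC : 0 ≤ C)
    (h : ∀ χ : 𝓢(E, ℂ), ‖∫ x, χ x * ψ x‖ ≤ C * l2norm χ) : l2norm ψ ≤ C := by
  obtain ⟨g, hg, hgC⟩ := exists_eq_toTemperedDistribution (u := (ψ.toLp 2 : 𝓢'(E, ℂ))) hC
    fun φ => by simpa [Lp.toTemperedDistribution_toLp_eq] using h φ
  have : ψ.toLp 2 = g := toTemperedDistribution_injective (by simpa using hg)
  rwa [l2norm, this]

end L2Duality

theorem sobolevNorm_le_of_forall {s σ : ℝ} {u : Dist} {C : ℝ} (hC : 0 ≤ C)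
    (h : ∀ φ, ‖weightedBessel s σ u φ‖ ≤ C * l2norm φ) :
    sobolevNorm s σ u ≤ ENNReal.ofReal C := by
  obtain ⟨g, hg, hgC⟩ := exists_eq_toTemperedDistribution hC h
  rw [sobolevNorm_eq hg, ← ofReal_norm]
  exact ENNReal.ofReal_le_ofReal hgC

theorem exists_eq_of_sobolevNorm_lt_top {s σ : ℝ} {u : Dist} (h : sobolevNorm s σ u < ∞) :
    ∃ g : Lp ℂ 2 (volume : Measure R3), weightedBessel s σ u = (g : Dist) ∧
      sobolevNorm s σ u = ‖g‖ₑ := by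
  by_contra! hne
  have : ∀ g : Lp ℂ 2 (volume : Measure R3), weightedBessel s σ u ≠ (g : Dist) :=
    fun g hg => hne g hg (sobolevNorm_eq hg)
  simp [sobolevNorm, this] at h

/-! ### Van der Corput's estimate and the kernel of the low frequencies -/

section VanDerCorput

open Complex

variable {c p q : ℝ}

theorem sq_norm_add_sq_mul_I (c p : ℝ) : ‖(c + p ^ 2 * I : ℂ)‖ ^ 2 = c ^ 2 + p ^ 4 := by
  rw [Complex.sq_norm, ← ofReal_pow, normSq_add_mul_I]
  ring

theorem add_sq_mul_I_ne_zero (hc : 0 < c) : (c + p ^ 2 * I : ℂ) ≠ 0 := by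
  rw [← norm_ne_zero_iff, ← pow_ne_zero_iff two_ne_zero, sq_norm_add_sq_mul_I]
  positivity

theorem norm_div_add_sq_mul_I_le (hc : 0 < c) : ‖(p / (c + p ^ 2 * I) : ℂ)‖ ≤ 1 / √c := by
  have hD : 0 < ‖(c + p ^ 2 * I : ℂ)‖ := norm_pos_iff.2 (add_sq_mul_I_ne_zero hc)
  rw [norm_div, norm_real, div_le_div_iff₀ hD (Real.sqrt_pos.2 hc), one_mul]
  refine le_of_sq_le_sq ?_ hD.le
  rw [mul_pow, Real.sq_sqrt hc.le, Real.norm_eq_abs, sq_abs, sq_norm_add_sq_mul_I]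
  nlinarith [sq_nonneg (c - p ^ 2), mul_nonneg hc.le (sq_nonneg p)]

theorem norm_add_sq_mul_I_ge (hc : 0 < c) : (c + p ^ 2) / (3 / 2) ≤ ‖(c + p ^ 2 * I : ℂ)‖ := by
  refine le_of_sq_le_sq ?_ (norm_nonneg _)
  rw [sq_norm_add_sq_mul_I]
  nlinarith [sq_nonneg (c - p ^ 2), mul_nonneg hc.le (sq_nonneg p)]

variable {φ φ' φ'' : ℝ → ℝ}

theorem hasDerivAt_div_add_sq_mul_I_mul_cexp (hc : 0 < c) {x : ℝ}
    (hφ : HasDerivAt φ (φ' x) x) (hφ' : HasDerivAt φ' (φ'' x) x) :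
    HasDerivAt (fun x => φ' x / (c + φ' x ^ 2 * I) * cexp (φ x * I))
      (cexp (φ x * I) - (c / (c + φ' x ^ 2 * I)
        - φ'' x * (c - φ' x ^ 2 * I) / (c + φ' x ^ 2 * I) ^ 2) * cexp (φ x * I)) x := by
  have hD : (c + φ' x ^ 2 * I : ℂ) ≠ 0 := add_sq_mul_I_ne_zero hc
  have hp := hφ'.ofReal_comp
  refine ((hp.div (((hp.pow 2).mul_const I).const_add (c : ℂ)) hD).mul
    (hφ.ofReal_comp.mul_const I).cexp).congr_deriv ?_
  simp only [Pi.pow_apply, Pi.div_apply]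
  field_simp
  ring

theorem norm_remainder_le (hc : 0 < c) (hq : c ≤ q) :
    ‖(c / (c + p ^ 2 * I) - q * (c - p ^ 2 * I) / (c + p ^ 2 * I) ^ 2 : ℂ)‖
      ≤ 3 / √c * (1 / (1 + (p / √c) ^ 2) * (q / √c)) := by
  have hD : 0 < ‖(c + p ^ 2 * I : ℂ)‖ := norm_pos_iff.2 (add_sq_mul_I_ne_zero hc)
  have hD' : ‖(c - p ^ 2 * I : ℂ)‖ = ‖(c + p ^ 2 * I : ℂ)‖ := by
    rw [← norm_conj (c + p ^ 2 * I : ℂ)]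
    simp [sub_eq_add_neg]
  have hq0 : 0 ≤ 2 * q := by linarith
  calc ‖(c / (c + p ^ 2 * I) - q * (c - p ^ 2 * I) / (c + p ^ 2 * I) ^ 2 : ℂ)‖
    _ ≤ ‖(c / (c + p ^ 2 * I) : ℂ)‖ + ‖(q * (c - p ^ 2 * I) / (c + p ^ 2 * I) ^ 2 : ℂ)‖ :=
      norm_sub_le _ _
    _ = (c + q) / ‖(c + p ^ 2 * I : ℂ)‖ := by
      rw [norm_div, norm_div, norm_mul, norm_pow, hD', norm_real, norm_real,
        Real.norm_of_nonneg hc.le, Real.norm_of_nonneg (hc.le.trans hq)]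
      field_simp
    _ ≤ 2 * q / ((c + p ^ 2) / (3 / 2)) := by
      gcongr
      · linarith
      · exact norm_add_sq_mul_I_ge hc
    _ = 3 / √c * (1 / (1 + (p / √c) ^ 2) * (q / √c)) := by
      rw [div_pow, Real.sq_sqrt hc.le]
      field_simp
      rw [Real.sq_sqrt hc.le]

theorem norm_integral_remainder_le (hc : 0 < c) {a b : ℝ} (hab : a ≤ b)
    (hφ' : ∀ x, HasDerivAt φ' (φ'' x) x) (hφ'' : Continuous φ'') (h : ∀ x ∈ Icc a b, c ≤ φ'' x) :
    ‖∫ x in a..b, (c / (c + φ' x ^ 2 * I)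
        - φ'' x * (c - φ' x ^ 2 * I) / (c + φ' x ^ 2 * I) ^ 2) * cexp (φ x * I)‖ ≤ 10 / √c := by
  have cφ' : Continuous φ' := continuous_iff_continuousAt.2 fun x => (hφ' x).continuousAt
  let A (x : ℝ) : ℝ := Real.arctan (φ' x / √c)
  have h_int : IntervalIntegrable (fun x => 1 / (1 + (φ' x / √c) ^ 2) * (φ'' x / √c)) volume a b :=
    Continuous.intervalIntegrable (by fun_prop (disch := intros; positivity)) a b
  have hA : ∫ x in a..b, 1 / (1 + (φ' x / √c) ^ 2) * (φ'' x / √c) = A b - A a :=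
    intervalIntegral.integral_eq_sub_of_hasDerivAt (fun x _ => ((hφ' x).div_const _).arctan) h_int
  have hA_le : A b - A a ≤ 10 / 3 := by
    linarith [Real.arctan_lt_pi_div_two (φ' b / √c), Real.neg_pi_div_two_lt_arctan (φ' a / √c),
      Real.pi_lt_d2]
  calc _ ≤ ∫ x in a..b, 3 / √c * (1 / (1 + (φ' x / √c) ^ 2) * (φ'' x / √c)) := by
        refine intervalIntegral.norm_integral_le_of_norm_le hab (.of_forall fun x hx => ?_)
          (h_int.const_mul _)
        rw [norm_mul, norm_exp_ofReal_mul_I, mul_one]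
        exact norm_remainder_le hc (h x (Ioc_subset_Icc_self hx))
    _ = 3 / √c * (A b - A a) := by rw [intervalIntegral.integral_const_mul, hA]
    _ ≤ 3 / √c * (10 / 3) := by gcongr
    _ = 10 / √c := by ring

/-- Integration by parts against `φ' / (c + i φ' ^ 2)`, a substitute for `1 / (i φ')` which is
bounded at the stationary point, so that no neighbourhood of it has to be cut out. -/
theorem norm_integral_cexp_le_of_le (hc : 0 < c) {a b : ℝ} (hab : a ≤ b)
    (hφ : ∀ x, HasDerivAt φ (φ' x) x) (hφ' : ∀ x, HasDerivAt φ' (φ'' x) x)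
    (hφ'' : Continuous φ'') (h : ∀ x ∈ Icc a b, c ≤ φ'' x) :
    ‖∫ x in a..b, cexp (φ x * I)‖ ≤ 12 / √c := by
  have cφ : Continuous φ := continuous_iff_continuousAt.2 fun x => (hφ x).continuousAt
  have cφ' : Continuous φ' := continuous_iff_continuousAt.2 fun x => (hφ' x).continuousAt
  have hD (x) : (c + φ' x ^ 2 * I : ℂ) ≠ 0 := add_sq_mul_I_ne_zero hc
  let W (x : ℝ) : ℂ := φ' x / (c + φ' x ^ 2 * I) * cexp (φ x * I)
  let R (x : ℝ) : ℂ := (c / (c + φ' x ^ 2 * I)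
    - φ'' x * (c - φ' x ^ 2 * I) / (c + φ' x ^ 2 * I) ^ 2) * cexp (φ x * I)
  have cR : Continuous R := by
    have hD2 (x) := pow_ne_zero 2 (hD x)
    fun_prop (disch := assumption)
  have ibp : ∫ x in a..b, cexp (φ x * I) = W b - W a + ∫ x in a..b, R x := by
    have hE : IntervalIntegrable (fun x => cexp (φ x * I)) volume a b :=
      Continuous.intervalIntegrable (by fun_prop) a b
    have hR := cR.intervalIntegrable (μ := volume) a b
    rw [← intervalIntegral.integral_eq_sub_of_hasDerivAt
      (fun x _ => hasDerivAt_div_add_sq_mul_I_mul_cexp hc (hφ x) (hφ' x)) (hE.sub hR),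
      intervalIntegral.integral_sub hE hR, sub_add_cancel]
  have hW (x) : ‖W x‖ ≤ 1 / √c := by
    rw [norm_mul, norm_exp_ofReal_mul_I, mul_one]
    exact norm_div_add_sq_mul_I_le hc
  calc ‖∫ x in a..b, cexp (φ x * I)‖
    _ ≤ ‖W b‖ + ‖W a‖ + ‖∫ x in a..b, R x‖ := by
      rw [ibp]
      exact (norm_add_le _ _).trans (by gcongr; exact norm_sub_le _ _)
    _ ≤ 1 / √c + 1 / √c + 10 / √c := by
      gcongr
      exacts [hW b, hW a, norm_integral_remainder_le hc hab hφ' hφ'' h]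
    _ = 12 / √c := by ring

theorem norm_integral_cexp_le (hc : 0 < c) {a b : ℝ}
    (hφ : ∀ x, HasDerivAt φ (φ' x) x) (hφ' : ∀ x, HasDerivAt φ' (φ'' x) x)
    (hφ'' : Continuous φ'') (h : ∀ x ∈ [[a, b]], c ≤ φ'' x) :
    ‖∫ x in a..b, cexp (φ x * I)‖ ≤ 12 / √c := by
  rcases le_total a b with hab | hab
  · exact norm_integral_cexp_le_of_le hc hab hφ hφ' hφ'' (by rwa [uIcc_of_le hab] at h)
  · rw [intervalIntegral.integral_symm, norm_neg]
    exact norm_integral_cexp_le_of_le hc hab hφ hφ' hφ'' (by rwa [uIcc_of_ge hab] at h)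

end VanDerCorput

/-- The dispersion relation `κ ↦ (m² + κ²) ^ (1/2)`. -/
def disp (m κ : ℝ) : ℝ := √(m ^ 2 + κ ^ 2)

section Dispersion

variable {m : ℝ}

theorem disp_pos (hm : 0 < m) (κ : ℝ) : 0 < disp m κ := Real.sqrt_pos.2 (by positivity)

theorem sq_disp (m κ : ℝ) : disp m κ ^ 2 = m ^ 2 + κ ^ 2 := Real.sq_sqrt (by positivity)

theorem le_disp (m κ : ℝ) : m ≤ disp m κ := Real.le_sqrt_of_sq_le (by nlinarith)

theorem abs_le_disp (m κ : ℝ) : |κ| ≤ disp m κ := Real.abs_le_sqrt (by nlinarith)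

theorem disp_le_disp {κ x : ℝ} (h : |κ| ≤ |x|) : disp m κ ≤ disp m x :=
  Real.sqrt_le_sqrt (by linarith [sq_le_sq.2 h])

theorem continuous_disp (m : ℝ) : Continuous (disp m) := by
  unfold disp
  fun_prop

theorem hasDerivAt_disp (hm : 0 < m) (κ : ℝ) : HasDerivAt (disp m) (κ / disp m κ) κ := by
  have h : HasDerivAt (fun κ => m ^ 2 + κ ^ 2) (2 * κ) κ := by
    simpa using (hasDerivAt_pow 2 κ).const_add (m ^ 2)
  refine (h.sqrt (by positivity)).congr_deriv ?_
  rw [disp, mul_div_mul_left _ _ two_ne_zero]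

theorem hasDerivAt_div_disp (hm : 0 < m) (κ : ℝ) :
    HasDerivAt (fun κ => κ / disp m κ) (m ^ 2 / disp m κ ^ 3) κ := by
  have hp := disp_pos hm κ
  refine ((hasDerivAt_id' κ).div (hasDerivAt_disp hm κ) hp.ne').congr_deriv ?_
  have := sq_disp m κ
  field_simp
  linarith

theorem abs_div_disp_le_one (hm : 0 < m) (κ : ℝ) : |κ / disp m κ| ≤ 1 := by
  rw [abs_div, abs_of_pos (disp_pos hm κ), div_le_one (disp_pos hm κ)]
  exact abs_le_disp m κ

theorem integrable_disp_norm_rpow {E : Type*} [NormedAddCommGroup E] [NormedSpace ℝ E]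
    [FiniteDimensional ℝ E] [MeasurableSpace E] [BorelSpace E] (μ : Measure E) [μ.IsAddHaarMeasure]
    (hm : 0 < m) {s : ℝ} (hs : Module.finrank ℝ E < s) :
    Integrable (fun x => disp m ‖x‖ ^ (-s)) μ := by
  have hc : 0 < min 1 (m ^ 2) := by positivity
  have h_le (x : E) : min 1 (m ^ 2) * (1 + ‖x‖ ^ 2) ≤ m ^ 2 + ‖x‖ ^ 2 := by
    nlinarith [min_le_left 1 (m ^ 2), min_le_right 1 (m ^ 2), sq_nonneg ‖x‖]
  refine ((integrable_rpow_neg_one_add_norm_sq (μ := μ) hs).const_mul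
    (min 1 (m ^ 2) ^ (-s / 2))).mono' (Continuous.aestronglyMeasurable ?_) (.of_forall fun x => ?_)
  · exact ((continuous_disp m).comp continuous_norm).rpow_const
      fun x => .inl (disp_pos hm ‖x‖).ne'
  · rw [Real.norm_of_nonneg (Real.rpow_nonneg (disp_pos hm _).le _),
      ← Real.mul_rpow hc.le (by positivity), disp, Real.sqrt_eq_rpow,
      ← Real.rpow_mul (by positivity), one_div_mul_eq_div]
    exact Real.rpow_le_rpow_of_nonpos (by positivity) (h_le x)
      (by linarith [Nat.cast_nonneg (α := ℝ) (Module.finrank ℝ E)])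

end Dispersion

section OneDimensional

open Complex

variable {m t : ℝ}

theorem norm_integral_cexp_disp_le (hm : 0 < m) (ht : 0 < t) (r x : ℝ) :
    ‖∫ κ in 0..x, cexp ((t * disp m κ + r * κ : ℝ) * I)‖ ≤
      12 / (m * √t) * √(disp m x ^ 3) := by
  have hd := disp_pos hm x
  have hφ (κ) : HasDerivAt (fun κ => t * disp m κ + r * κ) (t * (κ / disp m κ) + r) κ := by
    simpa using ((hasDerivAt_disp hm κ).const_mul t).fun_add ((hasDerivAt_id' κ).const_mul r)
  have hφ' (κ) : HasDerivAt (fun κ => t * (κ / disp m κ) + r) (t * (m ^ 2 / disp m κ ^ 3)) κ :=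
    ((hasDerivAt_div_disp hm κ).const_mul t).add_const r
  have hφ'' : Continuous fun κ => t * (m ^ 2 / disp m κ ^ 3) := by
    have := continuous_disp m
    fun_prop (disch := exact fun κ => pow_ne_zero _ (disp_pos hm κ).ne')
  have hconvex : ∀ κ ∈ [[0, x]], t * (m ^ 2 / disp m x ^ 3) ≤ t * (m ^ 2 / disp m κ ^ 3) := by
    intro κ hκ
    have h0 := disp_pos hm κ
    have : |κ| ≤ |x| := by simpa using abs_sub_left_of_mem_uIcc hκ
    gcongr
    exact disp_le_disp this
  refine (norm_integral_cexp_le (by positivity) hφ hφ' hφ'' hconvex).trans_eq ?_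
  rw [Real.sqrt_mul ht.le, Real.sqrt_div (by positivity), Real.sqrt_sq hm.le]
  field_simp

theorem norm_integral_mul_cexp_disp_le (hm : 0 < m) (ht : 0 < t) (r : ℝ) {β β' : ℝ → ℂ}
    (hβ : ∀ κ, HasDerivAt β (β' κ) κ) (iβ : Integrable fun κ => √(disp m κ ^ 3) * ‖β κ‖)
    (iβ' : Integrable fun κ => √(disp m κ ^ 3) * ‖β' κ‖) :
    ‖∫ κ, β κ * cexp ((t * disp m κ + r * κ : ℝ) * I)‖ ≤
      12 / (m * √t) * ∫ κ, √(disp m κ ^ 3) * ‖β' κ‖ := by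
  let e (κ : ℝ) : ℂ := cexp ((t * disp m κ + r * κ : ℝ) * I)
  let F (x : ℝ) : ℂ := ∫ κ in 0..x, e κ
  have he : Continuous e := by
    have := continuous_disp m
    fun_prop
  have hF (x) : HasDerivAt F (e x) x :=
    intervalIntegral.integral_hasDerivAt_right (he.intervalIntegrable 0 x)
      he.aestronglyMeasurable.stronglyMeasurableAtFilter he.continuousAt
  have F_le (x) : ‖F x‖ ≤ 12 / (m * √t) * √(disp m x ^ 3) := norm_integral_cexp_disp_le hm ht r x
  have hβ'm : Measurable β' := (funext fun κ => (hβ κ).deriv) ▸ measurable_deriv β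
  have cβ : Continuous β := continuous_iff_continuousAt.2 fun κ => (hβ κ).continuousAt
  have cF : Continuous F := continuous_iff_continuousAt.2 fun κ => (hF κ).continuousAt
  have mul_F_le (b : ℂ) (κ : ℝ) : ‖b * F κ‖ ≤ 12 / (m * √t) * (√(disp m κ ^ 3) * ‖b‖) := by
    rw [norm_mul, mul_comm, ← mul_assoc]
    gcongr
    exact F_le κ
  have iβF : Integrable (β * F) :=
    (iβ.const_mul _).mono' (cβ.mul cF).aestronglyMeasurable (.of_forall fun κ => mul_F_le _ κ)
  have iβ'F : Integrable (β' * F) := (iβ'.const_mul _).mono'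
    (hβ'm.aestronglyMeasurable.mul cF.aestronglyMeasurable) (.of_forall fun κ => mul_F_le _ κ)
  have iβe : Integrable (β * e) := by
    refine (iβ.const_mul (1 / √(m ^ 3))).mono' (cβ.mul he).aestronglyMeasurable
      (.of_forall fun κ => ?_)
    have : √(m ^ 3) ≤ √(disp m κ ^ 3) := by
      gcongr
      exact le_disp m κ
    rw [Pi.mul_apply, norm_mul, norm_exp_ofReal_mul_I, mul_one, ← mul_assoc, one_div_mul_eq_div]
    exact le_mul_of_one_le_left (norm_nonneg _) ((one_le_div (by positivity)).2 this)
  rw [integral_mul_deriv_eq_deriv_mul_of_integrable (fun κ _ => hβ κ) (fun κ _ => hF κ)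
    iβe iβ'F iβF, norm_neg, ← integral_const_mul]
  exact norm_integral_le_of_norm_le (iβ'.const_mul _) (.of_forall fun κ => mul_F_le _ κ)

end OneDimensional

section HalfLine

open Complex

variable {c c' c'' : ℝ → ℂ} {M t : ℝ}

theorem integral_Ioi_mul_cexp (ht : t ≠ 0) (hc : ∀ w ∈ Ici M, HasDerivAt c (c' w) w)
    (ic : IntegrableOn c (Ioi M)) (ic' : IntegrableOn c' (Ioi M)) :
    ∫ w in Ioi M, c w * cexp ((t * w : ℝ) * I) =
      -(c M * cexp ((t * M : ℝ) * I) + ∫ w in Ioi M, c' w * cexp ((t * w : ℝ) * I)) / (t * I) := by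
  have htI : (t * I : ℂ) ≠ 0 := by simp [ht]
  let E (w : ℝ) : ℂ := cexp ((t * w : ℝ) * I) / (t * I)
  have hE (w) : HasDerivAt E (cexp ((t * w : ℝ) * I)) w := by
    refine ((((hasDerivAt_id' w).const_mul t).ofReal_comp.mul_const I).cexp.div_const
      (t * I : ℂ)).congr_deriv ?_
    rw [mul_one, mul_div_cancel_right₀ _ htI]
  have cE : Continuous E := continuous_iff_continuousAt.2 fun w => (hE w).continuousAt
  have E_le (w) : ‖E w‖ ≤ 1 / |t| := by
    rw [norm_div, norm_exp_ofReal_mul_I, norm_mul, norm_I, mul_one, norm_real, Real.norm_eq_abs]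
  have hc0 : Tendsto c atTop (𝓝 0) :=
    tendsto_zero_of_hasDerivAt_of_integrableOn_Ioi (fun w hw => hc w (mem_Ici_of_Ioi hw)) ic' ic
  have hbot : Tendsto (c * E) (𝓝[>] M) (𝓝 (c M * E M)) :=
    ((hc M self_mem_Ici).continuousAt.mul cE.continuousAt).tendsto.mono_left nhdsWithin_le_nhds
  have htop : Tendsto (c * E) atTop (𝓝 0) :=
    hc0.zero_mul_isBoundedUnder_le (isBoundedUnder_of ⟨_, E_le⟩)
  rw [integral_Ioi_mul_deriv_eq_deriv_mul (fun w hw => hc w (mem_Ici_of_Ioi hw)) (fun w _ => hE w)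
    (ic.mul_bdd (by fun_prop) (.of_forall fun w => (norm_exp_ofReal_mul_I _).le))
    (ic'.mul_bdd cE.aestronglyMeasurable (.of_forall E_le)) hbot htop]
  simp only [E, mul_div_assoc', integral_div]
  ring

theorem norm_integral_Ioi_mul_cexp_add_le (ht : t ≠ 0) (hc : ∀ w ∈ Ici M, HasDerivAt c (c' w) w)
    (hc' : ∀ w ∈ Ici M, HasDerivAt c' (c'' w) w) (ic : IntegrableOn c (Ioi M))
    (ic' : IntegrableOn c' (Ioi M)) (ic'' : IntegrableOn c'' (Ioi M)) :
    ‖(∫ w in Ioi M, c w * cexp ((t * w : ℝ) * I)) + c M * cexp ((t * M : ℝ) * I) / (t * I)‖ ≤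
      (‖c' M‖ + ∫ w in Ioi M, ‖c'' w‖) / t ^ 2 := by
  rw [integral_Ioi_mul_cexp ht hc ic ic', integral_Ioi_mul_cexp ht hc' ic' ic'', neg_div, add_div,
    neg_add_rev, neg_add_cancel_right, norm_neg, norm_div, norm_div, norm_neg, norm_mul, norm_I,
    mul_one, norm_real, Real.norm_eq_abs, div_div, abs_mul_abs_self, ← sq]
  gcongr
  refine (norm_add_le _ _).trans (add_le_add ?_ ?_)
  · rw [norm_mul, norm_exp_ofReal_mul_I, mul_one]
  · refine (norm_integral_le_integral_norm _).trans_eq ?_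
    simp only [norm_mul, norm_exp_ofReal_mul_I, mul_one]

end HalfLine

section Slicing

open Complex

/-- The plane orthogonal to the first coordinate axis. -/
abbrev R2 : Type := EuclideanSpace ℝ (Fin 2)

/-- The splitting `k ↦ (k₀, (k₁, k₂))` of `ℝ³` into slices orthogonal to the first axis. -/
def splitCoord : R3 ≃ᵐ ℝ × R2 :=
  ((MeasurableEquiv.toLp 2 (Fin 3 → ℝ)).symm.trans
    (MeasurableEquiv.piFinSuccAbove (fun _ : Fin 3 => ℝ) 0)).trans
    (MeasurableEquiv.prodCongr (MeasurableEquiv.refl ℝ) (MeasurableEquiv.toLp 2 (Fin 2 → ℝ)))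

theorem measurePreserving_splitCoord : MeasurePreserving splitCoord :=
  ((MeasurePreserving.id (volume : Measure ℝ)).prod
    (EuclideanSpace.volume_preserving_symm_measurableEquiv_toLp (Fin 2)).symm).comp
    ((volume_preserving_piFinSuccAbove (fun _ : Fin 3 => ℝ) 0).comp
      (EuclideanSpace.volume_preserving_symm_measurableEquiv_toLp (Fin 3)))

theorem norm_eq_disp_splitCoord (k : R3) :
    ‖k‖ = disp (splitCoord k).1 ‖(splitCoord k).2‖ := by
  have h0 : (splitCoord k).1 = k 0 := rfl
  have h1 : (splitCoord k).2 0 = k 1 := rfl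
  have h2 : (splitCoord k).2 1 = k 2 := rfl
  rw [disp, EuclideanSpace.norm_eq, EuclideanSpace.norm_sq_eq, Fin.sum_univ_three,
    Fin.sum_univ_two, h0, h1, h2, add_assoc]
  simp only [Real.norm_eq_abs, sq_abs]

theorem integrable_and_integral_eq_slice {F : ℝ → ℝ → ℂ}
    (hF : Integrable fun k : R3 => F (k 0) ‖k‖) :
    Integrable (fun κ => ∫ y : R2, F κ (disp κ ‖y‖)) ∧
      ∫ k : R3, F (k 0) ‖k‖ = ∫ κ, ∫ y : R2, F κ (disp κ ‖y‖) := by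
  let G (q : ℝ × R2) : ℂ := F q.1 (disp q.1 ‖q.2‖)
  have e : (fun k : R3 => F (k 0) ‖k‖) = G ∘ splitCoord :=
    funext fun k => congrArg (F (k 0)) (norm_eq_disp_splitCoord k)
  rw [e] at hF
  have hG : Integrable G :=
    (measurePreserving_splitCoord.integrable_comp_emb splitCoord.measurableEmbedding).1 hF
  refine ⟨hG.integral_prod_left, ?_⟩
  rw [e, ← integral_prod G hG]
  exact measurePreserving_splitCoord.integral_comp splitCoord.measurableEmbedding G

theorem integral_radial_plane (f : ℝ → ℂ) :
    ∫ y : R2, f ‖y‖ = 2 * Real.pi * ∫ ρ in Ioi (0 : ℝ), ρ * f ρ := by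
  have h_ball : (volume : Measure R2).real (Metric.ball 0 1) = Real.pi := by
    rw [Measure.real, EuclideanSpace.volume_ball_fin_two]
    simp [Real.pi_pos.le]
  rw [integral_fun_norm_addHaar, h_ball]
  simp [mul_assoc]

theorem disp_disp (m κ ρ : ℝ) : disp m (disp κ ρ) = disp (disp m κ) ρ := by
  rw [disp, sq_disp, ← add_assoc, ← sq_disp m κ]
  rfl

variable {m M : ℝ}

theorem injOn_disp : InjOn (disp M) (Ioi 0) := fun a ha b hb h => by
  have := congrArg (· ^ 2) h
  simp only [sq_disp, add_right_inj] at this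
  exact (pow_left_inj₀ (le_of_lt ha) (le_of_lt hb) two_ne_zero).1 this

theorem image_disp_Ioi (hM : 0 < M) : disp M '' Ioi 0 = Ioi M := by
  ext w
  constructor
  · rintro ⟨ρ, hρ : 0 < ρ, rfl⟩
    exact Real.lt_sqrt_of_sq_lt (by linarith [sq_pos_of_pos hρ])
  · intro hw
    have hlt : M ^ 2 < w ^ 2 := pow_lt_pow_left₀ hw hM.le two_ne_zero
    refine ⟨√(w ^ 2 - M ^ 2), Real.sqrt_pos.2 (sub_pos.2 hlt), ?_⟩
    rw [disp, Real.sq_sqrt (sub_nonneg.2 hlt.le), add_sub_cancel, Real.sqrt_sq (hM.trans hw).le]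

theorem integral_Ioi_mul_comp_disp (hM : 0 < M) (f : ℝ → ℂ) :
    ∫ ρ in Ioi (0 : ℝ), ρ * f (disp M ρ) = ∫ w in Ioi M, w * f w := by
  rw [← image_disp_Ioi hM, integral_image_eq_integral_abs_deriv_smul measurableSet_Ioi
    (fun ρ _ => (hasDerivAt_disp hM ρ).hasDerivWithinAt) injOn_disp]
  refine setIntegral_congr_fun measurableSet_Ioi fun ρ (hρ : 0 < ρ) => ?_
  have hd := disp_pos hM ρ
  have hd' : (disp M ρ : ℂ) ≠ 0 := ofReal_ne_zero.2 hd.ne'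
  simp only [abs_of_pos (div_pos hρ hd), real_smul, ofReal_div]
  field_simp

theorem integral_radial_mul_cexp_inner (G : ℝ → ℂ) (z : R3) :
    ∫ k : R3, G ‖k‖ * cexp ((inner ℝ k z : ℝ) * I) =
      ∫ k : R3, G ‖k‖ * cexp ((‖z‖ * k 0 : ℝ) * I) := by
  let w : R3 := EuclideanSpace.single 0 ‖z‖
  let L := Submodule.reflection (ℝ ∙ (z - w))ᗮ
  have hLz : L z = w := Submodule.reflection_sub (by simp [w])
  have h_inner (k : R3) : inner ℝ k z = ‖z‖ * L k 0 := by
    rw [← L.inner_map_map, hLz, EuclideanSpace.inner_single_right, RCLike.conj_to_real]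
  simp_rw [h_inner]
  simpa only [L.norm_map] using L.measurePreserving.integral_comp
    L.toHomeomorph.measurableEmbedding (fun k : R3 => G ‖k‖ * cexp ((‖z‖ * k 0 : ℝ) * I))

end Slicing

section Kernel

open Complex

variable {m K t : ℝ} {c : ℝ → ℝ}

/-- The class of amplitudes of the kernel estimate: `c`, `c'` and `c''` are `O(w⁻³)` on `[m, ∞)`. -/
structure HasCubicDecay (m K : ℝ) (c : ℝ → ℝ) : Prop where
  differentiableAt : ∀ w ≥ m, DifferentiableAt ℝ c w
  differentiableAt_deriv : ∀ w ≥ m, DifferentiableAt ℝ (deriv c) w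
  abs_le : ∀ w ≥ m, |c w| ≤ K / w ^ 3
  abs_deriv_le : ∀ w ≥ m, |deriv c w| ≤ K / w ^ 3
  abs_deriv_deriv_le : ∀ w ≥ m, |deriv (deriv c) w| ≤ K / w ^ 3

theorem integrableOn_Ioi_div_cube {M : ℝ} (hM : 0 < M) (K : ℝ) :
    IntegrableOn (fun w : ℝ => K / w ^ 3) (Ioi M) := by
  refine IntegrableOn.congr_fun ((integrableOn_Ioi_rpow_of_lt (a := -3) (by norm_num) hM).const_mul
    K) (fun w (hw : M < w) => ?_) measurableSet_Ioi
  rw [Real.rpow_neg (hM.trans hw).le, ← div_eq_mul_inv]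
  norm_cast

theorem integral_Ioi_div_cube {M : ℝ} (hM : 0 < M) (K : ℝ) :
    ∫ w in Ioi M, K / w ^ 3 = K / (2 * M ^ 2) := by
  have h_rpow : ∀ w ∈ Ioi M, K / w ^ 3 = K * w ^ (-3 : ℝ) := fun w (hw : M < w) => by
    rw [Real.rpow_neg (hM.trans hw).le, ← div_eq_mul_inv]
    norm_cast
  rw [setIntegral_congr_fun measurableSet_Ioi h_rpow, integral_const_mul,
    integral_Ioi_rpow_of_lt (by norm_num) hM, show (-3 + 1 : ℝ) = -2 by norm_num,
    Real.rpow_neg hM.le, Real.rpow_two]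
  field_simp

theorem integrable_div_disp_norm_pow {E : Type*} [NormedAddCommGroup E] [NormedSpace ℝ E]
    [FiniteDimensional ℝ E] [MeasurableSpace E] [BorelSpace E] (μ : Measure E) [μ.IsAddHaarMeasure]
    (hm : 0 < m) (K : ℝ) {n : ℕ} (hn : Module.finrank ℝ E < n) :
    Integrable (fun x => K / disp m ‖x‖ ^ n) μ := by
  refine ((integrable_disp_norm_rpow μ hm (Nat.cast_lt.2 hn)).const_mul K).congr
    (.of_forall fun x => ?_)
  simp only [Real.rpow_neg (disp_pos hm _).le, Real.rpow_natCast, div_eq_mul_inv]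

theorem integrable_div_disp_pow (hm : 0 < m) (K : ℝ) {n : ℕ} (hn : 1 < n) :
    Integrable fun κ => K / disp m κ ^ n := by
  simpa only [disp, Real.norm_eq_abs, sq_abs] using
    integrable_div_disp_norm_pow (volume : Measure ℝ) hm K (n := n) (by simpa using hn)

theorem integrable_div_sqrt_disp_cube (hm : 0 < m) (K : ℝ) :
    Integrable fun κ => K / √(disp m κ ^ 3) := by
  have h := (integrable_disp_norm_rpow (volume : Measure ℝ) hm (s := 3 / 2)
    (by norm_num)).const_mul K
  simp only [disp, Real.norm_eq_abs, sq_abs] at h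
  refine h.congr (.of_forall fun κ => ?_)
  have hd : 0 ≤ disp m κ := (disp_pos hm κ).le
  change K * disp m κ ^ (-(3 / 2) : ℝ) = K / √(disp m κ ^ 3)
  rw [Real.sqrt_eq_rpow, ← Real.rpow_natCast, ← Real.rpow_mul hd, Real.rpow_neg hd,
    ← div_eq_mul_inv]
  norm_num

theorem integral_plane_comp_disp (hm : 0 < m) (κ : ℝ) (f : ℝ → ℂ) :
    ∫ y : R2, f (disp m (disp κ ‖y‖)) = 2 * Real.pi * ∫ w in Ioi (disp m κ), w * f w := by
  rw [← integral_Ioi_mul_comp_disp (disp_pos hm κ),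
    integral_radial_plane fun ρ => f (disp m (disp κ ρ))]
  simp only [disp_disp]

namespace HasCubicDecay

theorem nonneg (hc : HasCubicDecay m K c) (hm : 0 < m) : 0 ≤ K := by
  have := (abs_nonneg _).trans (hc.abs_le m le_rfl)
  rwa [le_div_iff₀ (by positivity), zero_mul] at this

theorem norm_slice_le (hc : HasCubicDecay m K c) (hm : 0 < m) (ht : t ≠ 0) {M : ℝ} (hM : m ≤ M) :
    ‖(∫ w in Ioi M, c w * cexp ((t * w : ℝ) * I)) + c M * cexp ((t * M : ℝ) * I) / (t * I)‖ ≤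
      K * (1 / m + 1 / 2) / M ^ 2 / t ^ 2 := by
  have hM0 : 0 < M := hm.trans_le hM
  have integrable {f : ℝ → ℝ} (hf : AEStronglyMeasurable f (volume.restrict (Ioi M)))
      (h : ∀ w ≥ m, |f w| ≤ K / w ^ 3) : IntegrableOn (fun w => (f w : ℂ)) (Ioi M) :=
    ((integrableOn_Ioi_div_cube hM0 K).mono' hf ((ae_restrict_mem measurableSet_Ioi).mono
      fun w (hw : M < w) => h w (hM.trans hw.le))).ofReal
  have hc_cont : ContinuousOn c (Ioi M) := fun w (hw : M < w) =>
    (hc.differentiableAt w (hM.trans hw.le)).continuousAt.continuousWithinAt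
  have ic := integrable (hc_cont.aestronglyMeasurable measurableSet_Ioi) hc.abs_le
  have ic' := integrable (stronglyMeasurable_deriv c).aestronglyMeasurable hc.abs_deriv_le
  have ic'' := integrable (stronglyMeasurable_deriv (deriv c)).aestronglyMeasurable
    hc.abs_deriv_deriv_le
  refine (norm_integral_Ioi_mul_cexp_add_le ht
    (fun w hw => (hc.differentiableAt w (hM.trans hw)).hasDerivAt.ofReal_comp)
    (fun w hw => (hc.differentiableAt_deriv w (hM.trans hw)).hasDerivAt.ofReal_comp)
    ic ic' ic'').trans (div_le_div_of_nonneg_right ?_ (sq_nonneg t))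
  have h_int : ∫ w in Ioi M, ‖((deriv (deriv c) w : ℝ) : ℂ)‖ ≤ K / (2 * M ^ 2) := by
    rw [← integral_Ioi_div_cube hM0 K]
    refine setIntegral_mono_on ic''.norm (integrableOn_Ioi_div_cube hM0 K) measurableSet_Ioi
      fun w (hw : M < w) => ?_
    rw [norm_real]
    exact hc.abs_deriv_deriv_le w (hM.trans hw.le)
  have hK := hc.nonneg hm
  calc ‖((deriv c M : ℝ) : ℂ)‖ + ∫ w in Ioi M, ‖((deriv (deriv c) w : ℝ) : ℂ)‖
    _ ≤ K / M ^ 3 + K / (2 * M ^ 2) := by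
      rw [norm_real]
      exact add_le_add (hc.abs_deriv_le M hM) h_int
    _ = K * (1 / M + 1 / 2) / M ^ 2 := by field_simp
    _ ≤ K * (1 / m + 1 / 2) / M ^ 2 := by gcongr

theorem continuous_comp_disp (hc : HasCubicDecay m K c) : Continuous fun κ => c (disp m κ) :=
  continuous_iff_continuousAt.2 fun κ =>
    (hc.differentiableAt _ (le_disp m κ)).continuousAt.comp (continuous_disp m).continuousAt

theorem norm_integral_mul_cexp_disp_le (hc : HasCubicDecay m K c) (hm : 0 < m) (ht : 0 < t)
    (r : ℝ) :
    ‖∫ κ, c (disp m κ) * cexp ((t * disp m κ + r * κ : ℝ) * I)‖ ≤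
      12 / (m * √t) * ∫ κ, K / √(disp m κ ^ 3) := by
  have sqrt_mul_le {κ x : ℝ} (hx : |x| ≤ K / disp m κ ^ 3) :
      √(disp m κ ^ 3) * ‖(x : ℂ)‖ ≤ K / √(disp m κ ^ 3) := by
    rw [norm_real, Real.norm_eq_abs]
    refine (mul_le_mul_of_nonneg_left hx (Real.sqrt_nonneg _)).trans_eq ?_
    rw [mul_div_left_comm, Real.sqrt_div_self', mul_one_div]
  have hβ (κ) : HasDerivAt (fun κ => (c (disp m κ) : ℂ))
      ((deriv c (disp m κ) * (κ / disp m κ) : ℝ) : ℂ) κ :=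
    ((hc.differentiableAt _ (le_disp m κ)).hasDerivAt.comp κ (hasDerivAt_disp hm κ)).ofReal_comp
  have hβ_le (κ) := sqrt_mul_le (hc.abs_le _ (le_disp m κ))
  have hβ'_le (κ) := sqrt_mul_le (κ := κ) (x := deriv c (disp m κ) * (κ / disp m κ)) <| by
    rw [abs_mul]
    exact (mul_le_of_le_one_right (abs_nonneg _) (abs_div_disp_le_one hm κ)).trans
      (hc.abs_deriv_le _ (le_disp m κ))
  have hsq : Continuous fun κ => √(disp m κ ^ 3) := ((continuous_disp m).pow 3).sqrt
  have norm_sqrt_mul (κ : ℝ) (z : ℂ) : ‖√(disp m κ ^ 3) * ‖z‖‖ = √(disp m κ ^ 3) * ‖z‖ :=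
    Real.norm_of_nonneg (by positivity)
  have iβ : Integrable fun κ => √(disp m κ ^ 3) * ‖(c (disp m κ) : ℂ)‖ :=
    (integrable_div_sqrt_disp_cube hm K).mono'
      (hsq.mul (continuous_ofReal.comp hc.continuous_comp_disp).norm).aestronglyMeasurable
      (.of_forall fun κ => (norm_sqrt_mul κ _).trans_le (hβ_le κ))
  have iβ' : Integrable fun κ =>
      √(disp m κ ^ 3) * ‖((deriv c (disp m κ) * (κ / disp m κ) : ℝ) : ℂ)‖ := by
    have h_meas : Measurable fun κ => deriv c (disp m κ) * (κ / disp m κ) :=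
      ((measurable_deriv c).comp (continuous_disp m).measurable).mul
        (measurable_id.div (continuous_disp m).measurable)
    exact (integrable_div_sqrt_disp_cube hm K).mono'
      (hsq.measurable.mul (measurable_ofReal.comp h_meas).norm).aestronglyMeasurable
      (.of_forall fun κ => (norm_sqrt_mul κ _).trans_le (hβ'_le κ))
  refine (KleinGordon.norm_integral_mul_cexp_disp_le hm ht r hβ iβ iβ').trans ?_
  exact mul_le_mul_of_nonneg_left
    (integral_mono iβ' (integrable_div_sqrt_disp_cube hm K) hβ'_le) (by positivity)

theorem norm_integral_slices_le (hc : HasCubicDecay m K c) (hm : 0 < m) (ht : 0 < t) (r : ℝ)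
    (hS : Integrable fun κ =>
      (∫ w in Ioi (disp m κ), c w * cexp ((t * w : ℝ) * I)) * cexp ((r * κ : ℝ) * I)) :
    ‖∫ κ, (∫ w in Ioi (disp m κ), c w * cexp ((t * w : ℝ) * I)) * cexp ((r * κ : ℝ) * I)‖ ≤
      (∫ κ, K * (1 / m + 1 / 2) / disp m κ ^ 2) / t ^ 2 +
        12 / (m * √t) * (∫ κ, K / √(disp m κ ^ 3)) / t := by
  let S (κ : ℝ) : ℂ := ∫ w in Ioi (disp m κ), c w * cexp ((t * w : ℝ) * I)
  let e (κ : ℝ) : ℂ := cexp ((r * κ : ℝ) * I)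
  let B (κ : ℝ) : ℂ := c (disp m κ) * cexp ((t * disp m κ + r * κ : ℝ) * I)
  have hSB (κ) : ‖S κ * e κ + B κ / (t * I)‖ ≤ K * (1 / m + 1 / 2) / disp m κ ^ 2 / t ^ 2 := by
    have h_factor : S κ * e κ + B κ / (t * I) =
        (S κ + c (disp m κ) * cexp ((t * disp m κ : ℝ) * I) / (t * I)) * e κ := by
      simp only [B, e, ofReal_add, add_mul, exp_add]
      ring
    rw [h_factor, norm_mul, norm_exp_ofReal_mul_I, mul_one]
    exact hc.norm_slice_le hm ht.ne' (le_disp m κ)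
  have hB : Integrable B := by
    have := continuous_disp m
    have h_cont : Continuous B := (continuous_ofReal.comp hc.continuous_comp_disp).mul (by fun_prop)
    refine (integrable_div_disp_pow hm K (n := 3) (by norm_num)).mono' h_cont.aestronglyMeasurable
      (.of_forall fun κ => ?_)
    rw [norm_mul, norm_exp_ofReal_mul_I, mul_one, norm_real]
    exact hc.abs_le _ (le_disp m κ)
  have h_split : ∫ κ, S κ * e κ =
      (∫ κ, S κ * e κ + B κ / (t * I)) - (∫ κ, B κ) / (t * I) := by
    rw [integral_add hS (hB.div_const _), integral_div, add_sub_cancel_right]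
  change ‖∫ κ, S κ * e κ‖ ≤ _
  rw [h_split]
  refine (norm_sub_le _ _).trans (add_le_add ?_ ?_)
  · rw [← integral_div]
    exact norm_integral_le_of_norm_le ((integrable_div_disp_pow hm _ one_lt_two).div_const _)
      (.of_forall hSB)
  · rw [norm_div, norm_mul, norm_I, mul_one, norm_real, Real.norm_of_nonneg ht.le]
    exact div_le_div_of_nonneg_right (hc.norm_integral_mul_cexp_disp_le hm ht r) ht.le

theorem integrable_comp_disp_norm (hc : HasCubicDecay m K c) (hm : 0 < m) :
    Integrable fun k : R3 => c (disp m ‖k‖) / disp m ‖k‖ := by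
  have hd : Continuous fun k : R3 => disp m ‖k‖ := (continuous_disp m).comp continuous_norm
  refine (integrable_div_disp_norm_pow (volume : Measure R3) hm K (n := 4) (by simp)).mono'
    (((hc.continuous_comp_disp.comp continuous_norm).div hd
      fun k => (disp_pos hm _).ne').aestronglyMeasurable) (.of_forall fun k => ?_)
  have hd := disp_pos hm ‖k‖
  rw [Real.norm_eq_abs, abs_div, abs_of_pos hd, div_le_iff₀ hd]
  refine (hc.abs_le _ (le_disp m _)).trans_eq ?_
  field_simp

theorem integral_kernel_eq (hc : HasCubicDecay m K c) (hm : 0 < m) (t : ℝ) (x : R3) :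
    Integrable (fun κ =>
      (∫ w in Ioi (disp m κ), c w * cexp ((t * w : ℝ) * I)) * cexp ((‖x‖ * κ : ℝ) * I)) ∧
    ∫ k : R3, (c (disp m ‖k‖) / disp m ‖k‖ : ℝ) * cexp ((t * disp m ‖k‖ : ℝ) * I) *
        cexp ((inner ℝ k x : ℝ) * I) =
      2 * Real.pi * ∫ κ, (∫ w in Ioi (disp m κ), c w * cexp ((t * w : ℝ) * I)) *
        cexp ((‖x‖ * κ : ℝ) * I) := by
  let f (w : ℝ) : ℂ := (c w / w : ℝ) * cexp ((t * w : ℝ) * I)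
  let e (κ : ℝ) : ℂ := cexp ((‖x‖ * κ : ℝ) * I)
  have h_int : Integrable fun k : R3 => f (disp m ‖k‖) * e (k 0) := by
    have hd : Continuous fun k : R3 => disp m ‖k‖ := (continuous_disp m).comp continuous_norm
    refine ((hc.integrable_comp_disp_norm hm).ofReal.mul_bdd (c := 1)
      (Continuous.aestronglyMeasurable (by fun_prop)) (.of_forall fun k => ?_)).mul_bdd (c := 1)
      (Continuous.aestronglyMeasurable (by fun_prop)) (.of_forall fun k => ?_)
    all_goals exact (norm_exp_ofReal_mul_I _).le
  have h_slice (κ) : ∫ y : R2, f (disp m (disp κ ‖y‖)) * e κ =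
      2 * Real.pi * ((∫ w in Ioi (disp m κ), c w * cexp ((t * w : ℝ) * I)) * e κ) := by
    rw [integral_mul_const, integral_plane_comp_disp hm, mul_assoc]
    congr 2
    refine setIntegral_congr_fun measurableSet_Ioi fun w (hw : disp m κ < w) => ?_
    have hw0 : (w : ℂ) ≠ 0 := ofReal_ne_zero.2 ((disp_pos hm κ).trans hw).ne'
    simp only [f, ofReal_div]
    field_simp
  obtain ⟨h_int', h_eq⟩ :=
    integrable_and_integral_eq_slice (F := fun κ ρ => f (disp m ρ) * e κ) h_int
  simp only [h_slice] at h_int' h_eq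
  refine ⟨(integrable_const_mul_iff (c := (2 * Real.pi : ℂ))
    (isUnit_iff_ne_zero.2 (by simp [Real.pi_ne_zero])) _).1 h_int', ?_⟩
  rw [← integral_const_mul, ← h_eq]
  exact integral_radial_mul_cexp_inner (fun ρ => f (disp m ρ)) x

/-- The constant of the kernel estimate, collecting the boundary and the remainder terms of the
slices. -/
def kernelConst (m K : ℝ) : ℝ :=
  2 * Real.pi * ((∫ κ, K * (1 / m + 1 / 2) / disp m κ ^ 2) + 12 / m * ∫ κ, K / √(disp m κ ^ 3))

theorem norm_kernel_le_of_one_le (hc : HasCubicDecay m K c) (hm : 0 < m) (ht : 1 ≤ t) (x : R3) :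
    ‖∫ k : R3, (c (disp m ‖k‖) / disp m ‖k‖ : ℝ) * cexp ((t * disp m ‖k‖ : ℝ) * I) *
        cexp ((inner ℝ k x : ℝ) * I)‖ ≤ kernelConst m K / (t * √t) := by
  have ht0 : 0 < t := by linarith
  have hK := hc.nonneg hm
  obtain ⟨h_int, h_eq⟩ := hc.integral_kernel_eq hm t x
  have h_sqrt : √t ≤ t := Real.sqrt_le_self_iff.2 (.inr ht)
  have h_two_pi : ‖(2 * Real.pi : ℂ)‖ = 2 * Real.pi := by simp [Real.pi_pos.le]
  rw [h_eq, norm_mul, h_two_pi, kernelConst, mul_div_assoc]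
  refine mul_le_mul_of_nonneg_left
    ((hc.norm_integral_slices_le hm ht0 ‖x‖ h_int).trans ?_) (by positivity)
  rw [add_div, sq]
  refine add_le_add (by gcongr) (le_of_eq ?_)
  field_simp

theorem norm_kernel_le (hc : HasCubicDecay m K c) (hm : 0 < m) (ht : 1 ≤ |t|) (x : R3) :
    ‖∫ k : R3, (c (disp m ‖k‖) / disp m ‖k‖ : ℝ) * cexp ((t * disp m ‖k‖ : ℝ) * I) *
        cexp ((inner ℝ k x : ℝ) * I)‖ ≤ kernelConst m K / (|t| * √|t|) := by
  rcases le_or_gt 0 t with h | h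
  · rw [abs_of_nonneg h] at ht ⊢
    exact hc.norm_kernel_le_of_one_le hm ht x
  · rw [abs_of_neg h] at ht ⊢
    refine (le_of_eq ?_).trans (hc.norm_kernel_le_of_one_le hm ht (-x))
    rw [← RCLike.norm_conj, ← integral_conj]
    simp only [map_mul, ← exp_conj, conj_I, conj_ofReal, inner_neg_right, ofReal_neg, neg_mul,
      mul_neg]

end HasCubicDecay

end Kernel

/-! ### Symbols in the group velocity and the inverse frequency -/

section Amplitude

variable {m : ℝ} {a : ℝ → ℝ}

/-- Amplitudes `a(ω⁻¹)` depending on the frequency through `ω⁻¹ ∈ (0, m⁻¹]`; smoothness up to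
`ω⁻¹ = 0` encodes symbol-type decay of the derivatives as `ω → ∞`. -/
def IsAmplitude (m : ℝ) (n : ℕ) (a : ℝ → ℝ) : Prop := ∀ y ∈ Icc 0 m⁻¹, ContDiffAt ℝ n a y

theorem inv_mem_Icc (hm : 0 < m) {w : ℝ} (hw : m ≤ w) : w⁻¹ ∈ Icc 0 m⁻¹ :=
  ⟨inv_nonneg.2 (hm.le.trans hw), inv_anti₀ hm hw⟩

/-- The amplitude `b` with `(w⁻³ a(w⁻¹))' = w⁻³ b(w⁻¹)`. -/
def cubicDeriv (a : ℝ → ℝ) (y : ℝ) : ℝ := -(3 * y * a y + y ^ 2 * deriv a y)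

theorem hasDerivAt_inv_cube_mul {w : ℝ} (hw : w ≠ 0) (ha : DifferentiableAt ℝ a w⁻¹) :
    HasDerivAt (fun w => w⁻¹ ^ 3 * a w⁻¹) (w⁻¹ ^ 3 * cubicDeriv a w⁻¹) w := by
  refine (((hasDerivAt_inv hw).fun_pow 3).mul
    (ha.hasDerivAt.comp w (hasDerivAt_inv hw))).congr_deriv ?_
  simp only [cubicDeriv, Function.comp_apply, inv_pow]
  field_simp
  norm_num
  field_simp
  ring

namespace IsAmplitude

theorem of_succ {n : ℕ} (ha : IsAmplitude m (n + 1) a) : IsAmplitude m n a := fun y hy =>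
  (ha y hy).of_le (by norm_cast; omega)

theorem cubicDeriv {n : ℕ} (ha : IsAmplitude m (n + 1) a) :
    IsAmplitude m n (cubicDeriv a) := fun y hy => by
  have h' : ContDiffAt ℝ n (deriv a) y :=
    ((ha y hy).fderiv_right (m := n) le_rfl).clm_apply contDiffAt_const
  have h : ContDiffAt ℝ n a y := ha.of_succ y hy
  unfold KleinGordon.cubicDeriv
  fun_prop

theorem exists_abs_le {n : ℕ} (ha : IsAmplitude m n a) (hm : 0 < m) :
    ∃ K, ∀ w ≥ m, |w⁻¹ ^ 3 * a w⁻¹| ≤ K / w ^ 3 := by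
  obtain ⟨K, hK⟩ := isCompact_Icc.exists_bound_of_continuousOn
    fun y hy => (ha y hy).continuousAt.continuousWithinAt
  refine ⟨K, fun w hw => ?_⟩
  have hw0 := hm.trans_le hw
  rw [abs_mul, abs_of_pos (by positivity), inv_pow, inv_mul_eq_div]
  gcongr
  exact hK _ (inv_mem_Icc hm hw)

theorem exists_hasCubicDecay (ha : IsAmplitude m 2 a) (hm : 0 < m) :
    ∃ K, HasCubicDecay m K fun w => w⁻¹ ^ 3 * a w⁻¹ := by
  have hb := ha.cubicDeriv
  have hc := hb.cubicDeriv
  obtain ⟨K₀, h₀⟩ := ha.exists_abs_le hm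
  obtain ⟨K₁, h₁⟩ := hb.exists_abs_le hm
  obtain ⟨K₂, h₂⟩ := hc.exists_abs_le hm
  have d₁ (w) (hw : m ≤ w) := hasDerivAt_inv_cube_mul (hm.trans_le hw).ne'
    ((ha _ (inv_mem_Icc hm hw)).differentiableAt two_ne_zero)
  have d₂ (w) (hw : m ≤ w) := hasDerivAt_inv_cube_mul (hm.trans_le hw).ne'
    ((hb _ (inv_mem_Icc hm hw)).differentiableAt one_ne_zero)
  have e (w) (hw : m ≤ w) : deriv (fun w => w⁻¹ ^ 3 * a w⁻¹) =ᶠ[𝓝 w]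
      fun w => w⁻¹ ^ 3 * KleinGordon.cubicDeriv a w⁻¹ := by
    have hw0 := (hm.trans_le hw).ne'
    filter_upwards [eventually_ne_nhds hw0, (tendsto_inv₀ hw0).eventually
      ((ha _ (inv_mem_Icc hm hw)).eventually (by simp))] with x hx0 hx
    exact (hasDerivAt_inv_cube_mul hx0 (hx.differentiableAt two_ne_zero)).deriv
  have le_max {K x w : ℝ} (hw : m ≤ w) (h : |x| ≤ K / w ^ 3) (hK : K ≤ max K₀ (max K₁ K₂)) :
      |x| ≤ max K₀ (max K₁ K₂) / w ^ 3 :=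
    h.trans (div_le_div_of_nonneg_right hK (pow_pos (hm.trans_le hw) 3).le)
  exact ⟨max K₀ (max K₁ K₂), fun w hw => (d₁ w hw).differentiableAt,
    fun w hw => (d₂ w hw).differentiableAt.congr_of_eventuallyEq (e w hw),
    fun w hw => le_max hw (h₀ w hw) (by simp),
    fun w hw => le_max hw ((d₁ w hw).deriv ▸ h₁ w hw) (by simp),
    fun w hw => le_max hw ((e w hw).deriv_eq ▸ (d₂ w hw).deriv ▸ h₂ w hw) (by simp)⟩

end IsAmplitude

end Amplitude

section VelocitySymbol

variable {E : Type*} [NormedAddCommGroup E] [InnerProductSpace ℝ E] {m : ℝ} {n : ℕ}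

/-- The frequency `ω(ξ) = (m² + |2πξ|²) ^ (1/2)`, where `2πξ` is the wave vector belonging to `ξ`
in the normalization of the Fourier transform used in Mathlib. -/
def omega (m : ℝ) (ξ : E) : ℝ := disp m ‖(2 * Real.pi) • ξ‖

/-- The group velocity `v = 2πξ / ω` together with `1 / ω`. -/
def velPoint (m : ℝ) (ξ : E) : E × ℝ :=
  ((omega m ξ)⁻¹ • (2 * Real.pi) • ξ, (omega m ξ)⁻¹)

/-- A compact set containing the range of `velPoint m`. -/
def velRegion (E : Type*) [NormedAddCommGroup E] (m : ℝ) : Set (E × ℝ) :=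
  Metric.closedBall 0 1 ×ˢ Icc 0 m⁻¹

/-- Symbols `Q(v, 1 / ω)` of order zero, as functions of the coordinates `velPoint`. -/
def IsSymbol (m : ℝ) (n : ℕ) (Q : E × ℝ → ℝ) : Prop :=
  ∀ p ∈ velRegion E m, ContDiffAt ℝ n Q p

/-- The vector field `∂_h` on `ξ`-space, expressed in the coordinates `velPoint`. -/
def velField (h : E) (p : E × ℝ) : E × ℝ :=
  (2 * Real.pi * p.2) • (h - inner ℝ p.1 h • p.1, -(inner ℝ p.1 h * p.2))

/-- The derivative `∂_h` of a symbol, expressed in the coordinates `velPoint`. -/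
def velDeriv (h : E) (Q : E × ℝ → ℝ) (p : E × ℝ) : ℝ := fderiv ℝ Q p (velField h p)

theorem omega_pos (hm : 0 < m) (ξ : E) : 0 < omega m ξ := disp_pos hm _

theorem sq_omega (m : ℝ) (ξ : E) : omega m ξ ^ 2 = m ^ 2 + ‖(2 * Real.pi) • ξ‖ ^ 2 := sq_disp _ _

theorem hasFDerivAt_omega (hm : 0 < m) (ξ : E) :
    HasFDerivAt (omega m) ((2 * Real.pi) • innerSL ℝ (velPoint m ξ).1) ξ := by
  have h := ((((hasFDerivAt_id ξ).const_smul (2 * Real.pi)).norm_sq.const_add (m ^ 2)).sqrt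
    (by positivity))
  refine h.congr_fderiv ?_
  ext x
  have : √(m ^ 2 + ‖(2 * Real.pi) • ξ‖ ^ 2) = omega m ξ := rfl
  simp [this, velPoint]
  ring

theorem continuous_omega (hm : 0 < m) : Continuous (omega m : E → ℝ) :=
  continuous_iff_continuousAt.2 fun ξ => (hasFDerivAt_omega hm ξ).continuousAt

theorem hasFDerivAt_inv_omega (hm : 0 < m) (ξ : E) : HasFDerivAt (fun ξ : E => (omega m ξ)⁻¹)
    (-((omega m ξ)⁻¹ ^ 2 * (2 * Real.pi)) • innerSL ℝ (velPoint m ξ).1) ξ := by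
  refine ((hasDerivAt_inv (omega_pos hm ξ).ne').comp_hasFDerivAt ξ
    (hasFDerivAt_omega hm ξ)).congr_fderiv ?_
  rw [smul_smul, inv_pow, neg_mul]

theorem differentiable_velPoint (hm : 0 < m) : Differentiable ℝ (velPoint m : E → E × ℝ) :=
  fun ξ => ((hasFDerivAt_inv_omega hm ξ).smul
    ((hasFDerivAt_id ξ).const_smul (2 * Real.pi))).differentiableAt.prodMk
    (hasFDerivAt_inv_omega hm ξ).differentiableAt

theorem fderiv_velPoint_apply (hm : 0 < m) (ξ h : E) :
    fderiv ℝ (velPoint m) ξ h = velField h (velPoint m ξ) := by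
  have := ((hasFDerivAt_inv_omega hm ξ).smul
    ((hasFDerivAt_id ξ).const_smul (2 * Real.pi))).prodMk (hasFDerivAt_inv_omega hm ξ)
  rw [HasFDerivAt.fderiv (f := velPoint m) this]
  simp only [velField, velPoint, ContinuousLinearMap.prod_apply, Prod.smul_mk, smul_apply,
    add_apply, ContinuousLinearMap.smulRight_apply, ContinuousLinearMap.id_apply,
    innerSL_apply_apply, smul_eq_mul, Pi.smul_apply, id_eq, Prod.mk.injEq]
  constructor
  · module
  · ring

theorem velPoint_mem_velRegion (hm : 0 < m) (ξ : E) : velPoint m ξ ∈ velRegion E m := by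
  refine ⟨?_, inv_mem_Icc hm (le_disp _ _)⟩
  rw [mem_closedBall_zero_iff, velPoint, norm_smul, norm_inv, inv_mul_eq_div,
    Real.norm_of_nonneg (omega_pos hm ξ).le]
  exact (le_abs_self _).trans (abs_div_disp_le_one hm _)

theorem isCompact_velRegion [FiniteDimensional ℝ E] (m : ℝ) : IsCompact (velRegion E m) :=
  have := FiniteDimensional.proper_real E
  (isCompact_closedBall _ _).prod isCompact_Icc

theorem norm_velPoint_sq (hm : 0 < m) (ξ : E) :
    ‖(velPoint m ξ).1‖ ^ 2 = 1 - m ^ 2 * (velPoint m ξ).2 ^ 2 := by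
  have := sq_omega m ξ
  have := (omega_pos hm ξ).ne'
  simp only [velPoint, norm_smul (omega m ξ)⁻¹, norm_inv, mul_pow, inv_pow, Real.norm_eq_abs,
    sq_abs]
  field_simp
  linarith

theorem IsAmplitude.isSymbol {a : ℝ → ℝ} (ha : IsAmplitude m n a) :
    IsSymbol m n fun p : E × ℝ => a p.2 := fun p hp => (ha _ hp.2).comp p contDiffAt_snd

namespace IsSymbol

variable {P Q : E × ℝ → ℝ}

theorem of_succ (hQ : IsSymbol m (n + 1) Q) : IsSymbol m n Q := fun p hp =>
  (hQ p hp).of_le (by norm_cast; omega)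

theorem inner_left (h : E) : IsSymbol m n fun p : E × ℝ => inner ℝ p.1 h := fun _ _ =>
  contDiffAt_fst.inner ℝ contDiffAt_const

theorem add (hP : IsSymbol m n P) (hQ : IsSymbol m n Q) : IsSymbol m n fun p => P p + Q p :=
  fun p hp => (hP p hp).add (hQ p hp)

theorem mul (hP : IsSymbol m n P) (hQ : IsSymbol m n Q) : IsSymbol m n fun p => P p * Q p :=
  fun p hp => (hP p hp).mul (hQ p hp)

theorem norm_sq_sq_mul (hQ : IsSymbol m n Q) : IsSymbol m n fun p => (‖p.1‖ ^ 2) ^ 2 * Q p :=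
  fun p hp => ((contDiffAt_fst.norm_sq ℝ).pow 2).mul (hQ p hp)

theorem velDeriv (hQ : IsSymbol m (n + 1) Q) (h : E) : IsSymbol m n (velDeriv h Q) :=
  fun p hp => ((hQ p hp).fderiv_right le_rfl).clm_apply <| by
    have hi : ContDiffAt ℝ n (fun p : E × ℝ => inner ℝ p.1 h) p := inner_left h p hp
    unfold velField
    fun_prop

theorem differentiableAt (hQ : IsSymbol m 1 Q) {p : E × ℝ} (hp : p ∈ velRegion E m) :
    DifferentiableAt ℝ Q p := (hQ p hp).differentiableAt one_ne_zero

theorem hasFDerivAt_comp (hQ : IsSymbol m 1 Q) (hm : 0 < m) (ξ : E) :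
    HasFDerivAt (fun ξ => Q (velPoint m ξ))
      ((fderiv ℝ Q (velPoint m ξ)).comp (fderiv ℝ (velPoint m) ξ)) ξ :=
  (hQ.differentiableAt (velPoint_mem_velRegion hm ξ)).hasFDerivAt.comp ξ
    (differentiable_velPoint hm ξ).hasFDerivAt

theorem continuous_comp (hQ : IsSymbol m 0 Q) (hm : 0 < m) :
    Continuous fun ξ => Q (velPoint m ξ) :=
  continuous_iff_continuousAt.2 fun ξ => (hQ _ (velPoint_mem_velRegion hm ξ)).continuousAt.comp
    (differentiable_velPoint hm ξ).continuousAt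

theorem exists_abs_le [FiniteDimensional ℝ E] (hQ : IsSymbol m 0 Q) (hm : 0 < m) :
    ∃ C, 0 ≤ C ∧ ∀ ξ, |Q (velPoint m ξ)| ≤ C := by
  obtain ⟨C, hC⟩ := (isCompact_velRegion m).exists_bound_of_continuousOn
    fun p hp => (hQ p hp).continuousAt.continuousWithinAt
  have hC (ξ) := hC _ (velPoint_mem_velRegion hm ξ)
  exact ⟨C, (norm_nonneg _).trans (hC 0), hC⟩

end IsSymbol

theorem velDeriv_inner_sq_mul (h k : E) {Q : E × ℝ → ℝ} {p : E × ℝ}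
    (hQ : DifferentiableAt ℝ Q p) :
    velDeriv h (fun p => inner ℝ p.1 k ^ 2 * Q p) p =
      inner ℝ p.1 k * (2 * velDeriv h (fun p => inner ℝ p.1 k) p * Q p +
        inner ℝ p.1 k * velDeriv h Q p) := by
  have hk : DifferentiableAt ℝ (fun p : E × ℝ => inner ℝ p.1 k) p :=
    differentiableAt_fst.inner ℝ (differentiableAt_const k)
  simp only [velDeriv, fderiv_fun_mul (hk.fun_pow 2) hQ, fderiv_fun_pow 2 hk, add_apply,
    smul_apply, smul_eq_mul]
  ring

end VelocitySymbol

/-! ### Oscillatory bilinear forms -/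

section Form

variable {E : Type*} [NormedAddCommGroup E] [InnerProductSpace ℝ E] {m : ℝ}

/-- The oscillating factor `e ^ (i t ω(ξ))`. -/
def phase (m t : ℝ) (ξ : E) : ℂ := Complex.exp ((t * omega m ξ : ℝ) * Complex.I)

theorem norm_phase (m t : ℝ) (ξ : E) : ‖phase m t ξ‖ = 1 := Complex.norm_exp_ofReal_mul_I _

theorem continuous_phase (hm : 0 < m) (t : ℝ) : Continuous (phase m t : E → ℂ) := by
  have := continuous_omega (E := E) hm
  unfold phase
  fun_prop

theorem hasFDerivAt_phase (hm : 0 < m) (t : ℝ) (ξ : E) :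
    HasFDerivAt (phase m t) ((phase m t ξ * (2 * Real.pi * Complex.I * t)) •
      Complex.ofRealCLM.comp (innerSL ℝ (velPoint m ξ).1)) ξ := by
  refine ((Complex.ofRealCLM.hasFDerivAt.comp ξ
    ((hasFDerivAt_omega hm ξ).const_mul t)).mul_const Complex.I).cexp.congr_fderiv ?_
  ext h
  simp [phase]
  ring

theorem fderiv_phase_apply (hm : 0 < m) (t : ℝ) (ξ h : E) :
    fderiv ℝ (phase m t) ξ h =
      phase m t ξ * (2 * Real.pi * Complex.I * t) * (inner ℝ (velPoint m ξ).1 h : ℝ) := by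
  rw [(hasFDerivAt_phase hm t ξ).fderiv]
  simp only [smul_apply, smul_eq_mul, ContinuousLinearMap.comp_apply, Complex.ofRealCLM_apply,
    innerSL_apply_apply]

theorem norm_phase_mul_ofReal_le {m t c C : ℝ} {ξ : E} (h : |c| ≤ C) :
    ‖phase m t ξ * (c : ℂ)‖ ≤ C := by
  rwa [norm_mul, norm_phase, one_mul, Complex.norm_real]

variable [FiniteDimensional ℝ E] [MeasurableSpace E] [BorelSpace E]

/-- The bilinear form `(f, g) ↦ ∫ e ^ (i t ω) Q(v, 1 / ω) 𝓕⁻ f 𝓕 g` of the operator with symbol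
`e ^ (i t ω) Q(v, 1 / ω)`. -/
def form (m t : ℝ) (Q : E × ℝ → ℝ) (f g : 𝓢(E, ℂ)) : ℂ :=
  ∫ ξ, phase m t ξ * Q (velPoint m ξ) * (𝓕⁻ f ξ * 𝓕 g ξ)

theorem integrable_phase_mul {Q : E × ℝ → ℝ} (hQ : IsSymbol m 0 Q) (hm : 0 < m) (t : ℝ)
    (F G : 𝓢(E, ℂ)) : Integrable fun ξ => phase m t ξ * Q (velPoint m ξ) * (F ξ * G ξ) := by
  obtain ⟨C, -, hC⟩ := hQ.exists_abs_le hm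
  have hc := (continuous_phase hm t).mul
    (Complex.continuous_ofReal.comp (hQ.continuous_comp hm))
  refine Integrable.bdd_mul (c := C) (F.integrable.mul_bdd (c := SchwartzMap.seminorm ℝ 0 0 G)
    G.continuous.aestronglyMeasurable (.of_forall (SchwartzMap.norm_le_seminorm ℝ G)))
    hc.aestronglyMeasurable (.of_forall fun ξ => norm_phase_mul_ofReal_le (hC ξ))

theorem norm_form_le {Q : E × ℝ → ℝ} {C : ℝ} (hm : 0 < m) (t : ℝ) (hQ : IsSymbol m 0 Q)
    (hC : ∀ ξ, |Q (velPoint m ξ)| ≤ C) (f g : 𝓢(E, ℂ)) :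
    ‖form m t Q f g‖ ≤ C * (l2norm f * l2norm g) := by
  have hC0 : 0 ≤ C := (abs_nonneg _).trans (hC 0)
  have hc := ((continuous_phase hm t).mul (Complex.continuous_ofReal.comp
    (hQ.continuous_comp hm))).mul (𝓕⁻ f : 𝓢(E, ℂ)).continuous
  have h := enorm_integral_mul_le (μ := volume)
    (f := fun ξ => phase m t ξ * Q (velPoint m ξ) * 𝓕⁻ f ξ) (g := (𝓕 g : 𝓢(E, ℂ)))
    hc.aestronglyMeasurable (𝓕 g : 𝓢(E, ℂ)).continuous.aestronglyMeasurable
  have h_le : eLpNorm (fun ξ => phase m t ξ * Q (velPoint m ξ) * 𝓕⁻ f ξ) 2 volume ≤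
      ENNReal.ofReal C * eLpNorm (𝓕⁻ f : 𝓢(E, ℂ)) 2 volume :=
    eLpNorm_le_mul_eLpNorm_of_ae_le_mul (.of_forall fun ξ => by
      rw [norm_mul]
      gcongr
      exact norm_phase_mul_ofReal_le (hC ξ)) 2
  have h := h.trans (mul_le_mul_left h_le _)
  rw [← ofReal_l2norm, ← ofReal_l2norm, l2norm_fourier, l2norm_fourierInv,
    ← ENNReal.ofReal_mul hC0, ← ENNReal.ofReal_mul (mul_nonneg hC0 (l2norm_nonneg f)),
    ← ofReal_norm, ENNReal.ofReal_le_ofReal_iff (mul_nonneg (mul_nonneg hC0 (l2norm_nonneg f))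
      (l2norm_nonneg g))] at h
  simpa only [form, mul_assoc] using h

theorem form_congr {P Q : E × ℝ → ℝ} (t : ℝ) (h : ∀ ξ, P (velPoint m ξ) = Q (velPoint m ξ))
    (f g : 𝓢(E, ℂ)) : form m t P f g = form m t Q f g := by
  simp only [form, h]

theorem form_add {P Q : E × ℝ → ℝ} (hm : 0 < m) (t : ℝ) (hP : IsSymbol m 0 P)
    (hQ : IsSymbol m 0 Q) (f g : 𝓢(E, ℂ)) :
    form m t (fun p => P p + Q p) f g = form m t P f g + form m t Q f g := by
  rw [form, form, form,
    ← integral_add (integrable_phase_mul hP hm t _ _) (integrable_phase_mul hQ hm t _ _)]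
  congr 1 with ξ
  push_cast
  ring

theorem form_sum {ι : Type*} (s : Finset ι) {Q : ι → E × ℝ → ℝ} (hm : 0 < m) (t : ℝ)
    (hQ : ∀ i ∈ s, IsSymbol m 0 (Q i)) (f g : 𝓢(E, ℂ)) :
    form m t (fun p => ∑ i ∈ s, Q i p) f g = ∑ i ∈ s, form m t (Q i) f g := by
  simp only [form]
  rw [← integral_finsetSum s fun i hi => integrable_phase_mul (hQ i hi) hm t _ _]
  congr 1 with ξ
  rw [Complex.ofReal_sum, Finset.mul_sum, Finset.sum_mul]

theorem form_add_left {Q : E × ℝ → ℝ} (hm : 0 < m) (t : ℝ) (hQ : IsSymbol m 0 Q)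
    (f₁ f₂ g : 𝓢(E, ℂ)) : form m t Q (f₁ + f₂) g = form m t Q f₁ g + form m t Q f₂ g := by
  rw [form, form, form,
    ← integral_add (integrable_phase_mul hQ hm t _ _) (integrable_phase_mul hQ hm t _ _)]
  congr 1 with ξ
  rw [FourierTransform.fourierInv_add, add_apply, add_mul, mul_add]

theorem form_add_right {Q : E × ℝ → ℝ} (hm : 0 < m) (t : ℝ) (hQ : IsSymbol m 0 Q)
    (f g₁ g₂ : 𝓢(E, ℂ)) : form m t Q f (g₁ + g₂) = form m t Q f g₁ + form m t Q f g₂ := by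
  rw [form, form, form,
    ← integral_add (integrable_phase_mul hQ hm t _ _) (integrable_phase_mul hQ hm t _ _)]
  congr 1 with ξ
  rw [FourierTransform.fourier_add, add_apply, mul_add, mul_add]

end Form

section IntegrationByParts

variable {E : Type*} [NormedAddCommGroup E] [InnerProductSpace ℝ E] {m : ℝ}

/-- Multiplication of a Schwartz function by the coordinate `x ↦ ⟨x, h⟩`. -/
def mulCoord (h : E) : 𝓢(E, ℂ) →L[ℝ] 𝓢(E, ℂ) :=
  SchwartzMap.smulLeftCLM ℂ (inner ℝ · h)

theorem mulCoord_apply (h : E) (f : 𝓢(E, ℂ)) (x : E) :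
    mulCoord h f x = (inner ℝ x h : ℝ) * f x := by
  rw [mulCoord, SchwartzMap.smulLeftCLM_apply_apply (Function.hasTemperateGrowth_inner_left h),
    Complex.real_smul]

theorem hasFDerivAt_symbol_mul {Q : E × ℝ → ℝ} (hm : 0 < m) (hQ : IsSymbol m 1 Q)
    (F G : 𝓢(E, ℂ)) (ξ : E) :
    HasFDerivAt (fun ξ => (Q (velPoint m ξ) : ℂ) * (F ξ * G ξ))
      ((Q (velPoint m ξ) : ℂ) • (F ξ • fderiv ℝ G ξ + G ξ • fderiv ℝ F ξ) + (F ξ * G ξ) •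
        Complex.ofRealCLM.comp ((fderiv ℝ Q (velPoint m ξ)).comp (fderiv ℝ (velPoint m) ξ))) ξ :=
  (Complex.ofRealCLM.hasFDerivAt.comp ξ (hQ.hasFDerivAt_comp hm ξ)).mul
    ((F.hasFDerivAt ξ).mul (G.hasFDerivAt ξ))

variable [FiniteDimensional ℝ E] [MeasurableSpace E] [BorelSpace E]

theorem fderiv_fourier (f : 𝓢(E, ℂ)) (ξ h : E) :
    fderiv ℝ (𝓕 f : 𝓢(E, ℂ)) ξ h = -(2 * Real.pi * Complex.I) * 𝓕 (mulCoord h f) ξ := by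
  rw [← SchwartzMap.lineDerivOp_apply_eq_fderiv, SchwartzMap.lineDerivOp_fourier_eq,
    FourierTransform.fourier_smul]
  rfl

theorem fderiv_fourierInv (f : 𝓢(E, ℂ)) (ξ h : E) :
    fderiv ℝ (𝓕⁻ f : 𝓢(E, ℂ)) ξ h = 2 * Real.pi * Complex.I * 𝓕⁻ (mulCoord h f) ξ := by
  rw [← SchwartzMap.lineDerivOp_apply_eq_fderiv, SchwartzMap.lineDerivOp_fourierInv_eq,
    FourierTransform.fourierInv_smul]
  rfl

theorem fderiv_symbol_mul_fourier_apply {Q : E × ℝ → ℝ} (hm : 0 < m) (hQ : IsSymbol m 1 Q)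
    (f g : 𝓢(E, ℂ)) (ξ h : E) :
    fderiv ℝ (fun ξ => (Q (velPoint m ξ) : ℂ) * (𝓕⁻ f ξ * 𝓕 g ξ)) ξ h =
      -(2 * Real.pi * Complex.I * (Q (velPoint m ξ) * (𝓕⁻ f ξ * 𝓕 (mulCoord h g) ξ))
        - 2 * Real.pi * Complex.I * (Q (velPoint m ξ) * (𝓕⁻ (mulCoord h f) ξ * 𝓕 g ξ))
        - velDeriv h Q (velPoint m ξ) * (𝓕⁻ f ξ * 𝓕 g ξ)) := by
  rw [(hasFDerivAt_symbol_mul hm hQ (𝓕⁻ f) (𝓕 g) ξ).fderiv]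
  simp only [add_apply, smul_apply, smul_eq_mul, ContinuousLinearMap.comp_apply,
    Complex.ofRealCLM_apply, fderiv_fourier, fderiv_fourierInv, fderiv_velPoint_apply hm,
    velDeriv]
  ring

theorem form_inner_mul {Q : E × ℝ → ℝ} (hm : 0 < m) (t : ℝ) (h : E) (hQ : IsSymbol m 1 Q)
    (f g : 𝓢(E, ℂ)) :
    2 * Real.pi * Complex.I * t * form m t (fun p => inner ℝ p.1 h * Q p) f g =
      2 * Real.pi * Complex.I * form m t Q f (mulCoord h g)
      - 2 * Real.pi * Complex.I * form m t Q (mulCoord h f) g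
      - form m t (velDeriv h Q) f g := by
  let P (ξ : E) : ℂ := Q (velPoint m ξ) * (𝓕⁻ f ξ * 𝓕 g ξ)
  have i₁ := (integrable_phase_mul hQ.of_succ hm t (𝓕⁻ f) (𝓕 (mulCoord h g))).const_mul
    (2 * Real.pi * Complex.I)
  have i₂ := (integrable_phase_mul hQ.of_succ hm t (𝓕⁻ (mulCoord h f)) (𝓕 g)).const_mul
    (2 * Real.pi * Complex.I)
  have i₃ := integrable_phase_mul (hQ.velDeriv h) hm t (𝓕⁻ f) (𝓕 g)
  have i₄ := (integrable_phase_mul ((IsSymbol.inner_left h).mul hQ.of_succ) hm t (𝓕⁻ f)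
    (𝓕 g)).const_mul (2 * Real.pi * Complex.I * t)
  have eP (ξ : E) : fderiv ℝ P ξ h * phase m t ξ =
      -(2 * Real.pi * Complex.I * (phase m t ξ * Q (velPoint m ξ) *
          (𝓕⁻ f ξ * 𝓕 (mulCoord h g) ξ))
        - 2 * Real.pi * Complex.I * (phase m t ξ * Q (velPoint m ξ) *
          (𝓕⁻ (mulCoord h f) ξ * 𝓕 g ξ))
        - phase m t ξ * velDeriv h Q (velPoint m ξ) * (𝓕⁻ f ξ * 𝓕 g ξ)) := by
    rw [fderiv_symbol_mul_fourier_apply hm hQ]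
    ring
  have ePhase (ξ : E) : P ξ * fderiv ℝ (phase m t) ξ h = 2 * Real.pi * Complex.I * t *
      (phase m t ξ * (inner ℝ (velPoint m ξ).1 h * Q (velPoint m ξ) : ℝ) *
        (𝓕⁻ f ξ * 𝓕 g ξ)) := by
    rw [fderiv_phase_apply hm, Complex.ofReal_mul]
    ring
  have key := integral_mul_fderiv_eq_neg_fderiv_mul_of_integrable (μ := volume) (f := P)
    (g := phase m t) (v := h) (by simp only [eP]; exact ((i₁.sub i₂).sub i₃).neg)
    (by simp only [ePhase]; exact i₄)
    ((integrable_phase_mul hQ.of_succ hm t (𝓕⁻ f) (𝓕 g)).congr (.of_forall fun ξ => by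
      simp only [P]; ring))
    (fun ξ _ => (hasFDerivAt_symbol_mul hm hQ _ _ ξ).differentiableAt)
    (fun ξ _ => (hasFDerivAt_phase hm t ξ).differentiableAt)
  simp only [eP, ePhase, integral_neg, neg_neg] at key
  have h_split := (integral_sub (i₁.sub i₂) i₃).trans
    (congrArg (· - _) (integral_sub i₁ i₂))
  simp only [integral_const_mul] at key h_split
  exact key.trans h_split

theorem abs_mul_norm_form_inner_mul_le {Q : E × ℝ → ℝ} (hm : 0 < m) (t : ℝ) (h : E)
    (hQ : IsSymbol m 1 Q) (f g : 𝓢(E, ℂ)) :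
    |t| * ‖form m t (fun p => inner ℝ p.1 h * Q p) f g‖ ≤
      ‖form m t Q f (mulCoord h g)‖ + ‖form m t Q (mulCoord h f) g‖
      + ‖form m t (velDeriv h Q) f g‖ := by
  have h2pi : ‖(2 * Real.pi * Complex.I : ℂ)‖ = 2 * Real.pi := by
    simp [abs_of_pos Real.pi_pos]
  have hpi : 1 ≤ 2 * Real.pi := by linarith [Real.pi_gt_three]
  have key := congrArg norm (form_inner_mul hm t h hQ f g)
  rw [norm_mul, norm_mul, h2pi, Complex.norm_real, Real.norm_eq_abs] at key
  refine le_of_mul_le_mul_left ?_ (one_pos.trans_le hpi)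
  calc 2 * Real.pi * (|t| * ‖form m t (fun p => inner ℝ p.1 h * Q p) f g‖)
    _ ≤ 2 * Real.pi * ‖form m t Q f (mulCoord h g)‖
        + 2 * Real.pi * ‖form m t Q (mulCoord h f) g‖ + ‖form m t (velDeriv h Q) f g‖ := by
      rw [← mul_assoc, key, ← h2pi, ← norm_mul, ← norm_mul]
      exact (norm_sub_le _ _).trans (add_le_add_left (norm_sub_le _ _) _)
    _ ≤ _ := by
      rw [mul_add, mul_add]
      gcongr
      exact le_mul_of_one_le_left (norm_nonneg _) hpi

end IntegrationByParts

section LowFrequency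

section Convolution

variable {E : Type*} [NormedAddCommGroup E] [InnerProductSpace ℝ E] [FiniteDimensional ℝ E]
  [MeasurableSpace E] [BorelSpace E] {a : E → ℂ} {M : ℝ}

theorem norm_integral_mul_fourier_le (ha : Integrable a) (hM : ∀ x, ‖𝓕 a x‖ ≤ M)
    (g : 𝓢(E, ℂ)) : ‖∫ ξ, a ξ * 𝓕 g ξ‖ ≤ M * ∫ x, ‖g x‖ := by
  have h_flip : ∫ ξ, 𝓕 (g : E → ℂ) ξ • a ξ = ∫ x, g x • 𝓕 a x := by
    have h := VectorFourier.integral_fourierIntegral_smul_eq_flip (L := innerₗ E) (μ := volume)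
      (ν := volume) Real.continuous_fourierChar continuous_inner g.integrable ha
    rwa [flip_innerₗ] at h
  rw [← integral_const_mul]
  calc ‖∫ ξ, a ξ * 𝓕 g ξ‖
    _ = ‖∫ x, g x • 𝓕 a x‖ := by
      rw [← h_flip]
      simp only [SchwartzMap.fourier_coe, smul_eq_mul, mul_comm]
    _ ≤ ∫ x, M * ‖g x‖ := norm_integral_le_of_norm_le (g.integrable.norm.const_mul M)
      (.of_forall fun x => by
        rw [norm_smul, mul_comm]
        gcongr
        exact hM x)

theorem norm_integral_mul_fourierInv_le (ha : Integrable a) (hM : ∀ x, ‖𝓕⁻ a x‖ ≤ M)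
    (f : 𝓢(E, ℂ)) : ‖∫ ξ, a ξ * 𝓕⁻ f ξ‖ ≤ M * ∫ x, ‖f x‖ := by
  rw [← integral_neg_eq_self]
  rw [Real.fourierInv_eq_fourier_comp_neg] at hM
  have h (ξ : E) : (𝓕⁻ f : 𝓢(E, ℂ)) (-ξ) = 𝓕 f ξ := by
    rw [SchwartzMap.fourierInv_coe, SchwartzMap.fourier_coe, Real.fourierInv_eq_fourier_neg,
      neg_neg]
  simpa only [h] using norm_integral_mul_fourier_le ha.comp_neg hM f

/-- A convolution with a bounded kernel maps `L¹` to `L^∞`. -/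
theorem norm_integral_mul_fourierInv_mul_fourier_le (ha : Integrable a)
    (hM : ∀ x, ‖𝓕⁻ a x‖ ≤ M) (f g : 𝓢(E, ℂ)) :
    ‖∫ ξ, a ξ * (𝓕⁻ f ξ * 𝓕 g ξ)‖ ≤ M * (∫ x, ‖f x‖) * ∫ x, ‖g x‖ := by
  let e (x ξ : E) : ℂ := Complex.exp ((-2 * Real.pi * inner ℝ ξ x : ℝ) * Complex.I)
  have he (x : E) : Integrable fun ξ => e x ξ * a ξ :=
    ha.bdd_mul (c := 1) (Continuous.aestronglyMeasurable (by fun_prop))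
      (.of_forall fun ξ => (Complex.norm_exp_ofReal_mul_I _).le)
  have h_trans (x y : E) : 𝓕⁻ (fun ξ => e x ξ * a ξ) y = 𝓕⁻ a (y - x) := by
    rw [Real.fourierInv_eq', Real.fourierInv_eq']
    congr 1 with ξ
    rw [smul_eq_mul, smul_eq_mul, ← mul_assoc, ← Complex.exp_add, inner_sub_right]
    congr 2
    push_cast
    ring
  have h_fourier (x : E) :
      𝓕 (fun ξ => a ξ * 𝓕⁻ f ξ) x = ∫ ξ, e x ξ * a ξ * 𝓕⁻ f ξ := by
    simp only [Real.fourier_eq', smul_eq_mul, mul_assoc, e]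
  simp only [← mul_assoc]
  refine norm_integral_mul_fourier_le (ha.mul_bdd (𝓕⁻ f : 𝓢(E, ℂ)).continuous.aestronglyMeasurable
    (.of_forall (SchwartzMap.norm_le_seminorm ℝ (𝓕⁻ f)))) (fun x => ?_) g
  rw [h_fourier]
  exact norm_integral_mul_fourierInv_le (he x) (fun y => h_trans x y ▸ hM _) f

end Convolution

variable {m K : ℝ} {a c : ℝ → ℝ}

theorem norm_fourierInv_phase_mul_le (hc : HasCubicDecay m K c) (hm : 0 < m) {t : ℝ}
    (ht : 1 ≤ |t|) (z : R3) :
    ‖𝓕⁻ (fun ξ : R3 => phase m t ξ * (c (omega m ξ) / omega m ξ : ℝ)) z‖ ≤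
      |((2 * Real.pi) ^ 3)⁻¹| * HasCubicDecay.kernelConst m K / (|t| * √|t|) := by
  have h_scale := Measure.integral_comp_smul (volume : Measure R3) (fun k : R3 =>
    (c (disp m ‖k‖) / disp m ‖k‖ : ℝ) * Complex.exp ((t * disp m ‖k‖ : ℝ) * Complex.I) *
      Complex.exp ((inner ℝ k z : ℝ) * Complex.I)) (2 * Real.pi)
  rw [finrank_euclideanSpace_fin] at h_scale
  have h_fourier : 𝓕⁻ (fun ξ : R3 => phase m t ξ * (c (omega m ξ) / omega m ξ : ℝ)) z =
      |((2 * Real.pi) ^ 3)⁻¹| • ∫ k : R3, (c (disp m ‖k‖) / disp m ‖k‖ : ℝ) *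
        Complex.exp ((t * disp m ‖k‖ : ℝ) * Complex.I) *
        Complex.exp ((inner ℝ k z : ℝ) * Complex.I) := by
    rw [← h_scale, Real.fourierInv_eq']
    congr 1 with ξ
    rw [real_inner_smul_left, smul_eq_mul, phase, omega]
    ring
  rw [h_fourier, norm_smul, Real.norm_of_nonneg (abs_nonneg _), mul_div_assoc]
  gcongr
  exact hc.norm_kernel_le hm ht z

theorem IsAmplitude.exists_norm_form_low_le (ha : IsAmplitude m 2 a) (hm : 0 < m) :
    ∃ C, 0 ≤ C ∧ ∀ t : ℝ, 1 ≤ |t| → ∀ f g : 𝓢(R3, ℂ),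
      ‖form m t (fun p => p.2 ^ 4 * a p.2) f g‖ ≤
        C / (|t| * √|t|) * ((∫ x, ‖f x‖) * ∫ x, ‖g x‖) := by
  obtain ⟨K, hc⟩ := ha.exists_hasCubicDecay hm
  have h_const := (norm_nonneg _).trans (norm_fourierInv_phase_mul_le hc hm (t := 1) (by simp) 0)
  simp only [abs_one, Real.sqrt_one, mul_one, div_one] at h_const
  refine ⟨_, h_const, fun t ht f g => ?_⟩
  have h_int : Integrable fun ξ : R3 => (omega m ξ)⁻¹ ^ 3 * a (omega m ξ)⁻¹ / omega m ξ :=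
    (hc.integrable_comp_disp_norm hm).comp_smul (R := 2 * Real.pi) (by positivity)
  have h_int := h_int.ofReal (𝕜 := ℂ) |>.bdd_mul
    (continuous_phase hm t).aestronglyMeasurable (.of_forall fun ξ => (norm_phase m t ξ).le)
  refine le_of_eq_of_le ?_ ((norm_integral_mul_fourierInv_mul_fourier_le h_int
    (norm_fourierInv_phase_mul_le hc hm ht) f g).trans_eq (mul_assoc _ _ _))
  simp only [form, velPoint, pow_succ, div_eq_mul_inv, mul_right_comm _ (a _)]
  rfl

end LowFrequency

section WeightedNorm

/-- The weighted norm `‖⟨x⟩ ^ σ f‖_{L²}` of a Schwartz function. -/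
def weightedNorm (σ : ℝ) (f : 𝓢(R3, ℂ)) : ℝ := l2norm (SchwartzMap.smulLeftCLM ℂ (weight σ) f)

theorem weightedNorm_nonneg (σ : ℝ) (f : 𝓢(R3, ℂ)) : 0 ≤ weightedNorm σ f := l2norm_nonneg _

theorem norm_weight (σ : ℝ) (x : R3) : ‖weight σ x‖ = (1 + ‖x‖ ^ 2) ^ (σ / 2) := by
  rw [weight, Complex.norm_real, Real.norm_of_nonneg (by positivity)]

theorem smul_weight_weight (σ τ : ℝ) (f : 𝓢(R3, ℂ)) :
    SchwartzMap.smulLeftCLM ℂ (weight σ) (SchwartzMap.smulLeftCLM ℂ (weight τ) f) =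
      SchwartzMap.smulLeftCLM ℂ (weight (σ + τ)) f := by
  rw [SchwartzMap.smulLeftCLM_smulLeftCLM_apply (hasTemperateGrowth_weight σ)
    (hasTemperateGrowth_weight τ)]
  congr 2 with x
  rw [Pi.mul_apply, weight, weight, weight, ← Complex.ofReal_mul,
    ← Real.rpow_add (by positivity), add_div]

theorem smul_weight_zero (f : 𝓢(R3, ℂ)) : SchwartzMap.smulLeftCLM ℂ (weight 0) f = f := by
  ext x
  simp [SchwartzMap.smulLeftCLM_apply_apply (hasTemperateGrowth_weight 0), weight]

theorem weightedNorm_zero (f : 𝓢(R3, ℂ)) : weightedNorm 0 f = l2norm f := by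
  rw [weightedNorm, smul_weight_zero]

theorem weightedNorm_le_mul {σ τ C : ℝ} {f g : 𝓢(R3, ℂ)}
    (h : ∀ x, (1 + ‖x‖ ^ 2) ^ (τ / 2) * ‖g x‖ ≤ C * (1 + ‖x‖ ^ 2) ^ (σ / 2) * ‖f x‖) :
    weightedNorm τ g ≤ C * weightedNorm σ f :=
  l2norm_le_mul fun x => by
    simpa only [SchwartzMap.smulLeftCLM_apply_apply (hasTemperateGrowth_weight _), norm_smul,
      norm_weight, mul_assoc] using h x

theorem weightedNorm_mono {σ τ : ℝ} (h : σ ≤ τ) (f : 𝓢(R3, ℂ)) :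
    weightedNorm σ f ≤ weightedNorm τ f := by
  rw [← one_mul (weightedNorm τ f)]
  refine weightedNorm_le_mul fun x => ?_
  rw [one_mul]
  gcongr
  exact le_add_of_nonneg_right (sq_nonneg _)

theorem weightedNorm_mulCoord_le (σ : ℝ) {h : R3} (hh : ‖h‖ ≤ 1) (f : 𝓢(R3, ℂ)) :
    weightedNorm σ (mulCoord h f) ≤ weightedNorm (σ + 1) f := by
  rw [← one_mul (weightedNorm (σ + 1) f)]
  refine weightedNorm_le_mul fun x => ?_
  have h_inner : |(inner ℝ x h : ℝ)| ≤ (1 + ‖x‖ ^ 2) ^ (1 / 2 : ℝ) :=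
    calc |(inner ℝ x h : ℝ)|
      _ ≤ ‖x‖ * ‖h‖ := abs_real_inner_le_norm x h
      _ ≤ ‖x‖ := mul_le_of_le_one_right (norm_nonneg x) hh
      _ ≤ (1 + ‖x‖ ^ 2) ^ (1 / 2 : ℝ) := by
        rw [← Real.sqrt_eq_rpow]
        exact Real.le_sqrt_of_sq_le (by linarith)
  rw [mulCoord_apply, norm_mul, Complex.norm_real, Real.norm_eq_abs, add_div,
    Real.rpow_add (by positivity), one_mul, mul_assoc]
  gcongr

theorem memLp_weight {σ : ℝ} (hσ : 3 / 2 < σ) : MemLp (weight (-σ)) 2 (volume : Measure R3) := by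
  have h_meas : AEStronglyMeasurable (weight (-σ)) (volume : Measure R3) :=
    (hasTemperateGrowth_weight (-σ)).1.continuous.aestronglyMeasurable
  rw [memLp_two_iff_integrable_sq_norm h_meas]
  refine (integrable_rpow_neg_one_add_norm_sq (E := R3) (μ := volume) (r := 2 * σ)
    (by simp; linarith)).congr (.of_forall fun x => ?_)
  simp only [norm_weight]
  rw [← Real.rpow_mul_natCast (by positivity)]
  congr 1
  push_cast
  ring

theorem exists_integral_norm_le {σ : ℝ} (hσ : 3 / 2 < σ) :
    ∃ C, 0 ≤ C ∧ ∀ f : 𝓢(R3, ℂ), ∫ x, ‖f x‖ ≤ C * weightedNorm σ f := by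
  have hw := memLp_weight hσ
  refine ⟨(eLpNorm (weight (-σ)) 2 (volume : Measure R3)).toReal, ENNReal.toReal_nonneg,
    fun f => ?_⟩
  let g := SchwartzMap.smulLeftCLM ℂ (weight σ) f
  have hf : ⇑f = weight (-σ) • ⇑g := by
    ext x
    rw [Pi.smul_apply', ← SchwartzMap.smulLeftCLM_apply_apply (hasTemperateGrowth_weight _),
      smul_weight_weight, neg_add_cancel, smul_weight_zero]
  rw [integral_norm_eq_lintegral_enorm f.continuous.aestronglyMeasurable,
    ← eLpNorm_one_eq_lintegral_enorm, weightedNorm, ← ENNReal.toReal_ofReal (l2norm_nonneg _),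
    ofReal_l2norm, ← ENNReal.toReal_mul]
  refine ENNReal.toReal_mono (ENNReal.mul_ne_top hw.2.ne (g.memLp 2 volume).2.ne) ?_
  rw [hf]
  exact eLpNorm_smul_le_mul_eLpNorm (p := 2) (q := 2) (r := 1) g.continuous.aestronglyMeasurable
    hw.1

end WeightedNorm

section Truncation

/-- The part of `f` in the ball of radius `|t|`, obtained with the smooth cutoff
`(1 + |x / t|²) ^ (-1)`. -/
def truncate (t : ℝ) : 𝓢(R3, ℂ) →L[ℂ] 𝓢(R3, ℂ) :=
  SchwartzMap.smulLeftCLM ℂ fun x => weight (-2) (t⁻¹ • x)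

theorem truncate_apply (t : ℝ) (f : 𝓢(R3, ℂ)) (x : R3) :
    truncate t f x = ((1 + ‖x‖ ^ 2 / t ^ 2)⁻¹ : ℝ) * f x := by
  have h_growth : (fun x : R3 => weight (-2) (t⁻¹ • x)).HasTemperateGrowth :=
    (hasTemperateGrowth_weight (-2)).comp (t⁻¹ • ContinuousLinearMap.id ℝ R3).hasTemperateGrowth
  rw [truncate, SchwartzMap.smulLeftCLM_apply_apply h_growth, weight, norm_smul, norm_inv, mul_pow,
    inv_pow, Real.norm_eq_abs, sq_abs, neg_div, div_self two_ne_zero, Real.rpow_neg_one,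
    inv_mul_eq_div, smul_eq_mul]

theorem weightedNorm_truncate_le {σ τ : ℝ} (h : τ ≤ σ) (t : ℝ) (f : 𝓢(R3, ℂ)) :
    weightedNorm τ (truncate t f) ≤ weightedNorm σ f := by
  refine le_trans ?_ (weightedNorm_mono h f)
  rw [← one_mul (weightedNorm τ f)]
  refine weightedNorm_le_mul fun x => ?_
  rw [truncate_apply, norm_mul, Complex.norm_real, Real.norm_of_nonneg (by positivity), one_mul]
  gcongr
  exact mul_le_of_le_one_left (norm_nonneg _)
    (inv_le_one_of_one_le₀ (le_add_of_nonneg_right (by positivity)))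

variable {σ t : ℝ}

theorem weightedNorm_two_truncate_le (h0 : 0 ≤ σ) (h2 : σ ≤ 2) (ht : 1 ≤ |t|) (f : 𝓢(R3, ℂ)) :
    weightedNorm 2 (truncate t f) ≤ |t| ^ (2 - σ) * weightedNorm σ f := by
  refine weightedNorm_le_mul fun x => ?_
  rw [truncate_apply, norm_mul, Complex.norm_real, Real.norm_of_nonneg (by positivity)]
  have ht0 : 0 < |t| := by linarith
  set y := 1 + ‖x‖ ^ 2 / t ^ 2 with hy
  have hy1 : 1 ≤ y := le_add_of_nonneg_right (by positivity)
  have hxy : 1 + ‖x‖ ^ 2 ≤ |t| ^ (2 : ℝ) * y := by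
    have : |t| ^ (2 : ℝ) * y = |t| ^ 2 + ‖x‖ ^ 2 := by
      rw [hy, Real.rpow_two, ← sq_abs t]
      field_simp
    rw [this]
    gcongr
    exact one_le_pow₀ ht
  have h_excess : (1 + ‖x‖ ^ 2) ^ ((2 - σ) / 2) ≤ |t| ^ (2 - σ) * y :=
    calc (1 + ‖x‖ ^ 2) ^ ((2 - σ) / 2)
      _ ≤ (|t| ^ (2 : ℝ) * y) ^ ((2 - σ) / 2) := by
        gcongr
      _ = |t| ^ (2 - σ) * y ^ ((2 - σ) / 2) := by
        rw [Real.mul_rpow (by positivity) (by positivity), ← Real.rpow_mul ht0.le]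
        congr 2
        ring
      _ ≤ |t| ^ (2 - σ) * y := by
        gcongr
        exact Real.rpow_le_self_of_one_le hy1 (by linarith)
  calc (1 + ‖x‖ ^ 2) ^ ((2 : ℝ) / 2) * (y⁻¹ * ‖f x‖)
    _ = (1 + ‖x‖ ^ 2) ^ ((2 - σ) / 2) * y⁻¹ * (1 + ‖x‖ ^ 2) ^ (σ / 2) * ‖f x‖ := by
      rw [show (2 : ℝ) / 2 = (2 - σ) / 2 + σ / 2 by ring, Real.rpow_add (by positivity)]
      ring
    _ ≤ |t| ^ (2 - σ) * y * y⁻¹ * (1 + ‖x‖ ^ 2) ^ (σ / 2) * ‖f x‖ := by gcongr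
    _ = |t| ^ (2 - σ) * (1 + ‖x‖ ^ 2) ^ (σ / 2) * ‖f x‖ := by
      rw [mul_inv_cancel_right₀ (by positivity)]

theorem l2norm_sub_truncate_le (h0 : 0 ≤ σ) (h2 : σ ≤ 2) (ht : t ≠ 0) (f : 𝓢(R3, ℂ)) :
    l2norm (f - truncate t f) ≤ |t| ^ (-σ) * weightedNorm σ f := by
  rw [← weightedNorm_zero]
  refine weightedNorm_le_mul fun x => ?_
  have ht0 : 0 < |t| := abs_pos.2 ht
  rw [sub_apply, truncate_apply, ← one_sub_mul, norm_mul, ← Complex.ofReal_one,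
    ← Complex.ofReal_sub, Complex.norm_real, zero_div, Real.rpow_zero, one_mul]
  set z := ‖x‖ ^ 2 / t ^ 2
  have hz : 0 ≤ z := by positivity
  have hzx : z ≤ |t| ^ (-2 : ℝ) * (1 + ‖x‖ ^ 2) := by
    rw [Real.rpow_neg ht0.le, Real.rpow_two, sq_abs, inv_mul_eq_div]
    exact div_le_div_of_nonneg_right (le_add_of_nonneg_left zero_le_one) (sq_nonneg t)
  have h_eq : 1 - (1 + z)⁻¹ = z / (1 + z) := by
    field_simp
    ring
  rw [h_eq, Real.norm_of_nonneg (by positivity)]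
  refine mul_le_mul_of_nonneg_right ?_ (norm_nonneg _)
  calc z / (1 + z)
    _ ≤ (z / (1 + z)) ^ (σ / 2) :=
      Real.self_le_rpow_of_le_one (by positivity) ((div_le_one (by positivity)).2 (by linarith))
        (by linarith)
    _ ≤ (|t| ^ (-2 : ℝ) * (1 + ‖x‖ ^ 2)) ^ (σ / 2) := by
      gcongr
      exact (div_le_self hz (by linarith)).trans hzx
    _ = |t| ^ (-σ) * (1 + ‖x‖ ^ 2) ^ (σ / 2) := by
      rw [Real.mul_rpow (by positivity) (by positivity), ← Real.rpow_mul ht0.le]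
      congr 2
      ring

end Truncation

section HighFrequency

variable {m : ℝ} {Q : R3 × ℝ → ℝ}

/-- The quantity `∑ i + j = 1, ‖⟨x⟩ ^ i f‖ * ‖⟨x⟩ ^ j g‖`, which controls one integration by
parts. -/
def firstMoment (f g : 𝓢(R3, ℂ)) : ℝ :=
  weightedNorm 1 f * weightedNorm 0 g + weightedNorm 0 f * weightedNorm 1 g

/-- The quantity `∑ i + j = 2, ‖⟨x⟩ ^ i f‖ * ‖⟨x⟩ ^ j g‖`, which controls two integrations by
parts. -/
def secondMoment (f g : 𝓢(R3, ℂ)) : ℝ :=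
  weightedNorm 2 f * weightedNorm 0 g + weightedNorm 1 f * weightedNorm 1 g +
    weightedNorm 0 f * weightedNorm 2 g

theorem weightedNorm_mul_nonneg (σ τ : ℝ) (f g : 𝓢(R3, ℂ)) :
    0 ≤ weightedNorm σ f * weightedNorm τ g :=
  mul_nonneg (weightedNorm_nonneg σ f) (weightedNorm_nonneg τ g)

theorem weightedNorm_mul_mono {σ σ' τ τ' : ℝ} (hσ : σ ≤ σ') (hτ : τ ≤ τ') (f g : 𝓢(R3, ℂ)) :
    weightedNorm σ f * weightedNorm τ g ≤ weightedNorm σ' f * weightedNorm τ' g :=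
  mul_le_mul (weightedNorm_mono hσ f) (weightedNorm_mono hτ g) (weightedNorm_nonneg τ g)
    (weightedNorm_nonneg σ' f)

theorem firstMoment_le_secondMoment (f g : 𝓢(R3, ℂ)) : firstMoment f g ≤ secondMoment f g := by
  have := weightedNorm_mul_mono (one_le_two (α := ℝ)) (le_refl 0) f g
  have := weightedNorm_mul_mono (le_refl 0) (one_le_two (α := ℝ)) f g
  have := weightedNorm_mul_nonneg 1 1 f g
  unfold firstMoment secondMoment
  linarith

theorem firstMoment_mulCoord_right_le {h : R3} (hh : ‖h‖ ≤ 1) (f g : 𝓢(R3, ℂ)) :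
    firstMoment f (mulCoord h g) ≤ secondMoment f g := by
  have h₀ := mul_le_mul_of_nonneg_left (weightedNorm_mulCoord_le 0 hh g) (weightedNorm_nonneg 1 f)
  have h₁ := mul_le_mul_of_nonneg_left (weightedNorm_mulCoord_le 1 hh g) (weightedNorm_nonneg 0 f)
  rw [zero_add] at h₀
  rw [one_add_one_eq_two] at h₁
  have := weightedNorm_mul_nonneg 2 0 f g
  unfold firstMoment secondMoment
  linarith

theorem firstMoment_mulCoord_left_le {h : R3} (hh : ‖h‖ ≤ 1) (f g : 𝓢(R3, ℂ)) :
    firstMoment (mulCoord h f) g ≤ secondMoment f g := by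
  have h₀ := mul_le_mul_of_nonneg_right (weightedNorm_mulCoord_le 0 hh f) (weightedNorm_nonneg 1 g)
  have h₁ := mul_le_mul_of_nonneg_right (weightedNorm_mulCoord_le 1 hh f) (weightedNorm_nonneg 0 g)
  rw [zero_add] at h₀
  rw [one_add_one_eq_two] at h₁
  have := weightedNorm_mul_nonneg 0 2 f g
  unfold firstMoment secondMoment
  linarith

theorem exists_abs_mul_norm_form_inner_mul_le (hm : 0 < m) (hQ : IsSymbol m 1 Q) {h : R3}
    (hh : ‖h‖ ≤ 1) : ∃ C, 0 ≤ C ∧ ∀ t (f g : 𝓢(R3, ℂ)),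
      |t| * ‖form m t (fun p => inner ℝ p.1 h * Q p) f g‖ ≤
        C * firstMoment f g := by
  obtain ⟨A, hA0, hA⟩ := hQ.of_succ.exists_abs_le hm
  obtain ⟨B, hB0, hB⟩ := (hQ.velDeriv h).exists_abs_le hm
  refine ⟨A + B, by positivity, fun t f g => ?_⟩
  have hM (f : 𝓢(R3, ℂ)) : weightedNorm 0 (mulCoord h f) ≤ weightedNorm 1 f := by
    simpa only [zero_add] using weightedNorm_mulCoord_le 0 hh f
  have := weightedNorm_nonneg 0 f
  have := weightedNorm_nonneg 0 g
  calc |t| * ‖form m t (fun p => inner ℝ p.1 h * Q p) f g‖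
    _ ≤ A * (weightedNorm 0 f * weightedNorm 0 (mulCoord h g))
        + A * (weightedNorm 0 (mulCoord h f) * weightedNorm 0 g)
        + B * (weightedNorm 0 f * weightedNorm 0 g) := by
      simp only [weightedNorm_zero]
      exact (abs_mul_norm_form_inner_mul_le hm t h hQ f g).trans (add_le_add (add_le_add
        (norm_form_le hm t hQ.of_succ hA _ _) (norm_form_le hm t hQ.of_succ hA _ _))
        (norm_form_le hm t (hQ.velDeriv h) hB _ _))
    _ ≤ A * (weightedNorm 0 f * weightedNorm 1 g) + A * (weightedNorm 1 f * weightedNorm 0 g)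
        + B * firstMoment f g := by
      gcongr
      · exact hM g
      · exact hM f
      · exact le_add_of_le_of_nonneg (weightedNorm_mul_mono zero_le_one le_rfl f g)
          (weightedNorm_mul_nonneg 0 1 f g)
    _ = (A + B) * firstMoment f g := by
      rw [firstMoment]
      ring

theorem exists_velDeriv_inner_sq_mul_eq (hQ : IsSymbol m 2 Q) (h k : R3) :
    ∃ R, IsSymbol m 1 R ∧ ∀ p ∈ velRegion R3 m,
      velDeriv h (fun p => inner ℝ p.1 k ^ 2 * Q p) p = inner ℝ p.1 k * R p := by
  have hk (n : ℕ) : IsSymbol m n fun p : R3 × ℝ => inner ℝ p.1 k := .inner_left k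
  refine ⟨fun p => (velDeriv h (fun p => inner ℝ p.1 k) p + velDeriv h (fun p => inner ℝ p.1 k) p)
      * Q p + inner ℝ p.1 k * velDeriv h Q p,
    ((((hk 2).velDeriv h).add ((hk 2).velDeriv h)).mul hQ.of_succ).add
      ((hk 1).mul (hQ.velDeriv h)), fun p hp => ?_⟩
  rw [velDeriv_inner_sq_mul h k (hQ.of_succ.differentiableAt hp), two_mul]

/-- Two integrations by parts are possible because `∂_h` maps `⟨v, k⟩ ^ 2 Q` to a multiple of
`⟨v, k⟩`. -/
theorem exists_sq_mul_norm_form_inner_mul_inner_sq_mul_le (hm : 0 < m) (hQ : IsSymbol m 2 Q)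
    {h k : R3} (hh : ‖h‖ ≤ 1) (hk : ‖k‖ ≤ 1) : ∃ C, 0 ≤ C ∧ ∀ t (f g : 𝓢(R3, ℂ)),
      |t| ^ 2 * ‖form m t (fun p => inner ℝ p.1 h * (inner ℝ p.1 k ^ 2 * Q p)) f g‖ ≤
        C * secondMoment f g := by
  have hi : IsSymbol m 1 fun p : R3 × ℝ => inner ℝ p.1 k := .inner_left k
  have hkQ : IsSymbol m 1 fun p => inner ℝ p.1 k * Q p := hi.mul hQ.of_succ
  have hP : IsSymbol m 1 fun p => inner ℝ p.1 k ^ 2 * Q p := by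
    simpa only [sq, mul_assoc] using hi.mul hkQ
  obtain ⟨R, hR, hR_eq⟩ := exists_velDeriv_inner_sq_mul_eq hQ h k
  have h_eqP (t f g) : form m t (fun p => inner ℝ p.1 k ^ 2 * Q p) f g =
      form m t (fun p => inner ℝ p.1 k * (inner ℝ p.1 k * Q p)) f g := by
    simp only [sq, mul_assoc]
  have h_eqR (t f g) : form m t (velDeriv h fun p => inner ℝ p.1 k ^ 2 * Q p) f g =
      form m t (fun p => inner ℝ p.1 k * R p) f g :=
    form_congr t (fun ξ => hR_eq _ (velPoint_mem_velRegion hm ξ)) f g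
  obtain ⟨A, hA0, hA⟩ := exists_abs_mul_norm_form_inner_mul_le hm hkQ hk
  obtain ⟨B, hB0, hB⟩ := exists_abs_mul_norm_form_inner_mul_le hm hR hk
  refine ⟨2 * A + B, by positivity, fun t f g => ?_⟩
  have h₁ := mul_le_mul_of_nonneg_left (abs_mul_norm_form_inner_mul_le hm t h hP f g)
    (abs_nonneg t)
  rw [h_eqP, h_eqP, h_eqR, mul_add, mul_add, ← mul_assoc, ← sq] at h₁
  calc |t| ^ 2 * ‖form m t (fun p => inner ℝ p.1 h * (inner ℝ p.1 k ^ 2 * Q p)) f g‖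
    _ ≤ A * firstMoment f (mulCoord h g) + A * firstMoment (mulCoord h f) g
        + B * firstMoment f g :=
      h₁.trans (add_le_add (add_le_add (hA t _ _) (hA t _ _)) (hB t f g))
    _ ≤ A * secondMoment f g + A * secondMoment f g + B * secondMoment f g := by
      gcongr
      · exact firstMoment_mulCoord_right_le hh f g
      · exact firstMoment_mulCoord_left_le hh f g
      · exact firstMoment_le_secondMoment f g
    _ = (2 * A + B) * secondMoment f g := by ring

theorem exists_sq_mul_norm_form_norm_sq_sq_mul_le (hm : 0 < m) (hQ : IsSymbol m 2 Q) :
    ∃ C, 0 ≤ C ∧ ∀ t (f g : 𝓢(R3, ℂ)),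
      |t| ^ 2 * ‖form m t (fun p => (‖p.1‖ ^ 2) ^ 2 * Q p) f g‖ ≤ C * secondMoment f g := by
  let b := EuclideanSpace.basisFun (Fin 3) ℝ
  have hb (i) : ‖b i‖ ≤ 1 := (b.norm_eq_one i).le
  have hi (n : ℕ) (i) : IsSymbol m n fun p : R3 × ℝ => inner ℝ p.1 (b i) := .inner_left (b i)
  let P (ij : Fin 3 × Fin 3) (p : R3 × ℝ) : ℝ :=
    inner ℝ p.1 (b ij.1) * (inner ℝ p.1 (b ij.2) ^ 2 * (inner ℝ p.1 (b ij.1) * Q p))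
  have hP (ij) : IsSymbol m 0 (P ij) := by
    simpa only [P, sq, mul_assoc] using (hi 0 ij.1).mul ((hi 0 ij.2).mul ((hi 0 ij.2).mul
      ((hi 0 ij.1).mul hQ.of_succ.of_succ)))
  have h_sum (p : R3 × ℝ) : (‖p.1‖ ^ 2) ^ 2 * Q p = ∑ ij, P ij p := by
    have h_norm := b.sum_sq_inner_left p.1
    rw [Fintype.sum_prod_type, sq, ← h_norm, Finset.sum_mul_sum, Finset.sum_mul]
    refine Finset.sum_congr rfl fun i _ => ?_
    rw [Finset.sum_mul]
    refine Finset.sum_congr rfl fun j _ => ?_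
    simp only [P]
    ring
  choose C hC0 hC using fun ij : Fin 3 × Fin 3 =>
    exists_sq_mul_norm_form_inner_mul_inner_sq_mul_le hm ((hi 2 ij.1).mul hQ) (hb ij.1) (hb ij.2)
  refine ⟨∑ ij, C ij, Finset.sum_nonneg fun ij _ => hC0 ij, fun t f g => ?_⟩
  simp only [h_sum]
  rw [form_sum _ hm t fun ij _ => hP ij, Finset.sum_mul]
  refine (mul_le_mul_of_nonneg_left (norm_sum_le _ _) (sq_nonneg _)).trans ?_
  rw [Finset.mul_sum]
  exact Finset.sum_le_sum fun ij _ => hC ij t f g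

theorem secondMoment_truncate_le {σ t : ℝ} (h1 : 1 ≤ σ) (h2 : σ ≤ 2) (ht : 1 ≤ |t|)
    (f g : 𝓢(R3, ℂ)) : secondMoment (truncate t f) (truncate t g) ≤
      3 * (|t| ^ (2 - σ) * (weightedNorm σ f * weightedNorm σ g)) := by
  have h_two (f) := weightedNorm_two_truncate_le (by linarith) h2 ht f
  have h_le {τ} (hτ : τ ≤ σ) (f) := weightedNorm_truncate_le hτ t f
  have := weightedNorm_nonneg
  calc secondMoment (truncate t f) (truncate t g)
    _ ≤ |t| ^ (2 - σ) * weightedNorm σ f * weightedNorm σ g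
        + weightedNorm σ f * weightedNorm σ g
        + weightedNorm σ f * (|t| ^ (2 - σ) * weightedNorm σ g) := by
      refine add_le_add (add_le_add ?_ ?_) ?_ <;>
        refine mul_le_mul ?_ ?_ (weightedNorm_nonneg _ _)
          (by first | exact this _ _ | exact mul_nonneg (by positivity) (this _ _))
      exacts [h_two f, h_le (by linarith) g, h_le h1 f, h_le h1 g, h_le (by linarith) f, h_two g]
    _ ≤ 3 * (|t| ^ (2 - σ) * (weightedNorm σ f * weightedNorm σ g)) := by
      have := le_mul_of_one_le_left (weightedNorm_mul_nonneg σ σ f g)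
        (Real.one_le_rpow ht (sub_nonneg.2 h2))
      linarith

theorem norm_form_le_norm_form_truncate_add (hm : 0 < m) (hQ : IsSymbol m 0 Q) {C : ℝ}
    (hC : ∀ ξ, |Q (velPoint m ξ)| ≤ C) {σ t : ℝ} (h0 : 0 ≤ σ) (h2 : σ ≤ 2) (ht : t ≠ 0)
    (f g : 𝓢(R3, ℂ)) : ‖form m t Q f g‖ ≤ ‖form m t Q (truncate t f) (truncate t g)‖
      + 2 * C * |t| ^ (-σ) * (weightedNorm σ f * weightedNorm σ g) := by
  have := (abs_nonneg _).trans (hC 0)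
  have h_tail := l2norm_sub_truncate_le h0 h2 ht
  have h_left : ‖form m t Q (f - truncate t f) (truncate t g)‖ ≤
      C * (|t| ^ (-σ) * weightedNorm σ f * weightedNorm σ g) := by
    refine (norm_form_le hm t hQ hC _ _).trans ?_
    gcongr
    · exact l2norm_nonneg _
    · exact mul_nonneg (by positivity) (weightedNorm_nonneg σ f)
    · exact h_tail f
    · exact weightedNorm_zero (truncate t g) ▸ weightedNorm_truncate_le h0 t g
  have h_right : ‖form m t Q f (g - truncate t g)‖ ≤
      C * (weightedNorm σ f * (|t| ^ (-σ) * weightedNorm σ g)) := by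
    refine (norm_form_le hm t hQ hC _ _).trans ?_
    gcongr
    · exact l2norm_nonneg _
    · exact weightedNorm_nonneg σ f
    · exact weightedNorm_zero f ▸ weightedNorm_mono h0 f
    · exact h_tail g
  have h_split : form m t Q f g = form m t Q (truncate t f) (truncate t g)
      + form m t Q (f - truncate t f) (truncate t g) + form m t Q f (g - truncate t g) := by
    rw [← form_add_left hm t hQ, add_sub_cancel, ← form_add_right hm t hQ, add_sub_cancel]
  calc ‖form m t Q f g‖
    _ ≤ _ := h_split ▸ norm_add₃_le
    _ ≤ _ := add_le_add_three le_rfl h_left h_right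
    _ = _ := by ring

/-- The truncated data allow two integrations by parts, the tails are small in `L²`. -/
theorem exists_norm_form_high_le (hm : 0 < m) (hQ : IsSymbol m 2 Q) {σ : ℝ} (h1 : 1 ≤ σ)
    (h2 : σ ≤ 2) : ∃ C, 0 ≤ C ∧ ∀ t, 1 ≤ |t| → ∀ f g : 𝓢(R3, ℂ),
      ‖form m t (fun p => (‖p.1‖ ^ 2) ^ 2 * Q p) f g‖ ≤
        C * |t| ^ (-σ) * (weightedNorm σ f * weightedNorm σ g) := by
  have hP : IsSymbol m 0 fun p => (‖p.1‖ ^ 2) ^ 2 * Q p := hQ.of_succ.of_succ.norm_sq_sq_mul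
  obtain ⟨A, hA0, hA⟩ := hP.exists_abs_le hm
  obtain ⟨B, hB0, hB⟩ := exists_sq_mul_norm_form_norm_sq_sq_mul_le hm hQ
  refine ⟨3 * B + 2 * A, by positivity, fun t ht f g => ?_⟩
  have ht0 : 0 < |t| := by linarith
  set P := fun p : R3 × ℝ => (‖p.1‖ ^ 2) ^ 2 * Q p
  have h_near : ‖form m t P (truncate t f) (truncate t g)‖ ≤
      3 * B * |t| ^ (-σ) * (weightedNorm σ f * weightedNorm σ g) := by
    refine le_of_mul_le_mul_left ?_ (pow_pos ht0 2)
    calc |t| ^ 2 * ‖form m t P (truncate t f) (truncate t g)‖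
      _ ≤ B * (3 * (|t| ^ (2 - σ) * (weightedNorm σ f * weightedNorm σ g))) := by
        refine (hB t _ _).trans ?_
        gcongr
        exact secondMoment_truncate_le h1 h2 ht f g
      _ = _ := by
        rw [sub_eq_add_neg, Real.rpow_add ht0, Real.rpow_two]
        ring
  calc ‖form m t P f g‖
    _ ≤ ‖form m t P (truncate t f) (truncate t g)‖
        + 2 * A * |t| ^ (-σ) * (weightedNorm σ f * weightedNorm σ g) :=
      norm_form_le_norm_form_truncate_add hm hP hA (by linarith) h2 (abs_pos.1 ht0) f g
    _ ≤ _ := add_le_add_left h_near _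
    _ = _ := by ring

end HighFrequency

section Decay

variable {m : ℝ} {a : ℝ → ℝ}

/-- With `u = m² / ω² = 1 - |v|²`, the identity `1 = u² (3 - 2u) + (1 - u)² (1 + 2u)` separates low
from high frequencies by polynomials in `u`. -/
theorem form_eq_low_add_high (hm : 0 < m) (ha : IsAmplitude m 0 a) (t : ℝ) (f g : 𝓢(R3, ℂ)) :
    form m t (fun p => a p.2) f g =
      form m t (fun p => p.2 ^ 4 * (m ^ 4 * (3 - 2 * m ^ 2 * p.2 ^ 2) * a p.2)) f g +
      form m t (fun p => (‖p.1‖ ^ 2) ^ 2 * ((1 + 2 * m ^ 2 * p.2 ^ 2) * a p.2)) f g := by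
  have h_low : IsAmplitude m 0 fun y => y ^ 4 * (m ^ 4 * (3 - 2 * m ^ 2 * y ^ 2) * a y) :=
    fun y hy => by
      have := ha y hy
      fun_prop
  have h_high : IsAmplitude m 0 fun y => (1 + 2 * m ^ 2 * y ^ 2) * a y := fun y hy => by
    have := ha y hy
    fun_prop
  rw [← form_add hm t h_low.isSymbol (h_high.isSymbol.norm_sq_sq_mul)]
  refine form_congr t (fun ξ => ?_) f g
  rw [norm_velPoint_sq hm]
  ring

theorem IsAmplitude.exists_norm_form_le_rpow (ha : IsAmplitude m 2 a) (hm : 0 < m) {σ : ℝ}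
    (hσ : 3 / 2 < σ) : ∃ C, 0 ≤ C ∧ ∀ t, 1 ≤ |t| → ∀ f g : 𝓢(R3, ℂ),
      ‖form m t (fun p => a p.2) f g‖ ≤
        C * |t| ^ (-(3 / 2) : ℝ) * (weightedNorm σ f * weightedNorm σ g) := by
  have h_low : IsAmplitude m 2 fun y => m ^ 4 * (3 - 2 * m ^ 2 * y ^ 2) * a y := fun y hy => by
    have := ha y hy
    fun_prop
  have h_high : IsAmplitude m 2 fun y => (1 + 2 * m ^ 2 * y ^ 2) * a y := fun y hy => by
    have := ha y hy
    fun_prop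
  obtain ⟨A, hA0, hA⟩ := h_low.exists_norm_form_low_le hm
  obtain ⟨B, hB0, hB⟩ := exists_norm_form_high_le hm h_high.isSymbol (σ := 3 / 2) (by norm_num)
    (by norm_num)
  obtain ⟨L, hL0, hL⟩ := exists_integral_norm_le hσ
  refine ⟨A * L ^ 2 + B, by positivity, fun t ht f g => ?_⟩
  have h_pow : A / (|t| * √|t|) = A * |t| ^ (-(3 / 2) : ℝ) := by
    have : 0 < |t| := by linarith
    rw [Real.rpow_neg this.le, Real.sqrt_eq_rpow, show (3 / 2 : ℝ) = 1 + 1 / 2 by norm_num,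
      Real.rpow_add this, Real.rpow_one, div_eq_mul_inv]
  have h_int : (∫ x, ‖f x‖) * (∫ x, ‖g x‖) ≤ L * weightedNorm σ f * (L * weightedNorm σ g) :=
    mul_le_mul (hL f) (hL g) (integral_nonneg fun _ => norm_nonneg _)
      (mul_nonneg hL0 (weightedNorm_nonneg σ f))
  rw [form_eq_low_add_high hm ha.of_succ.of_succ]
  calc _ ≤ A / (|t| * √|t|) * ((∫ x, ‖f x‖) * ∫ x, ‖g x‖)
        + B * |t| ^ (-(3 / 2) : ℝ) * (weightedNorm (3 / 2) f * weightedNorm (3 / 2) g) :=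
      norm_add_le_of_le (hA t ht f g) (hB t ht f g)
    _ ≤ A * |t| ^ (-(3 / 2) : ℝ) * (L * weightedNorm σ f * (L * weightedNorm σ g))
        + B * |t| ^ (-(3 / 2) : ℝ) * (weightedNorm σ f * weightedNorm σ g) := by
      rw [h_pow]
      exact add_le_add (mul_le_mul_of_nonneg_left h_int (by positivity))
        (mul_le_mul_of_nonneg_left (weightedNorm_mul_mono hσ.le hσ.le f g) (by positivity))
    _ = _ := by ring

theorem abs_rpow_neg_le {t r : ℝ} (hr : 0 ≤ r) (ht : 1 ≤ |t|) :
    |t| ^ (-r) ≤ 2 ^ r / (1 + |t|) ^ r := by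
  have : 0 < |t| := by linarith
  rw [Real.rpow_neg this.le, ← Real.inv_rpow this.le,
    ← Real.div_rpow zero_le_two (by positivity), inv_eq_one_div]
  gcongr ?_ ^ r
  rw [div_le_div_iff₀ this (by positivity)]
  linarith

theorem IsAmplitude.exists_norm_form_le (ha : IsAmplitude m 2 a) (hm : 0 < m) {σ : ℝ}
    (hσ : 3 / 2 < σ) : ∃ C, 0 ≤ C ∧ ∀ t (f g : 𝓢(R3, ℂ)),
      ‖form m t (fun p => a p.2) f g‖ ≤
        C / (1 + |t|) ^ (3 / 2 : ℝ) * (weightedNorm σ f * weightedNorm σ g) := by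
  have hQ : IsSymbol m 0 fun p : R3 × ℝ => a p.2 := ha.of_succ.of_succ.isSymbol
  obtain ⟨K, hK0, hK⟩ := hQ.exists_abs_le hm
  obtain ⟨A, hA0, hA⟩ := ha.exists_norm_form_le_rpow hm hσ
  refine ⟨2 ^ (3 / 2 : ℝ) * (K + A), by positivity, fun t f g => ?_⟩
  have hw := weightedNorm_mul_nonneg σ σ f g
  rcases le_total |t| 1 with ht | ht
  · calc ‖form m t (fun p => a p.2) f g‖
      _ ≤ K * (weightedNorm 0 f * weightedNorm 0 g) := by
        simpa only [weightedNorm_zero] using norm_form_le hm t hQ hK f g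
      _ ≤ (K + A) * (weightedNorm σ f * weightedNorm σ g) := by
        exact mul_le_mul (le_add_of_nonneg_right hA0)
          (weightedNorm_mul_mono (by linarith) (by linarith) f g)
          (weightedNorm_mul_nonneg 0 0 f g) (by positivity)
      _ ≤ _ := by
        gcongr
        rw [le_div_iff₀ (by positivity), mul_comm]
        gcongr
        linarith
  · calc ‖form m t (fun p => a p.2) f g‖
      _ ≤ A * |t| ^ (-(3 / 2) : ℝ) * (weightedNorm σ f * weightedNorm σ g) := hA t ht f g
      _ ≤ (K + A) * (2 ^ (3 / 2 : ℝ) / (1 + |t|) ^ (3 / 2 : ℝ)) *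
          (weightedNorm σ f * weightedNorm σ g) := by
        gcongr
        · exact le_add_of_nonneg_left hK0
        · exact abs_rpow_neg_le (by norm_num) ht
      _ = _ := by ring

end Decay

/-! ### Fourier multipliers on weighted Sobolev spaces -/

section TemperateGrowth

theorem abs_iteratedDeriv_sin_cos_le (n : ℕ) (x : ℝ) :
    |iteratedDeriv n Real.sin x| ≤ 1 ∧ |iteratedDeriv n Real.cos x| ≤ 1 := by
  induction n with
  | zero => simpa using ⟨Real.abs_sin_le_one x, Real.abs_cos_le_one x⟩
  | succ n ih =>
    rw [Real.iteratedDeriv_add_one_sin, Real.iteratedDeriv_add_one_cos]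
    exact ⟨ih.2, by simpa using ih.1⟩

@[fun_prop]
theorem hasTemperateGrowth_sin : Real.sin.HasTemperateGrowth := by
  refine ⟨Real.contDiff_sin, fun n => ⟨0, 1, fun x => ?_⟩⟩
  rw [norm_iteratedFDeriv_eq_norm_iteratedDeriv]
  simpa using (abs_iteratedDeriv_sin_cos_le n x).1

@[fun_prop]
theorem hasTemperateGrowth_cos : Real.cos.HasTemperateGrowth := by
  refine ⟨Real.contDiff_cos, fun n => ⟨0, 1, fun x => ?_⟩⟩
  rw [norm_iteratedFDeriv_eq_norm_iteratedDeriv]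
  simpa using (abs_iteratedDeriv_sin_cos_le n x).2

variable {E : Type*} [NormedAddCommGroup E] [InnerProductSpace ℝ E] {m : ℝ}

theorem hasTemperateGrowth_one : (1 : E → ℂ).HasTemperateGrowth := .const 1

theorem omega_rpow (hm : 0 < m) (r : ℝ) (ξ : E) :
    omega m ξ ^ r = m ^ r * (1 + ‖(2 * Real.pi / m) • ξ‖ ^ 2) ^ (r / 2) := by
  have h_sq : omega m ξ ^ 2 = m ^ 2 * (1 + ‖(2 * Real.pi / m) • ξ‖ ^ 2) := by
    rw [sq_omega, norm_smul, norm_smul, Real.norm_of_nonneg (by positivity),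
      Real.norm_of_nonneg (by positivity)]
    field_simp
  have h_half {x : ℝ} (hx : 0 ≤ x) : (x ^ 2) ^ (r / 2) = x ^ r := by
    rw [← Real.rpow_natCast_mul hx, Nat.cast_ofNat, mul_div_cancel₀ r two_ne_zero]
  rw [← h_half (omega_pos hm ξ).le, ← h_half hm.le, h_sq,
    Real.mul_rpow (by positivity) (by positivity)]

theorem hasTemperateGrowth_omega_rpow (hm : 0 < m) (r : ℝ) :
    (fun ξ : E => omega m ξ ^ r).HasTemperateGrowth := by
  simp only [omega_rpow hm]
  exact (Function.HasTemperateGrowth.const _).mul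
    ((Function.hasTemperateGrowth_one_add_norm_sq_rpow (H := E) (r / 2)).comp
      (((2 * Real.pi / m) • ContinuousLinearMap.id ℝ E).hasTemperateGrowth))

theorem hasTemperateGrowth_omega (hm : 0 < m) : (omega m : E → ℝ).HasTemperateGrowth := by
  simpa only [Real.rpow_one] using hasTemperateGrowth_omega_rpow (E := E) hm 1

theorem hasTemperateGrowth_inv_omega (hm : 0 < m) :
    (omega m : E → ℝ)⁻¹.HasTemperateGrowth := by
  simpa only [Real.rpow_neg_one] using! hasTemperateGrowth_omega_rpow (E := E) hm (-1)

theorem besselSymbol_eq_omega_rpow (s : ℝ) (ξ : R3) :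
    besselSymbol s ξ = (omega 1 ξ ^ s : ℝ) := by
  rw [besselSymbol, omega_rpow one_pos, div_one, Real.one_rpow, one_mul]

theorem besselSymbol_zero : besselSymbol 0 = 1 := by
  ext ξ
  simp [besselSymbol]

theorem besselSymbol_mul (r s : ℝ) : besselSymbol r * besselSymbol s = besselSymbol (r + s) := by
  ext ξ
  rw [Pi.mul_apply, besselSymbol_eq_omega_rpow, besselSymbol_eq_omega_rpow,
    besselSymbol_eq_omega_rpow, ← Complex.ofReal_mul, ← Real.rpow_add (omega_pos one_pos ξ)]

end TemperateGrowth

section TransposeMultiplier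

variable {E : Type*} [NormedAddCommGroup E] [InnerProductSpace ℝ E] [FiniteDimensional ℝ E]
  [MeasurableSpace E] [BorelSpace E] {a b : E → ℂ}

/-- The transpose, acting on Schwartz functions, of the Fourier multiplier with symbol `a` on
tempered distributions. -/
def dualMult (a : E → ℂ) (φ : 𝓢(E, ℂ)) : 𝓢(E, ℂ) := 𝓕 (SchwartzMap.smulLeftCLM ℂ a (𝓕⁻ φ))

theorem fourierInv_dualMult_apply (ha : a.HasTemperateGrowth) (φ : 𝓢(E, ℂ)) (ξ : E) :
    𝓕⁻ (dualMult a φ) ξ = a ξ * 𝓕⁻ φ ξ := by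
  rw [dualMult, FourierTransform.fourierInv_fourier_eq, SchwartzMap.smulLeftCLM_apply_apply ha,
    smul_eq_mul]

theorem dualMult_dualMult (ha : a.HasTemperateGrowth) (hb : b.HasTemperateGrowth) (φ : 𝓢(E, ℂ)) :
    dualMult a (dualMult b φ) = dualMult (a * b) φ := by
  rw [dualMult, dualMult, dualMult, FourierTransform.fourierInv_fourier_eq,
    SchwartzMap.smulLeftCLM_smulLeftCLM_apply ha hb]

theorem dualMult_sub (ha : a.HasTemperateGrowth) (hb : b.HasTemperateGrowth) (φ : 𝓢(E, ℂ)) :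
    dualMult (a - b) φ = dualMult a φ - dualMult b φ := by
  rw [dualMult, dualMult, dualMult, SchwartzMap.smulLeftCLM_sub ha hb, sub_apply, sub_eq_add_neg,
    FourierTransform.fourier_add, FourierTransform.fourier_neg, sub_eq_add_neg]

theorem dualMult_neg (ha : a.HasTemperateGrowth) (φ : 𝓢(E, ℂ)) :
    dualMult (-a) φ = -dualMult a φ := by
  rw [dualMult, dualMult, SchwartzMap.smulLeftCLM_neg ha, neg_apply, FourierTransform.fourier_neg]

theorem dualMult_smul (ha : a.HasTemperateGrowth) (c : ℂ) (φ : 𝓢(E, ℂ)) :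
    dualMult (c • a) φ = c • dualMult a φ := by
  rw [dualMult, dualMult, SchwartzMap.smulLeftCLM_smul ha, smul_apply,
    FourierTransform.fourier_smul]

theorem dualMult_one (φ : 𝓢(E, ℂ)) : dualMult 1 φ = φ := by
  rw [dualMult, Pi.one_def, SchwartzMap.smulLeftCLM_const, one_smul]
  exact FourierTransform.fourier_fourierInv_eq φ

theorem dualMult_zero (φ : 𝓢(E, ℂ)) : dualMult 0 φ = 0 := by
  rw [← zero_smul ℂ (1 : E → ℂ), dualMult_smul hasTemperateGrowth_one, zero_smul]

theorem l2norm_dualMult_le_mul (ha : a.HasTemperateGrowth) (hb : b.HasTemperateGrowth) {K : ℝ}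
    (h : ∀ ξ, ‖a ξ‖ ≤ K * ‖b ξ‖) (φ : 𝓢(E, ℂ)) :
    l2norm (dualMult a φ) ≤ K * l2norm (dualMult b φ) := by
  rw [← l2norm_fourierInv (dualMult a φ), ← l2norm_fourierInv (dualMult b φ)]
  refine l2norm_le_mul fun ξ => ?_
  rw [fourierInv_dualMult_apply ha, fourierInv_dualMult_apply hb, norm_mul, norm_mul, ← mul_assoc]
  gcongr
  exact h ξ

theorem l2norm_dualMult_le (ha : a.HasTemperateGrowth) {K : ℝ} (h : ∀ ξ, ‖a ξ‖ ≤ K)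
    (φ : 𝓢(E, ℂ)) : l2norm (dualMult a φ) ≤ K * l2norm φ := by
  simpa only [dualMult_one] using
    l2norm_dualMult_le_mul ha hasTemperateGrowth_one (by simpa using h) φ

theorem toTemperedDistribution_dualMult (ha : a.HasTemperateGrowth)
    (g : Lp ℂ 2 (volume : Measure E)) (φ : 𝓢(E, ℂ)) :
    (g : 𝓢'(E, ℂ)) (dualMult a φ) =
      ∫ ξ, a ξ * 𝓕⁻ φ ξ * (𝓕 g : Lp ℂ 2 (volume : Measure E)) ξ := by
  change (𝓕 (g : 𝓢'(E, ℂ))) (SchwartzMap.smulLeftCLM ℂ a (𝓕⁻ φ)) = _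
  rw [Lp.fourier_toTemperedDistribution_eq, Lp.toTemperedDistribution_apply]
  simp only [SchwartzMap.smulLeftCLM_apply_apply ha, smul_eq_mul]

theorem integrable_symbol_mul (ha : a.HasTemperateGrowth) (ψ : 𝓢(E, ℂ))
    (G : Lp ℂ 2 (volume : Measure E)) : Integrable fun ξ => a ξ * ψ ξ * G ξ := by
  refine (((SchwartzMap.smulLeftCLM ℂ a ψ).memLp 2 volume).integrable_mul (Lp.memLp G)).congr
    (.of_forall fun ξ => ?_)
  simp only [Pi.mul_apply, SchwartzMap.smulLeftCLM_apply_apply ha, smul_eq_mul]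

theorem norm_toTemperedDistribution_dualMult_le (ha : a.HasTemperateGrowth) {K : ℝ}
    (hK : ∀ ξ, ‖a ξ‖ ≤ K) (g : Lp ℂ 2 (volume : Measure E)) (φ : 𝓢(E, ℂ)) :
    ‖(g : 𝓢'(E, ℂ)) (dualMult a φ)‖ ≤ (eLpNorm (fun ξ => a ξ *
      (𝓕 g : Lp ℂ 2 (volume : Measure E)) ξ) 2 volume).toReal * l2norm φ := by
  set G := (𝓕 g : Lp ℂ 2 (volume : Measure E))
  have h_meas : AEStronglyMeasurable (fun ξ => a ξ * G ξ) volume :=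
    ha.1.continuous.aestronglyMeasurable.mul (Lp.aestronglyMeasurable G)
  have h_memLp : MemLp (fun ξ => a ξ * G ξ) 2 volume := by
    refine (Lp.memLp G).of_le_mul (c := K) h_meas (.of_forall fun ξ => ?_)
    rw [norm_mul]
    gcongr
    exact hK ξ
  have h := enorm_integral_mul_le h_meas (𝓕⁻ φ : 𝓢(E, ℂ)).continuous.aestronglyMeasurable
  rw [← ofReal_l2norm, l2norm_fourierInv, ← ENNReal.ofReal_toReal h_memLp.2.ne,
    ← ENNReal.ofReal_mul ENNReal.toReal_nonneg, ← ofReal_norm, ENNReal.ofReal_le_ofReal_iff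
      (mul_nonneg ENNReal.toReal_nonneg (l2norm_nonneg _))] at h
  simpa only [toTemperedDistribution_dualMult ha, mul_right_comm] using h

end TransposeMultiplier

section WeightedBessel

variable {s σ r : ℝ} {u v : Dist} {a b : R3 → ℂ}

theorem weightedBessel_apply (s σ : ℝ) (u : Dist) (φ : 𝓢(R3, ℂ)) :
    weightedBessel s σ u φ =
      u (dualMult (besselSymbol s) (SchwartzMap.smulLeftCLM ℂ (weight σ) φ)) := rfl

theorem weightedBessel_zero_zero (u : Dist) : weightedBessel 0 0 u = u := by
  ext φ
  rw [weightedBessel_apply, smul_weight_zero, besselSymbol_zero, dualMult_one]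

theorem apply_dualMult_besselSymbol_mul (h : weightedBessel s σ u = v)
    (ha : a.HasTemperateGrowth) (φ : 𝓢(R3, ℂ)) :
    u (dualMult (besselSymbol s * a) φ) =
      v (SchwartzMap.smulLeftCLM ℂ (weight (-σ)) (dualMult a φ)) := by
  rw [← h, weightedBessel_apply, smul_weight_weight, add_neg_cancel, smul_weight_zero,
    dualMult_dualMult (hasTemperateGrowth_besselSymbol s) ha]

theorem apply_dualMult_dualMult_besselSymbol (h : weightedBessel s σ u = v)
    (ha : a.HasTemperateGrowth) (hb : b.HasTemperateGrowth)
    (hab : a * besselSymbol r = besselSymbol s * b) (φ : 𝓢(R3, ℂ)) :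
    u (dualMult a (dualMult (besselSymbol r) φ)) =
      v (SchwartzMap.smulLeftCLM ℂ (weight (-σ)) (dualMult b φ)) := by
  rw [dualMult_dualMult ha (hasTemperateGrowth_besselSymbol r), hab,
    apply_dualMult_besselSymbol_mul h hb]

theorem sobolevNorm_zero_zero_le_one (u : Dist) : sobolevNorm 0 0 u ≤ sobolevNorm 1 0 u := by
  rcases eq_or_ne (sobolevNorm 1 0 u) ∞ with h | h
  · exact h ▸ le_top
  obtain ⟨f, hf, hf_norm⟩ := exists_eq_of_sobolevNorm_lt_top h.lt_top
  rw [hf_norm, ← ofReal_norm]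
  refine sobolevNorm_le_of_forall (norm_nonneg _) fun φ => ?_
  have h_growth := hasTemperateGrowth_besselSymbol (-1)
  rw [weightedBessel_apply, smul_weight_zero, ← add_neg_cancel (1 : ℝ), ← besselSymbol_mul,
    apply_dualMult_besselSymbol_mul hf h_growth, neg_zero, smul_weight_zero]
  refine (norm_toTemperedDistribution_apply_le f _).trans ?_
  gcongr
  rw [← one_mul (l2norm φ)]
  refine l2norm_dualMult_le h_growth (fun ξ => ?_) φ
  rw [besselSymbol, Complex.norm_real, Real.norm_of_nonneg (by positivity)]
  exact Real.rpow_le_one_of_one_le_of_nonpos (by nlinarith [sq_nonneg ‖(2 * Real.pi) • ξ‖])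
    (by norm_num)

theorem sobolevNorm_zero_weight_le (hσ : 0 ≤ σ) (s : ℝ) (u : Dist) :
    sobolevNorm s 0 u ≤ sobolevNorm s σ u := by
  rcases eq_or_ne (sobolevNorm s σ u) ∞ with h | h
  · exact h ▸ le_top
  obtain ⟨f, hf, hf_norm⟩ := exists_eq_of_sobolevNorm_lt_top h.lt_top
  rw [hf_norm, ← ofReal_norm]
  refine sobolevNorm_le_of_forall (norm_nonneg _) fun φ => ?_
  rw [weightedBessel_apply, smul_weight_zero, ← mul_one (besselSymbol s),
    apply_dualMult_besselSymbol_mul hf hasTemperateGrowth_one, dualMult_one, ← weightedNorm_zero φ]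
  refine (norm_toTemperedDistribution_apply_le f _).trans ?_
  gcongr
  exact weightedNorm_mono (neg_nonpos.2 hσ) φ

theorem energyNorm_zero_le (hσ : 0 ≤ σ) (Ψ : Phase) : energyNorm 0 Ψ ≤ energyNorm σ Ψ :=
  add_le_add (sobolevNorm_zero_weight_le hσ 1 Ψ.1) (sobolevNorm_zero_weight_le hσ 0 Ψ.2)

end WeightedBessel

section DifferentiableSymbols

variable {E : Type*} [NormedAddCommGroup E] [NormedSpace ℝ E]

/-- A family `a` of symbols which is differentiable in time with derivative `a'`, and whose
derivative is dominated, uniformly in time, by a symbol. -/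
structure SymbolPath (a a' : ℝ → E → ℂ) : Prop where
  growth : ∀ t, (a t).HasTemperateGrowth
  growth_deriv : ∀ t, (a' t).HasTemperateGrowth
  hasDerivAt : ∀ t ξ, HasDerivAt (fun s => a s ξ) (a' t ξ) t
  bound : ∃ h : E → ℂ, h.HasTemperateGrowth ∧ ∀ t ξ, ‖a' t ξ‖ ≤ ‖h ξ‖

namespace SymbolPath

variable {a a' : ℝ → E → ℂ}

theorem norm_sub_le (ha : SymbolPath a a') {h : E → ℂ} (hb : ∀ t ξ, ‖a' t ξ‖ ≤ ‖h ξ‖)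
    (s t : ℝ) (ξ : E) : ‖a s ξ - a t ξ‖ ≤ |s - t| * ‖h ξ‖ := by
  rw [mul_comm, ← Real.norm_eq_abs]
  exact convex_univ.norm_image_sub_le_of_norm_hasDerivWithin_le
    (fun x _ => (ha.hasDerivAt x ξ).hasDerivWithinAt) (fun x _ => hb x ξ) (mem_univ t) (mem_univ s)

theorem comp_const_sub (ha : SymbolPath a a') (T : ℝ) :
    SymbolPath (fun s => a (T - s)) (fun s => -a' (T - s)) where
  growth t := ha.growth _
  growth_deriv t := (ha.growth_deriv _).neg
  hasDerivAt t ξ := (ha.hasDerivAt (T - t) ξ).comp_const_sub T t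
  bound := by
    obtain ⟨h, hh, hb⟩ := ha.bound
    exact ⟨h, hh, fun t ξ => by simpa only [Pi.neg_apply, norm_neg] using hb (T - t) ξ⟩

end SymbolPath

theorem SymbolPath.hasDerivAt_apply_Lp {E : Type*} [NormedAddCommGroup E] [InnerProductSpace ℝ E]
    [FiniteDimensional ℝ E] [MeasurableSpace E] [BorelSpace E] {a a' : ℝ → E → ℂ}
    (ha : SymbolPath a a') (g : Lp ℂ 2 (volume : Measure E)) (φ : 𝓢(E, ℂ)) (t : ℝ) :
    HasDerivAt (fun s => (g : 𝓢'(E, ℂ)) (dualMult (a s) φ))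
      ((g : 𝓢'(E, ℂ)) (dualMult (a' t) φ)) t := by
  obtain ⟨h, hh, hb⟩ := ha.bound
  set G := (𝓕 g : Lp ℂ 2 (volume : Measure E))
  simp only [toTemperedDistribution_dualMult (ha.growth _),
    toTemperedDistribution_dualMult (ha.growth_deriv _)]
  refine (hasDerivAt_integral_of_dominated_loc_of_deriv_le
    (bound := fun ξ => ‖h ξ * 𝓕⁻ φ ξ * G ξ‖) univ_mem
    (.of_forall fun s => (integrable_symbol_mul (ha.growth s) _ G).aestronglyMeasurable)
    (integrable_symbol_mul (ha.growth t) _ G)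
    (integrable_symbol_mul (ha.growth_deriv t) _ G).aestronglyMeasurable
    (.of_forall fun ξ s _ => ?_) (integrable_symbol_mul hh _ G).norm
    (.of_forall fun ξ s _ => ((ha.hasDerivAt s ξ).mul_const _).mul_const _)).2
  simp only [norm_mul]
  gcongr
  exact hb s ξ

end DifferentiableSymbols

section TimeDependentPairing

variable {a a' : ℝ → R3 → ℂ}

theorem SymbolPath.hasDerivAt_apply (ha : SymbolPath a a') {s : ℝ} {u : Dist}
    (hu : sobolevNorm s 0 u < ∞) (φ : 𝓢(R3, ℂ)) (t : ℝ) :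
    HasDerivAt (fun r => u (dualMult (a r) φ)) (u (dualMult (a' t) φ)) t := by
  obtain ⟨f, hf, -⟩ := exists_eq_of_sobolevNorm_lt_top hu
  have h_bessel := hasTemperateGrowth_besselSymbol (-s)
  have h_apply {c : R3 → ℂ} (hc : c.HasTemperateGrowth) :
      u (dualMult c φ) = (f : Dist) (dualMult c (dualMult (besselSymbol (-s)) φ)) := by
    have h_mul : c = besselSymbol s * (c * besselSymbol (-s)) := by
      rw [mul_left_comm, besselSymbol_mul, add_neg_cancel, besselSymbol_zero, mul_one]
    rw [dualMult_dualMult hc h_bessel, ← smul_weight_zero (dualMult (c * _) φ), ← neg_zero,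
      ← apply_dualMult_besselSymbol_mul hf (hc.mul h_bessel), ← h_mul]
  simp only [h_apply (ha.growth _), h_apply (ha.growth_deriv _)]
  exact ha.hasDerivAt_apply_Lp f _ t

theorem norm_apply_le_of_sobolevNorm_lt {u : Dist} {K : ℝ}
    (hu : sobolevNorm 0 0 u < ENNReal.ofReal K) (φ : 𝓢(R3, ℂ)) : ‖u φ‖ ≤ K * l2norm φ := by
  obtain ⟨g, hg, hg_norm⟩ := exists_eq_of_sobolevNorm_lt_top (hu.trans ENNReal.ofReal_lt_top)
  rw [hg_norm, ← ofReal_norm, ENNReal.ofReal_lt_ofReal_iff_of_nonneg (norm_nonneg g)] at hu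
  rw [← weightedBessel_zero_zero u, hg]
  exact (norm_toTemperedDistribution_apply_le g φ).trans
    (mul_le_mul_of_nonneg_right hu.le (l2norm_nonneg φ))

theorem SymbolPath.hasDerivAt_apply_sub_sub (ha : SymbolPath a a') {u : ℝ → Dist} {t : ℝ}
    (hu : Tendsto (fun s => sobolevNorm 0 0 (u s - u t)) (𝓝 t) (𝓝 0)) (φ : 𝓢(R3, ℂ)) :
    HasDerivAt (fun s => (u s - u t) (dualMult (a s) φ - dualMult (a t) φ)) 0 t := by
  obtain ⟨h, hh, hb⟩ := ha.bound
  rw [hasDerivAt_iff_isLittleO, Asymptotics.isLittleO_iff]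
  intro ε hε
  set L := l2norm (dualMult h φ)
  have hL : 0 ≤ L := l2norm_nonneg _
  have h_ratio : 0 < ε / (L + 1) := by positivity
  filter_upwards [hu.eventually_lt_const (ENNReal.ofReal_pos.2 h_ratio)] with s hs
  have h_sub : l2norm (dualMult (a s) φ - dualMult (a t) φ) ≤ |s - t| * L := by
    rw [← dualMult_sub (ha.growth s) (ha.growth t)]
    exact l2norm_dualMult_le_mul ((ha.growth s).sub (ha.growth t)) hh (ha.norm_sub_le hb s t) φ
  simp only [sub_self, map_zero, smul_zero, sub_zero, Real.norm_eq_abs]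
  calc _ ≤ ε / (L + 1) * l2norm (dualMult (a s) φ - dualMult (a t) φ) :=
        norm_apply_le_of_sobolevNorm_lt hs _
    _ ≤ ε / (L + 1) * (|s - t| * (L + 1)) := by gcongr; exact h_sub.trans (by gcongr; linarith)
    _ = ε * |s - t| := by field_simp

theorem SymbolPath.hasDerivAt_pairing (ha : SymbolPath a a') {u : ℝ → Dist} {t : ℝ}
    (hu : sobolevNorm 0 0 (u t) < ∞)
    (hu_cont : Tendsto (fun s => sobolevNorm 0 0 (u s - u t)) (𝓝 t) (𝓝 0)) (φ : 𝓢(R3, ℂ)) {d : ℂ}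
    (hd : HasDerivAt (fun s => u s (dualMult (a t) φ)) d t) :
    HasDerivAt (fun s => u s (dualMult (a s) φ)) (d + u t (dualMult (a' t) φ)) t := by
  have h_sum := ((hd.add (ha.hasDerivAt_apply hu φ t)).add
    (ha.hasDerivAt_apply_sub_sub hu_cont φ)).sub_const (u t (dualMult (a t) φ))
  rw [add_zero] at h_sum
  refine h_sum.congr_of_eventuallyEq (.of_forall fun s => ?_)
  simp only [Pi.add_apply, map_sub, sub_apply]
  ring

end TimeDependentPairing

section StrongContinuity

variable {E : Type*} [NormedAddCommGroup E]

theorem tendsto_eLpNorm_mul_zero {ι α : Type*} [MeasurableSpace α] {μ : Measure α} {l : Filter ι}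
    [l.IsCountablyGenerated] {p : ℝ≥0∞} (hp_zero : p ≠ 0) (hp_top : p ≠ ∞) {c : ι → α → ℂ}
    {G : α → ℂ} {K : ℝ} (hc : ∀ i, AEStronglyMeasurable (c i) μ) (hK : ∀ i x, ‖c i x‖ ≤ K)
    (h_lim : ∀ x, Tendsto (fun i => c i x) l (𝓝 0)) (hG : MemLp G p μ) :
    Tendsto (fun i => eLpNorm (fun x => c i x * G x) p μ) l (𝓝 0) := by
  have hp : 0 < p.toReal := ENNReal.toReal_pos hp_zero hp_top
  have h_pow_zero : (0 : ℝ≥0∞) ^ p.toReal = 0 := ENNReal.zero_rpow_of_pos hp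
  have h_lintegral : Tendsto (fun i => ∫⁻ x, ‖c i x * G x‖ₑ ^ p.toReal ∂μ) l (𝓝 0) := by
    rw [← lintegral_zero (μ := μ)]
    refine tendsto_lintegral_filter_of_dominated_convergence'
      (fun x => (ENNReal.ofReal K * ‖G x‖ₑ) ^ p.toReal)
      (.of_forall fun i => ((hc i).mul hG.1).enorm.pow_const _)
      (.of_forall fun i => .of_forall fun x => ?_) ?_ (.of_forall fun x => ?_)
    · rw [enorm_mul, ← ofReal_norm (c i x)]
      gcongr
      exact hK i x
    · simp only [ENNReal.mul_rpow_of_nonneg _ _ hp.le]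
      rw [lintegral_const_mul' _ _ (by finiteness)]
      exact ENNReal.mul_ne_top (by finiteness)
        (lintegral_rpow_enorm_lt_top_of_eLpNorm_lt_top hp_zero hp_top hG.2).ne
    · have h_enorm : Tendsto (fun i => ‖c i x * G x‖ₑ) l (𝓝 0) := by
        simpa using ((h_lim x).mul_const (G x)).enorm
      simpa only [h_pow_zero] using h_enorm.ennrpow_const p.toReal
  simp only [eLpNorm_eq_lintegral_rpow_enorm_toReal hp_zero hp_top]
  simpa [hp] using h_lintegral.ennrpow_const (1 / p.toReal)

/-- A uniformly bounded family of symbols which is pointwise continuous in time. -/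
structure BddSymbolPath [NormedSpace ℝ E] (a : ℝ → E → ℂ) : Prop where
  growth : ∀ t, (a t).HasTemperateGrowth
  continuous : ∀ ξ, Continuous fun t => a t ξ
  bound : ∃ K, 0 ≤ K ∧ ∀ t ξ, ‖a t ξ‖ ≤ K

theorem BddSymbolPath.exists_tendsto_norm_apply_sub_le [InnerProductSpace ℝ E]
    [FiniteDimensional ℝ E] [MeasurableSpace E] [BorelSpace E] {a : ℝ → E → ℂ}
    (ha : BddSymbolPath a) (f : Lp ℂ 2 (volume : Measure E)) (t : ℝ) :
    ∃ N : ℝ → ℝ, (∀ r, 0 ≤ N r) ∧ Tendsto N (𝓝 t) (𝓝 0) ∧ ∀ r φ,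
      ‖(f : 𝓢'(E, ℂ)) (dualMult (a r) φ) - (f : 𝓢'(E, ℂ)) (dualMult (a t) φ)‖ ≤
        N r * l2norm φ := by
  obtain ⟨K, -, hK⟩ := ha.bound
  have h_growth (r : ℝ) : (a r - a t).HasTemperateGrowth := (ha.growth r).sub (ha.growth t)
  have h_bound (r : ℝ) (ξ : E) : ‖(a r - a t) ξ‖ ≤ K + K :=
    (norm_sub_le _ _).trans (add_le_add (hK r ξ) (hK t ξ))
  refine ⟨fun r => (eLpNorm (fun ξ => (a r - a t) ξ *
    (𝓕 f : Lp ℂ 2 (volume : Measure E)) ξ) 2 volume).toReal, fun _ => ENNReal.toReal_nonneg,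
    (ENNReal.tendsto_toReal ENNReal.zero_ne_top).comp ?_, fun r φ => ?_⟩
  · refine tendsto_eLpNorm_mul_zero two_ne_zero ENNReal.ofNat_ne_top
      (fun r => (h_growth r).1.continuous.aestronglyMeasurable) h_bound (fun ξ => ?_) (Lp.memLp _)
    simpa using ((ha.continuous ξ).tendsto t).sub_const (a t ξ)
  · rw [← map_sub, ← dualMult_sub (ha.growth r) (ha.growth t)]
    exact norm_toTemperedDistribution_dualMult_le (h_growth r) (h_bound r) f φ

variable {a b : ℝ → R3 → ℂ} {s τ : ℝ} {f g : Lp ℂ 2 (volume : Measure R3)}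

theorem sobolevNorm_le_of_apply_eq_add {u : Dist} {A B : 𝓢(R3, ℂ) → 𝓢(R3, ℂ)} {K L : ℝ}
    (hu : ∀ φ, weightedBessel s τ u φ = (f : Dist) (A φ) + (g : Dist) (B φ))
    (hK : 0 ≤ K) (hL : 0 ≤ L) (hA : ∀ φ, l2norm (A φ) ≤ K * l2norm φ)
    (hB : ∀ φ, l2norm (B φ) ≤ L * l2norm φ) :
    sobolevNorm s τ u ≤ ENNReal.ofReal (‖f‖ * K + ‖g‖ * L) := by
  refine sobolevNorm_le_of_forall (by positivity) fun φ => ?_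
  rw [hu]
  calc _ ≤ ‖(f : Dist) (A φ)‖ + ‖(g : Dist) (B φ)‖ := norm_add_le _ _
    _ ≤ ‖f‖ * l2norm (A φ) + ‖g‖ * l2norm (B φ) :=
      add_le_add (norm_toTemperedDistribution_apply_le f _)
        (norm_toTemperedDistribution_apply_le g _)
    _ ≤ ‖f‖ * (K * l2norm φ) + ‖g‖ * (L * l2norm φ) := by gcongr; exacts [hA φ, hB φ]
    _ = _ := by ring

variable {u : ℝ → Dist}

theorem sobolevNorm_lt_top_of_bddSymbolPath (ha : BddSymbolPath a) (hb : BddSymbolPath b)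
    (hu : ∀ t φ, weightedBessel s 0 (u t) φ =
      (f : Dist) (dualMult (a t) φ) + (g : Dist) (dualMult (b t) φ)) (t : ℝ) :
    sobolevNorm s 0 (u t) < ∞ := by
  obtain ⟨K, hK, haK⟩ := ha.bound
  obtain ⟨L, hL, hbL⟩ := hb.bound
  exact (sobolevNorm_le_of_apply_eq_add (hu t) hK hL (l2norm_dualMult_le (ha.growth t) (haK t))
    (l2norm_dualMult_le (hb.growth t) (hbL t))).trans_lt ENNReal.ofReal_lt_top

theorem tendsto_sobolevNorm_sub_of_bddSymbolPath (ha : BddSymbolPath a) (hb : BddSymbolPath b)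
    (hu : ∀ t φ, weightedBessel s 0 (u t) φ =
      (f : Dist) (dualMult (a t) φ) + (g : Dist) (dualMult (b t) φ)) (t : ℝ) :
    Tendsto (fun r => sobolevNorm s 0 (u r - u t)) (𝓝 t) (𝓝 0) := by
  obtain ⟨M, hM, hM_lim, haM⟩ := ha.exists_tendsto_norm_apply_sub_le f t
  obtain ⟨N, hN, hN_lim, hbN⟩ := hb.exists_tendsto_norm_apply_sub_le g t
  have h_lim : Tendsto (fun r => ENNReal.ofReal (M r + N r)) (𝓝 t) (𝓝 0) := by
    simpa using ENNReal.tendsto_ofReal (hM_lim.add hN_lim)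
  refine tendsto_of_tendsto_of_tendsto_of_le_of_le tendsto_const_nhds h_lim (fun _ => zero_le)
    fun r => sobolevNorm_le_of_forall (add_nonneg (hM r) (hN r)) fun φ => ?_
  rw [map_sub, sub_apply, hu, hu, add_sub_add_comm, add_mul]
  exact (norm_add_le _ _).trans (add_le_add (haM r φ) (hbN r φ))

end StrongContinuity

/-! ### The propagator -/

section TrigonometricSymbols

variable {E : Type*} [NormedAddCommGroup E] [InnerProductSpace ℝ E] {m : ℝ}

/-- The symbol `cos (t ω)`. -/
def cosSymbol (m t : ℝ) (ξ : E) : ℂ := (Real.cos (t * omega m ξ) : ℝ)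

/-- The symbol `a sin (t ω)`; the propagator involves `a = ω⁻¹` and `a = -ω`. -/
def sinSymbol (m : ℝ) (a : E → ℝ) (t : ℝ) (ξ : E) : ℂ := (a ξ * Real.sin (t * omega m ξ) : ℝ)

/-- The symbol `-ω²` of `Δ - m²`. -/
def laplaceSymbol (m : ℝ) (ξ : E) : ℂ := (-omega m ξ ^ 2 : ℝ)

theorem hasTemperateGrowth_ofReal_comp {a : E → ℝ} (ha : a.HasTemperateGrowth) :
    (fun ξ => (a ξ : ℂ)).HasTemperateGrowth :=
  Function.Complex.hasTemperateGrowth_ofReal.comp ha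

theorem hasTemperateGrowth_cosSymbol (hm : 0 < m) (t : ℝ) :
    (cosSymbol m t : E → ℂ).HasTemperateGrowth :=
  hasTemperateGrowth_ofReal_comp
    (hasTemperateGrowth_cos.comp ((Function.HasTemperateGrowth.const t).mul
      (hasTemperateGrowth_omega hm)))

theorem hasTemperateGrowth_sinSymbol (hm : 0 < m) {a : E → ℝ} (ha : a.HasTemperateGrowth)
    (t : ℝ) : (sinSymbol m a t).HasTemperateGrowth :=
  hasTemperateGrowth_ofReal_comp (ha.mul
    (hasTemperateGrowth_sin.comp ((Function.HasTemperateGrowth.const t).mul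
      (hasTemperateGrowth_omega hm))))

theorem hasTemperateGrowth_laplaceSymbol (hm : 0 < m) :
    (laplaceSymbol m : E → ℂ).HasTemperateGrowth := by
  refine hasTemperateGrowth_ofReal_comp
    (.neg ?_)
  simpa only [sq] using! (hasTemperateGrowth_omega hm).mul (hasTemperateGrowth_omega hm)

theorem norm_cosSymbol_le (m t : ℝ) (ξ : E) : ‖cosSymbol m t ξ‖ ≤ 1 := by
  rw [cosSymbol, Complex.norm_real]
  exact Real.abs_cos_le_one _

theorem norm_sinSymbol_le (a : E → ℝ) (t : ℝ) (ξ : E) : ‖sinSymbol m a t ξ‖ ≤ |a ξ| := by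
  rw [sinSymbol, Complex.norm_real, Real.norm_eq_abs, abs_mul]
  exact mul_le_of_le_one_right (abs_nonneg _) (Real.abs_sin_le_one _)

theorem cosSymbol_zero (m : ℝ) : (cosSymbol m 0 : E → ℂ) = 1 := by
  ext ξ
  simp [cosSymbol]

theorem sinSymbol_zero (m : ℝ) (a : E → ℝ) : sinSymbol m a 0 = 0 := by
  ext ξ
  simp [sinSymbol]

theorem laplaceSymbol_mul_sinSymbol (hm : 0 < m) (t : ℝ) :
    laplaceSymbol m * sinSymbol m (omega m : E → ℝ)⁻¹ t = sinSymbol m (-omega m) t := by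
  ext ξ
  have := (omega_pos hm ξ).ne'
  simp only [laplaceSymbol, sinSymbol, Pi.mul_apply, Pi.inv_apply, Pi.neg_apply]
  norm_cast
  field_simp

theorem hasDerivAt_mul_sin_mul (a t w : ℝ) :
    HasDerivAt (fun s => a * Real.sin (s * w)) (a * w * Real.cos (t * w)) t := by
  refine (((hasDerivAt_mul_const w).sin).const_mul a).congr_deriv ?_
  ring

theorem hasDerivAt_cos_mul (t w : ℝ) :
    HasDerivAt (fun s => Real.cos (s * w)) (-w * Real.sin (t * w)) t := by
  refine ((hasDerivAt_mul_const w).cos).congr_deriv ?_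
  ring

theorem symbolPath_cosSymbol (hm : 0 < m) :
    SymbolPath (cosSymbol m) (sinSymbol m (-omega m : E → ℝ)) where
  growth := hasTemperateGrowth_cosSymbol hm
  growth_deriv := hasTemperateGrowth_sinSymbol hm (hasTemperateGrowth_omega hm).neg
  hasDerivAt t ξ := (hasDerivAt_cos_mul t (omega m ξ)).ofReal_comp
  bound := ⟨_, hasTemperateGrowth_ofReal_comp (hasTemperateGrowth_omega hm), fun t ξ => by
    simpa using norm_sinSymbol_le (-omega m) t ξ⟩

theorem symbolPath_sinSymbol_inv_omega (hm : 0 < m) :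
    SymbolPath (sinSymbol m (omega m : E → ℝ)⁻¹) (cosSymbol m) where
  growth := hasTemperateGrowth_sinSymbol hm (hasTemperateGrowth_inv_omega hm)
  growth_deriv := hasTemperateGrowth_cosSymbol hm
  hasDerivAt t ξ := by
    have h_deriv := (hasDerivAt_mul_sin_mul (omega m ξ)⁻¹ t (omega m ξ)).ofReal_comp
    rwa [inv_mul_cancel₀ (omega_pos hm ξ).ne', one_mul] at h_deriv
  bound := ⟨1, hasTemperateGrowth_one, fun t ξ => by simpa using norm_cosSymbol_le m t ξ⟩

theorem symbolPath_sinSymbol_neg_omega (hm : 0 < m) :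
    SymbolPath (sinSymbol m (-omega m : E → ℝ)) fun t => laplaceSymbol m * cosSymbol m t where
  growth := hasTemperateGrowth_sinSymbol hm (hasTemperateGrowth_omega hm).neg
  growth_deriv t := (hasTemperateGrowth_laplaceSymbol hm).mul (hasTemperateGrowth_cosSymbol hm t)
  hasDerivAt t ξ := by
    refine (hasDerivAt_mul_sin_mul (-omega m ξ) t (omega m ξ)).ofReal_comp.congr_deriv ?_
    rw [Pi.mul_apply, laplaceSymbol, cosSymbol, ← Complex.ofReal_mul, neg_mul, ← sq]
  bound := ⟨_, hasTemperateGrowth_laplaceSymbol hm, fun t ξ => by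
    rw [Pi.mul_apply, norm_mul]
    exact mul_le_of_le_one_right (norm_nonneg _) (norm_cosSymbol_le m t ξ)⟩

theorem bddSymbolPath_cosSymbol (hm : 0 < m) : BddSymbolPath (cosSymbol m : ℝ → E → ℂ) where
  growth := hasTemperateGrowth_cosSymbol hm
  continuous ξ := by unfold cosSymbol; fun_prop
  bound := ⟨1, zero_le_one, norm_cosSymbol_le m⟩

theorem bddSymbolPath_sinSymbol (hm : 0 < m) {a : E → ℝ} (ha : a.HasTemperateGrowth) {K : ℝ}
    (hK : ∀ ξ, |a ξ| ≤ K) : BddSymbolPath (sinSymbol m a) where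
  growth := hasTemperateGrowth_sinSymbol hm ha
  continuous ξ := by unfold sinSymbol; fun_prop
  bound := ⟨K, (abs_nonneg _).trans (hK 0), fun t ξ => (norm_sinSymbol_le a t ξ).trans (hK ξ)⟩

end TrigonometricSymbols

section FrequencyRatio

variable {E : Type*} [NormedAddCommGroup E] [InnerProductSpace ℝ E] {μ ν : ℝ}

/-- The ratio `ω_μ / ω_ν` of the frequencies of two masses, as a function of `y = 1 / ω_ν`. -/
def freqRatio (μ ν y : ℝ) : ℝ := √(1 + (μ ^ 2 - ν ^ 2) * y ^ 2)

theorem freqRatio_inv_omega (hμ : 0 < μ) (hν : 0 < ν) (ξ : E) :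
    freqRatio μ ν (omega ν ξ)⁻¹ = omega μ ξ / omega ν ξ := by
  have := (omega_pos hν ξ).ne'
  rw [freqRatio, ← Real.sqrt_sq (div_pos (omega_pos hμ ξ) (omega_pos hν ξ)).le]
  congr 1
  rw [div_pow, sq_omega μ, inv_pow, ← div_eq_mul_inv, eq_div_iff (by positivity), add_mul,
    div_mul_cancel₀ _ (by positivity), sq_omega ν]
  ring

theorem one_add_sq_sub_sq_mul_sq_pos (hμ : 0 < μ) (hν : 0 < ν) {y : ℝ} (hy : y ∈ Icc 0 ν⁻¹) :
    0 < 1 + (μ ^ 2 - ν ^ 2) * y ^ 2 := by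
  have h_le : ν ^ 2 * y ^ 2 ≤ 1 := by
    rw [← mul_pow]
    exact pow_le_one₀ (mul_nonneg hν.le hy.1) ((le_inv_mul_iff₀ hν).1 (by simpa using hy.2))
  rcases hy.1.eq_or_lt with rfl | hy_pos
  · norm_num
  · nlinarith [mul_pos (pow_pos hμ 2) (pow_pos hy_pos 2)]

theorem isAmplitude_freqRatio (hμ : 0 < μ) (hν : 0 < ν) (n : ℕ) :
    IsAmplitude ν n (freqRatio μ ν) := fun y hy =>
  ContDiffAt.sqrt (by fun_prop) (one_add_sq_sub_sq_mul_sq_pos hμ hν hy).ne'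

theorem isAmplitude_neg_inv_freqRatio (hμ : 0 < μ) (hν : 0 < ν) (n : ℕ) :
    IsAmplitude ν n fun y => -(freqRatio μ ν y)⁻¹ := fun y hy =>
  ((isAmplitude_freqRatio hμ hν n y hy).inv
    (Real.sqrt_pos.2 (one_add_sq_sub_sq_mul_sq_pos hμ hν hy)).ne').neg

theorem hasTemperateGrowth_omega_div_omega (hμ : 0 < μ) (hν : 0 < ν) :
    (omega μ / omega ν : E → ℝ).HasTemperateGrowth := by
  rw [div_eq_mul_inv]
  exact (hasTemperateGrowth_omega hμ).mul (hasTemperateGrowth_inv_omega hν)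

theorem exists_abs_omega_div_omega_le [FiniteDimensional ℝ E] (hμ : 0 < μ) (hν : 0 < ν) :
    ∃ K, ∀ ξ : E, |(omega μ / omega ν : E → ℝ) ξ| ≤ K := by
  obtain ⟨K, -, hK⟩ := (isAmplitude_freqRatio hμ hν 0).isSymbol.exists_abs_le (E := E) hν
  refine ⟨K, fun ξ => ?_⟩
  rw [Pi.div_apply, ← freqRatio_inv_omega hμ hν]
  exact hK ξ

end FrequencyRatio

section Propagator

variable {m : ℝ}

/-- The propagator `(cos (t ω), ω⁻¹ sin (t ω); -ω sin (t ω), cos (t ω))` of the free Klein-Gordon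
equation, as a matrix of Fourier multipliers. -/
def propagator (m t : ℝ) (Ψ : Phase) : Phase :=
  (fourierMultiplierCLM ℂ (cosSymbol m t) Ψ.1 +
      fourierMultiplierCLM ℂ (sinSymbol m (omega m)⁻¹ t) Ψ.2,
    fourierMultiplierCLM ℂ (sinSymbol m (-omega m) t) Ψ.1 +
      fourierMultiplierCLM ℂ (cosSymbol m t) Ψ.2)

theorem propagator_fst_apply (m t : ℝ) (Ψ : Phase) (φ : 𝓢(R3, ℂ)) :
    (propagator m t Ψ).1 φ = Ψ.1 (dualMult (cosSymbol m t) φ) +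
      Ψ.2 (dualMult (sinSymbol m (omega m)⁻¹ t) φ) := rfl

theorem propagator_snd_apply (m t : ℝ) (Ψ : Phase) (φ : 𝓢(R3, ℂ)) :
    (propagator m t Ψ).2 φ = Ψ.1 (dualMult (sinSymbol m (-omega m) t) φ) +
      Ψ.2 (dualMult (cosSymbol m t) φ) := rfl

theorem propagator_zero (m : ℝ) (Ψ : Phase) : propagator m 0 Ψ = Ψ := by
  ext φ
  · rw [propagator_fst_apply, cosSymbol_zero, sinSymbol_zero, dualMult_one, dualMult_zero, map_zero,
      add_zero]
  · rw [propagator_snd_apply, cosSymbol_zero, sinSymbol_zero, dualMult_one, dualMult_zero, map_zero,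
      zero_add]

theorem laplacian_sub_apply (m : ℝ) (u : Dist) (φ : 𝓢(R3, ℂ)) :
    (Δ u - (m : ℂ) ^ 2 • u) φ = u (dualMult (laplaceSymbol m) φ) := by
  have h_sq : (fun ξ : R3 => ((‖ξ‖ ^ 2 : ℝ) : ℂ)).HasTemperateGrowth :=
    hasTemperateGrowth_ofReal_comp (Function.hasTemperateGrowth_norm_sq R3)
  have h_symbol : laplaceSymbol m = (-(2 * Real.pi : ℂ) ^ 2) • (fun ξ : R3 => ((‖ξ‖ ^ 2 : ℝ) : ℂ)) -
      (m : ℂ) ^ 2 • (1 : R3 → ℂ) := by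
    ext ξ
    simp only [laplaceSymbol, sq_omega, norm_smul, Pi.sub_apply, Pi.smul_apply, Pi.one_apply,
      smul_eq_mul, mul_pow, Real.norm_eq_abs, sq_abs]
    push_cast
    ring
  have h_smul {a : R3 → ℂ} (ha : a.HasTemperateGrowth) (c : ℂ) : (c • a).HasTemperateGrowth :=
    (Function.HasTemperateGrowth.const c).mul ha
  rw [h_symbol, dualMult_sub (h_smul h_sq _) (h_smul hasTemperateGrowth_one _), dualMult_smul h_sq,
    dualMult_smul hasTemperateGrowth_one, dualMult_one, laplacian_eq_fourierMultiplierCLM, map_sub,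
    map_smul, map_smul]
  change (-(2 * Real.pi) ^ 2 : ℝ) • (u (dualMult _ φ)) - _ = _
  rw [Complex.real_smul]
  push_cast
  rfl

theorem neg_I_mul_freeHamiltonian_fst_apply (m : ℝ) (Ψ : Phase) (φ : 𝓢(R3, ℂ)) :
    -Complex.I * (freeHamiltonian m Ψ).1 φ = Ψ.2 φ := by
  change -Complex.I * (Complex.I * Ψ.2 φ) = Ψ.2 φ
  rw [← mul_assoc, neg_mul, Complex.I_mul_I, neg_neg, one_mul]

theorem neg_I_mul_freeHamiltonian_snd_apply (m : ℝ) (Ψ : Phase) (φ : 𝓢(R3, ℂ)) :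
    -Complex.I * (freeHamiltonian m Ψ).2 φ = Ψ.1 (dualMult (laplaceSymbol m) φ) := by
  rw [← laplacian_sub_apply]
  change -Complex.I * (Complex.I * (Δ Ψ.1 - (m : ℂ) ^ 2 • Ψ.1) φ) = _
  rw [← mul_assoc, neg_mul, Complex.I_mul_I, neg_neg, one_mul]

variable {σ : ℝ} {Ψ : Phase} {f g : Dist}

theorem weightedBessel_propagator_fst (hm : 0 < m) (hf : weightedBessel 1 σ Ψ.1 = f)
    (hg : weightedBessel 0 σ Ψ.2 = g) (τ t : ℝ) (φ : 𝓢(R3, ℂ)) :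
    weightedBessel 1 τ (propagator m t Ψ).1 φ =
      f (SchwartzMap.smulLeftCLM ℂ (weight (-σ))
        (dualMult (cosSymbol m t) (SchwartzMap.smulLeftCLM ℂ (weight τ) φ))) +
      g (SchwartzMap.smulLeftCLM ℂ (weight (-σ))
        (dualMult (sinSymbol m (omega 1 / omega m) t)
          (SchwartzMap.smulLeftCLM ℂ (weight τ) φ))) := by
  have h_cos := hasTemperateGrowth_cosSymbol (E := R3) hm t
  rw [weightedBessel_apply, propagator_fst_apply,
    apply_dualMult_dualMult_besselSymbol hf h_cos h_cos (mul_comm _ _),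
    apply_dualMult_dualMult_besselSymbol hg
      (hasTemperateGrowth_sinSymbol hm (hasTemperateGrowth_inv_omega hm) t)
      (hasTemperateGrowth_sinSymbol hm (hasTemperateGrowth_omega_div_omega one_pos hm) t)]
  ext ξ
  simp only [sinSymbol, besselSymbol_zero, besselSymbol_eq_omega_rpow, Real.rpow_one, Pi.mul_apply,
    Pi.inv_apply, Pi.div_apply, Pi.one_apply]
  push_cast
  ring

theorem weightedBessel_propagator_snd (hm : 0 < m) (hf : weightedBessel 1 σ Ψ.1 = f)
    (hg : weightedBessel 0 σ Ψ.2 = g) (τ t : ℝ) (φ : 𝓢(R3, ℂ)) :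
    weightedBessel 0 τ (propagator m t Ψ).2 φ =
      f (SchwartzMap.smulLeftCLM ℂ (weight (-σ))
        (dualMult (sinSymbol m (-(omega m / omega 1)) t)
          (SchwartzMap.smulLeftCLM ℂ (weight τ) φ))) +
      g (SchwartzMap.smulLeftCLM ℂ (weight (-σ))
        (dualMult (cosSymbol m t) (SchwartzMap.smulLeftCLM ℂ (weight τ) φ))) := by
  have h_cos := hasTemperateGrowth_cosSymbol (E := R3) hm t
  rw [weightedBessel_apply, propagator_snd_apply,
    apply_dualMult_dualMult_besselSymbol hg h_cos h_cos (mul_comm _ _),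
    apply_dualMult_dualMult_besselSymbol hf
      (hasTemperateGrowth_sinSymbol hm (hasTemperateGrowth_omega hm).neg t)
      (hasTemperateGrowth_sinSymbol hm (hasTemperateGrowth_omega_div_omega hm one_pos).neg t)]
  ext ξ
  have := (omega_pos one_pos ξ).ne'
  simp only [sinSymbol, besselSymbol_zero, besselSymbol_eq_omega_rpow, Real.rpow_one, Pi.mul_apply,
    Pi.neg_apply, Pi.div_apply, Pi.one_apply, mul_one]
  norm_cast
  field_simp

end Propagator

section WellPosedness

variable {m : ℝ}

theorem isFreeSolution_propagator (hm : 0 < m) {Ψ : Phase} (hΨ : Ψ ∈ energySpace 0) :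
    IsFreeSolution m fun t => propagator m t Ψ := by
  obtain ⟨h_fst, h_snd⟩ := ENNReal.add_lt_top.1 hΨ
  obtain ⟨f, hf, -⟩ := exists_eq_of_sobolevNorm_lt_top h_fst
  obtain ⟨g, hg, -⟩ := exists_eq_of_sobolevNorm_lt_top h_snd
  obtain ⟨K, hK⟩ := exists_abs_omega_div_omega_le (E := R3) one_pos hm
  obtain ⟨L, hL⟩ := exists_abs_omega_div_omega_le (E := R3) hm one_pos
  have h_cos := bddSymbolPath_cosSymbol (E := R3) hm
  have h_sin₁ := bddSymbolPath_sinSymbol hm (hasTemperateGrowth_omega_div_omega one_pos hm) hK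
  have h_sin₂ := bddSymbolPath_sinSymbol hm (hasTemperateGrowth_omega_div_omega hm one_pos).neg
    fun ξ => (abs_neg _).trans_le (hL ξ)
  have h_apply_fst := weightedBessel_propagator_fst hm hf hg 0
  have h_apply_snd := weightedBessel_propagator_snd hm hf hg 0
  simp only [neg_zero, smul_weight_zero] at h_apply_fst h_apply_snd
  refine ⟨fun t => ENNReal.add_lt_top.2
    ⟨sobolevNorm_lt_top_of_bddSymbolPath h_cos h_sin₁ h_apply_fst t,
      sobolevNorm_lt_top_of_bddSymbolPath h_sin₂ h_cos h_apply_snd t⟩,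
    fun t => ?_, fun t φ => ?_, fun t φ => ?_⟩
  · simpa [energyNorm] using
      (tendsto_sobolevNorm_sub_of_bddSymbolPath h_cos h_sin₁ h_apply_fst t).add
        (tendsto_sobolevNorm_sub_of_bddSymbolPath h_sin₂ h_cos h_apply_snd t)
  · rw [neg_I_mul_freeHamiltonian_fst_apply]
    exact ((symbolPath_cosSymbol hm).hasDerivAt_apply h_fst φ t).add
      ((symbolPath_sinSymbol_inv_omega hm).hasDerivAt_apply h_snd φ t)
  · have h_laplace := hasTemperateGrowth_laplaceSymbol (E := R3) hm
    rw [neg_I_mul_freeHamiltonian_snd_apply, propagator_fst_apply,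
      dualMult_dualMult (h_cos.growth t) h_laplace, mul_comm (cosSymbol m t),
      dualMult_dualMult ((symbolPath_sinSymbol_inv_omega hm).growth t) h_laplace,
      mul_comm (sinSymbol m _ t), laplaceSymbol_mul_sinSymbol hm]
    exact ((symbolPath_sinSymbol_neg_omega hm).hasDerivAt_apply h_fst φ t).add
      ((symbolPath_cosSymbol hm).hasDerivAt_apply h_snd φ t)

theorem sobolevNorm_fst_le_energyNorm (Ψ : Phase) : sobolevNorm 0 0 Ψ.1 ≤ energyNorm 0 Ψ :=
  (sobolevNorm_zero_zero_le_one Ψ.1).trans le_self_add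

theorem sobolevNorm_snd_le_energyNorm (σ : ℝ) (Ψ : Phase) :
    sobolevNorm 0 σ Ψ.2 ≤ energyNorm σ Ψ := le_add_self

namespace IsFreeSolution

variable {Ψ : ℝ → Phase}

theorem tendsto_sobolevNorm_fst_sub (h : IsFreeSolution m Ψ) (t : ℝ) :
    Tendsto (fun s => sobolevNorm 0 0 ((Ψ s).1 - (Ψ t).1)) (𝓝 t) (𝓝 0) :=
  tendsto_of_tendsto_of_tendsto_of_le_of_le tendsto_const_nhds (h.continuous t)
    (fun _ => zero_le) fun s => sobolevNorm_fst_le_energyNorm (Ψ s - Ψ t)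

theorem tendsto_sobolevNorm_snd_sub (h : IsFreeSolution m Ψ) (t : ℝ) :
    Tendsto (fun s => sobolevNorm 0 0 ((Ψ s).2 - (Ψ t).2)) (𝓝 t) (𝓝 0) :=
  tendsto_of_tendsto_of_tendsto_of_le_of_le tendsto_const_nhds (h.continuous t)
    (fun _ => zero_le) fun s => sobolevNorm_snd_le_energyNorm 0 (Ψ s - Ψ t)

/-- The test functions solve the backward equation, which is dual to the equation for `Ψ`. -/
theorem hasDerivAt_propagator_fst_apply (h : IsFreeSolution m Ψ) (hm : 0 < m) (T t : ℝ)
    (φ : 𝓢(R3, ℂ)) : HasDerivAt (fun s => (propagator m (T - s) (Ψ s)).1 φ) 0 t := by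
  have h_cos := symbolPath_cosSymbol (E := R3) hm
  have h_sin := symbolPath_sinSymbol_inv_omega (E := R3) hm
  have h_fst := h.equation_fst t (dualMult (cosSymbol m (T - t)) φ)
  have h_snd := h.equation_snd t (dualMult (sinSymbol m (omega m)⁻¹ (T - t)) φ)
  rw [neg_I_mul_freeHamiltonian_fst_apply] at h_fst
  rw [neg_I_mul_freeHamiltonian_snd_apply,
    dualMult_dualMult (hasTemperateGrowth_laplaceSymbol hm) (h_sin.growth _),
    laplaceSymbol_mul_sinSymbol hm] at h_snd
  refine (((h_cos.comp_const_sub T).hasDerivAt_pairing (u := fun s => (Ψ s).1)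
    ((sobolevNorm_fst_le_energyNorm _).trans_lt (h.mem t)) (h.tendsto_sobolevNorm_fst_sub t) φ
    h_fst).add ((h_sin.comp_const_sub T).hasDerivAt_pairing (u := fun s => (Ψ s).2)
    ((sobolevNorm_snd_le_energyNorm 0 _).trans_lt (h.mem t)) (h.tendsto_sobolevNorm_snd_sub t) φ
    h_snd)).congr_deriv ?_
  rw [dualMult_neg (h_cos.growth_deriv _), dualMult_neg (h_sin.growth_deriv _), map_neg, map_neg]
  ring

theorem fst_eq_propagator_fst (h : IsFreeSolution m Ψ) (hm : 0 < m) (T : ℝ) :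
    (Ψ T).1 = (propagator m T (Ψ 0)).1 := by
  ext φ
  have h_deriv := fun t => h.hasDerivAt_propagator_fst_apply hm T t φ
  have h_const := is_const_of_deriv_eq_zero (fun t => (h_deriv t).differentiableAt)
    (fun t => (h_deriv t).deriv) T 0
  simpa only [sub_self, sub_zero, propagator_zero] using h_const

theorem eq_propagator (h : IsFreeSolution m Ψ) (hm : 0 < m) (T : ℝ) :
    Ψ T = propagator m T (Ψ 0) := by
  refine Prod.ext (h.fst_eq_propagator_fst hm T) (ContinuousLinearMap.ext fun φ => ?_)
  have h_deriv := h.equation_fst T φ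
  have h_deriv_propagator := (isFreeSolution_propagator hm (h.mem 0)).equation_fst T φ
  rw [neg_I_mul_freeHamiltonian_fst_apply] at h_deriv h_deriv_propagator
  simp only [← h.fst_eq_propagator_fst hm] at h_deriv_propagator
  exact h_deriv.unique h_deriv_propagator

end IsFreeSolution

end WellPosedness

section Decay

variable {m σ : ℝ}

theorem integral_mul_smul_dualMult {a : R3 → ℂ} (ha : a.HasTemperateGrowth) (σ : ℝ)
    (χ φ : 𝓢(R3, ℂ)) :
    ∫ x, χ x * SchwartzMap.smulLeftCLM ℂ (weight σ) (dualMult a φ) x =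
      ∫ ξ, a ξ * (𝓕⁻ φ ξ * 𝓕 (SchwartzMap.smulLeftCLM ℂ (weight σ) χ) ξ) := by
  calc _ = ∫ x, SchwartzMap.smulLeftCLM ℂ (weight σ) χ x *
        𝓕 (SchwartzMap.smulLeftCLM ℂ a (𝓕⁻ φ)) x := by
        simp only [SchwartzMap.smulLeftCLM_apply_apply (hasTemperateGrowth_weight σ), smul_eq_mul,
          dualMult, mul_assoc, mul_left_comm (χ _)]
    _ = ∫ ξ, 𝓕 (SchwartzMap.smulLeftCLM ℂ (weight σ) χ) ξ *
        SchwartzMap.smulLeftCLM ℂ a (𝓕⁻ φ) ξ := (SchwartzMap.integral_fourier_mul_eq _ _).symm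
    _ = _ := by
        congr 1 with ξ
        rw [SchwartzMap.smulLeftCLM_apply_apply ha, smul_eq_mul]
        ring

theorem l2norm_smul_dualMult_smul_le {a : R3 → ℂ} (ha : a.HasTemperateGrowth) {K : ℝ}
    (hK : 0 ≤ K) (h : ∀ f g : 𝓢(R3, ℂ),
      ‖∫ ξ, a ξ * (𝓕⁻ f ξ * 𝓕 g ξ)‖ ≤ K * (weightedNorm σ f * weightedNorm σ g))
    (φ : 𝓢(R3, ℂ)) : l2norm (SchwartzMap.smulLeftCLM ℂ (weight (-σ))
      (dualMult a (SchwartzMap.smulLeftCLM ℂ (weight (-σ)) φ))) ≤ K * l2norm φ := by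
  refine l2norm_le_of_forall (mul_nonneg hK (l2norm_nonneg _)) fun χ => ?_
  rw [integral_mul_smul_dualMult ha]
  refine (h _ _).trans_eq ?_
  simp only [weightedNorm, smul_weight_weight, add_neg_cancel, smul_weight_zero, mul_assoc]

theorem integral_cosSymbol_mul (hm : 0 < m) (t : ℝ) (f g : 𝓢(R3, ℂ)) :
    ∫ ξ, cosSymbol m t ξ * (𝓕⁻ f ξ * 𝓕 g ξ) =
      (form m t (fun _ => 1) f g + form m (-t) (fun _ => 1) f g) / 2 := by
  have h_symbol : IsSymbol m 0 fun _ : R3 × ℝ => (1 : ℝ) := fun _ _ => contDiffAt_const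
  rw [form, form, ← integral_add (integrable_phase_mul h_symbol hm t _ _)
    (integrable_phase_mul h_symbol hm (-t) _ _), ← integral_div]
  congr 1 with ξ
  simp only [cosSymbol, phase, Complex.ofReal_cos, Complex.cos]
  push_cast
  ring_nf

theorem integral_sinSymbol_mul (hm : 0 < m) {a : R3 → ℝ} {b : ℝ → ℝ} (hb : IsAmplitude m 0 b)
    (hab : ∀ ξ, b (omega m ξ)⁻¹ = a ξ) (t : ℝ) (f g : 𝓢(R3, ℂ)) :
    ∫ ξ, sinSymbol m a t ξ * (𝓕⁻ f ξ * 𝓕 g ξ) =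
      (form m (-t) (fun p => b p.2) f g - form m t (fun p => b p.2) f g) * (Complex.I / 2) := by
  rw [form, form, ← integral_sub (integrable_phase_mul hb.isSymbol hm (-t) _ _)
    (integrable_phase_mul hb.isSymbol hm t _ _), ← integral_mul_const]
  congr 1 with ξ
  simp only [velPoint, hab, sinSymbol, phase, Complex.ofReal_mul, Complex.ofReal_sin, Complex.sin]
  push_cast
  ring_nf

theorem exists_norm_integral_cosSymbol_le (hm : 0 < m) (hσ : 3 / 2 < σ) :
    ∃ C, 0 ≤ C ∧ ∀ t (f g : 𝓢(R3, ℂ)), ‖∫ ξ, cosSymbol m t ξ * (𝓕⁻ f ξ * 𝓕 g ξ)‖ ≤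
      C / (1 + |t|) ^ (3 / 2 : ℝ) * (weightedNorm σ f * weightedNorm σ g) := by
  have h_amplitude : IsAmplitude m 2 fun _ => 1 := fun _ _ => contDiffAt_const
  obtain ⟨C, hC, h⟩ := h_amplitude.exists_norm_form_le hm hσ
  refine ⟨C, hC, fun t f g => ?_⟩
  have h_neg := h (-t) f g
  rw [abs_neg] at h_neg
  rw [integral_cosSymbol_mul hm, norm_div, Complex.norm_ofNat]
  linarith [h t f g, norm_add_le (form m t (fun _ => 1) f g) (form m (-t) (fun _ => 1) f g)]

theorem exists_norm_integral_sinSymbol_le (hm : 0 < m) (hσ : 3 / 2 < σ) {a : R3 → ℝ} {b : ℝ → ℝ}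
    (hb : IsAmplitude m 2 b) (hab : ∀ ξ, b (omega m ξ)⁻¹ = a ξ) :
    ∃ C, 0 ≤ C ∧ ∀ t (f g : 𝓢(R3, ℂ)), ‖∫ ξ, sinSymbol m a t ξ * (𝓕⁻ f ξ * 𝓕 g ξ)‖ ≤
      C / (1 + |t|) ^ (3 / 2 : ℝ) * (weightedNorm σ f * weightedNorm σ g) := by
  obtain ⟨C, hC, h⟩ := hb.exists_norm_form_le hm hσ
  refine ⟨C, hC, fun t f g => ?_⟩
  have h_neg := h (-t) f g
  rw [abs_neg] at h_neg
  rw [integral_sinSymbol_mul hm hb.of_succ.of_succ hab, norm_mul, norm_div, Complex.norm_ofNat,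
    Complex.norm_I]
  linarith [h t f g,
    norm_sub_le (form m (-t) (fun p => b p.2) f g) (form m t (fun p => b p.2) f g)]

theorem exists_energyNorm_propagator_le (hm : 0 < m) (hσ : 3 / 2 < σ) :
    ∃ C : ℝ, 0 < C ∧ ∀ Ψ ∈ energySpace σ, ∀ t : ℝ, energyNorm (-σ) (propagator m t Ψ) ≤
      ENNReal.ofReal (C / (1 + |t|) ^ (3 / 2 : ℝ)) * energyNorm σ Ψ := by
  obtain ⟨A, hA, h_cos⟩ := exists_norm_integral_cosSymbol_le hm hσ
  obtain ⟨B, hB, h_sin₁⟩ := exists_norm_integral_sinSymbol_le hm hσ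
    (isAmplitude_freqRatio one_pos hm 2) (freqRatio_inv_omega one_pos hm)
  obtain ⟨D, hD, h_sin₂⟩ := exists_norm_integral_sinSymbol_le (a := -(omega m / omega 1)) hm hσ
    (isAmplitude_neg_inv_freqRatio one_pos hm 2) fun ξ => by
      rw [freqRatio_inv_omega one_pos hm, inv_div, Pi.neg_apply, Pi.div_apply]
  refine ⟨A + B + D + 1, by positivity, fun Ψ hΨ t => ?_⟩
  obtain ⟨f, hf, hf_norm⟩ := exists_eq_of_sobolevNorm_lt_top (ENNReal.add_lt_top.1 hΨ).1
  obtain ⟨g, hg, hg_norm⟩ := exists_eq_of_sobolevNorm_lt_top (ENNReal.add_lt_top.1 hΨ).2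
  set T := (1 + |t|) ^ (3 / 2 : ℝ)
  have hT : 0 < T := by positivity
  have h_cos_le := l2norm_smul_dualMult_smul_le (hasTemperateGrowth_cosSymbol hm t)
    (div_nonneg hA hT.le) (h_cos t)
  have h_fst := sobolevNorm_le_of_apply_eq_add (weightedBessel_propagator_fst hm hf hg (-σ) t)
    (div_nonneg hA hT.le) (div_nonneg hB hT.le) h_cos_le
    (l2norm_smul_dualMult_smul_le (hasTemperateGrowth_sinSymbol hm
      (hasTemperateGrowth_omega_div_omega one_pos hm) t) (div_nonneg hB hT.le) (h_sin₁ t))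
  have h_snd := sobolevNorm_le_of_apply_eq_add (weightedBessel_propagator_snd hm hf hg (-σ) t)
    (div_nonneg hD hT.le) (div_nonneg hA hT.le)
    (l2norm_smul_dualMult_smul_le (hasTemperateGrowth_sinSymbol hm
      (hasTemperateGrowth_omega_div_omega hm one_pos).neg t) (div_nonneg hD hT.le) (h_sin₂ t))
    h_cos_le
  refine (add_le_add h_fst h_snd).trans ?_
  rw [energyNorm, hf_norm, hg_norm, ← ofReal_norm, ← ofReal_norm,
    ← ENNReal.ofReal_add (norm_nonneg _) (norm_nonneg _), ← ENNReal.ofReal_mul (by positivity),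
    ← ENNReal.ofReal_add (by positivity) (by positivity)]
  refine ENNReal.ofReal_le_ofReal ?_
  calc _ = ((A + D) * ‖f‖ + (A + B) * ‖g‖) / T := by ring
    _ ≤ ((A + B + D + 1) * ‖f‖ + (A + B + D + 1) * ‖g‖) / T := by
      have h_fst_const : A + D ≤ A + B + D + 1 := by linarith
      have h_snd_const : A + B ≤ A + B + D + 1 := by linarith
      gcongr
    _ = _ := by ring

end Decay

end KleinGordon

end

theorem proposition2p1 (m : ℝ) (hm : 0 < m) :
    -- the group `𝓤₀(t)`: `𝓤₀(t)Ψ₀` is the value at `t` of the unique solution starting at `Ψ₀`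
    (∀ Ψ₀ ∈ KleinGordon.energySpace 0,
      ∃! Ψ : ℝ → KleinGordon.Phase, KleinGordon.IsFreeSolution m Ψ ∧ Ψ 0 = Ψ₀) ∧
    -- the decay of `𝓤₀(t)Ψ₀`
    ∀ σ : ℝ, 3 / 2 < σ → ∃ C : ℝ, 0 < C ∧
      ∀ Ψ₀ ∈ KleinGordon.energySpace σ, Ψ₀ ∈ KleinGordon.energySpace 0 ∧
        ∀ Ψ : ℝ → KleinGordon.Phase, KleinGordon.IsFreeSolution m Ψ → Ψ 0 = Ψ₀ →
          ∀ t : ℝ, KleinGordon.energyNorm (-σ) (Ψ t) ≤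
            ENNReal.ofReal (C / (1 + |t|) ^ (3 / 2 : ℝ)) * KleinGordon.energyNorm σ Ψ₀ := by
  refine ⟨fun Ψ₀ h₀ => ⟨fun t => KleinGordon.propagator m t Ψ₀,
    ⟨KleinGordon.isFreeSolution_propagator hm h₀, KleinGordon.propagator_zero m Ψ₀⟩,
    fun Ψ hΨ => funext fun t => ?_⟩, fun σ hσ => ?_⟩
  · rw [hΨ.1.eq_propagator hm t, hΨ.2]
  · obtain ⟨C, hC, h⟩ := KleinGordon.exists_energyNorm_propagator_le hm hσ
    refine ⟨C, hC, fun Ψ₀ h₀ => ⟨lt_of_le_of_lt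
      (KleinGordon.energyNorm_zero_le (by linarith) Ψ₀) h₀, fun Ψ hΨ hΨ₀ t => ?_⟩⟩
    rw [hΨ.eq_propagator hm t, hΨ₀]
    exact h Ψ₀ h₀ t
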